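/- Let $d\in\{2,3\}$, $\Omega=(0,1)^d$, $T>0$, and let $(\mathsf u,\mathsf p)$ solve the Stokes problem $\mathsf u_t-\Delta \mathsf u+\nabla \mathsf p=f$ in $\Omega\times(0,T]$, $\nabla\!\cdot \mathsf u=0$ in $\Omega\times[0,T]$, $\mathsf u|_{\partial\Omega}=0$, $\mathsf u|_{t=0}=\mathsf u_0$, where $\mathsf p$ has zero mean. **Operators and norms.** Let $A=\prod_{i=1}^d(1-\partial_{ii})$ act on zero-mean functions, with homogeneous Neumann conditions: $A\phi=g$ means that $\phi\in L^2(\Omega)$ has zero mean and, for $d=3$, that there are $p_2,p_1\in L^2(\Omega)$ with $\phi-\partial_{zz}\phi=p_2$, $\partial_z\phi|_{z=0,1}=0$; $p_2-\partial_{yy}p_2=p_1$, $\partial_yp_2|_{y=0,1}=0$; $p_1-\partial_{xx}p_1=g$, $\partial_xp_1|_{x=0,1}=0$ (for $d=2$ the $z$-factor is omitted). Let $Y$ be the space of zero-mean $q\in L^2(\Omega)$ with $$\|q\|_A^2=\|q\|_{L^2}^2+\|\nabla q\|_{L^2}^2+\sum_{i<j}\|\partial_{ij}q\|_{L^2}^2+\sum_{i<j<k}\|\partial_{ijk}q\|_{L^2}^2<\infty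 ,$$ which is the extension of the norm $\langle Aq,q\rangle^{1/2}$. For $\tau>0$ put $Bv=\partial_{xxyy}v$ if $d=2$ and $Bv=(\partial_{xxyy}+\partial_{yyzz}+\partial_{zzxx}-\frac\tau2\partial_{xxyyzz})v$ if $d=3$, $D(B)=\{v\in H^1_0(\Omega)^d: Bv\in L^2(\Omega)^d\}$, and $$\|v\|_B^2=\langle v,Bv\rangle=\sum_{i<j}\|\partial_{ij}v\|_{L^2}^2+\frac\tau2\sum_{i<j<k}\|\partial_{ijk}v\|_{L^2}^2 .$$ Finally $\|v\|_{H^1}=\|\nabla v\|_{L^2}$ for $v\in H^1_0(\Omega)^d$. **Scheme.** Let $t_k=k\tau$, $f^{k+1/2}=f(t_{k+1/2})$. Start from $u^0=\mathsf u_0$, $p^{-1/2}=\mathsf p(0)$ and a given $\phi^{-1/2}$. For $k=0,\dots,K-1$ set $p^{\star,k+1/2}=p^{k-1/2}+\phi^{k-1/2}$; compute $u^{k+1}$ as follows. If $d=2$ (Peaceman–Rachford), $$\tfrac{u^{k+1/2}-u^k}{\tau/2}-\partial_{xx}u^{k+1/2}-\partial_{yy}u^k+\nabla p^{\star,k+1/2}=f^{k+1/2},\quad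 u^{k+1/2}|_{x=0,1}=0,$$ $$\tfrac{u^{k+1}-u^{k+1/2}}{\tau/2}-\partial_{xx}u^{k+1/2}-\partial_{yy}u^{k+1}+\nabla p^{\star,k+1/2}=f^{k+1/2},\quad u^{k+1}|_{y=0,1}=0.$$ If $d=3$ (Douglas), $$\tfrac{\xi^{k+1}-u^k}\tau-\Delta u^k+\nabla p^{\star,k+1/2}=f^{k+1/2},$$ $$\tfrac{\eta^{k+1}-\xi^{k+1}}\tau-\tfrac12\partial_{xx}(\eta^{k+1}-u^k)=0,\quad \eta^{k+1}|_{x=0,1}=0,$$ $$\tfrac{\zeta^{k+1}-\eta^{k+1}}\tau-\tfrac12\partial_{yy}(\zeta^{k+1}-u^k)=0,\quad \zeta^{k+1}|_{y=0,1}=0,$$ $$\tfrac{u^{k+1}-\zeta^{k+1}}\tau-\tfrac12\partial_{zz}(u^{k+1}-u^k)=0,\quad u^{k+1}|_{z=0,1}=0.$$ Then solve $A\phi^{k+1/2}=-\frac1\tau\nabla\!\cdot u^{k+1}$ and set $p^{k+1/2}=p^{k-1/2}+\phi^{k+1/2}$ (the standard form, $\chi=0$). All equations hold in $L^2(\Omega)$.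 Put $e^k=\mathsf u(t_k)-u^k$, $\delta e^k=e^k-e^{k-1}$, $\epsilon^{k+1/2}=\mathsf p(t_{k+1/2})-p^{k+1/2}$. **Theorem.** Assume $f\in W^{2,\infty}(0,T;L^2(\Omega)^d)$, $\mathsf u\in W^{2,\infty}(0,T;H^2(\Omega)^d)\cap W^{1,\infty}(0,T;D(B))$ (if $d=3$, for every $\tau>0$) and $\mathsf p\in W^{2,\infty}(0,T;Y)$. For every $c_0$ there is a constant $c$, depending only on $c_0$, $T$, $f$, $\mathsf u$ and $\mathsf p$, such that for every $\tau>0$ (no restriction on the time step), every integer $K\ge0$ with $K\tau\le T$, and every solution of the scheme with $\|\mathsf p(\frac\tau2)-p^{\star,1/2}\|_{L^2}\le c_0\tau$ (where $p^{\star,1/2}=p^{-1/2}+\phi^{-1/2}$), one has $e^k\in H^1_0(\Omega)^d$ with $\|e^k\|_B<\infty$ for $0\le k\le K$, $\epsilon^{k+1/2}\in Y$ for $0\le k<K$, and $$\max_{0\le k\le K}\|e^k\|_{L^2}+\Big(\tau\sum_{k=0}^K\|e^k\|_{H^1}^2\Big)^{1/2}+\tau\max_{0\le k\le K}\|e^k\|_B+\tau\max_{0\le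 k<K}\|\epsilon^{k+1/2}\|_A+\sqrt\tau\Big(\tau\sum_{k=1}^{K}\|\delta e^k\|_B^2\Big)^{1/2}\le c\,\tau .$$ -/

import Mathlib

open MeasureTheory Filter Topology
open scoped ContDiff

noncomputable section

namespace DirSplit

/-! ### Function spaces on the open unit cube -/

/-- The domain `Ω = (0,1)^d`. -/
def cube (d : ℕ) : Set (Fin d → ℝ) := Set.univ.pi fun _ => Set.Ioo (0 : ℝ) 1

/-- Scalar `L²(Ω)`. -/
abbrev L2 (d : ℕ) : Type := Lp ℝ 2 (volume.restrict (cube d))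

/-- Vector-valued `L²(Ω)^d`, given by components; its Euclidean norm is `normL2` below. -/
abbrev VF (d : ℕ) : Type := Fin d → L2 d

variable {d : ℕ}

/-- Test functions `φ ∈ C_c^∞(Ω)`. -/
def IsTest (φ : (Fin d → ℝ) → ℝ) : Prop :=
  ContDiff ℝ ∞ φ ∧ HasCompactSupport φ ∧ tsupport φ ⊆ cube d

/-- Classical partial derivative in direction `i`. -/
def pderiv (i : Fin d) (φ : (Fin d → ℝ) → ℝ) : (Fin d → ℝ) → ℝ :=
  fun x => fderiv ℝ φ x (Pi.single i 1)

/-- Iterated classical partial derivatives along a list of directions. -/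
def pderivs : List (Fin d) → ((Fin d → ℝ) → ℝ) → (Fin d → ℝ) → ℝ
  | [], φ => φ
  | i :: l, φ => pderiv i (pderivs l φ)

/-- `g` is the weak derivative `∂_l v`, where `l` lists the directions of differentiation. -/
def IsWeakDeriv (l : List (Fin d)) (v g : L2 d) : Prop :=
  ∀ φ : (Fin d → ℝ) → ℝ, IsTest φ →
    ∫ x in cube d, v x * pderivs l φ x = (-1) ^ l.length * ∫ x in cube d, g x * φ x

/-- The weak derivative `∂_l v` belongs to `L²(Ω)`. -/
def HasWD (l : List (Fin d)) (v : L2 d) : Prop := ∃ g : L2 d, IsWeakDeriv l v g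

open Classical in
/-- The weak derivative `∂_l v ∈ L²(Ω)`; only meaningful under `HasWD l v`. -/
def WD (l : List (Fin d)) (v : L2 d) : L2 d :=
  if h : HasWD l v then h.choose else 0

/-- Closure of `C_c^∞(Ω)` in the norm `(‖v‖² + ∑_{i ∈ s} ‖∂_i v‖²)^{1/2}`. -/
def MemClosureTest (s : Set (Fin d)) (v : L2 d) : Prop :=
  (∀ i ∈ s, HasWD [i] v) ∧
    ∃ φ : ℕ → (Fin d → ℝ) → ℝ, (∀ n, IsTest (φ n)) ∧
      Tendsto (fun n => eLpNorm (fun x => φ n x - v x) 2 (volume.restrict (cube d)))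
        atTop (𝓝 0) ∧
      ∀ i ∈ s, Tendsto (fun n => eLpNorm (fun x => pderiv i (φ n) x - WD [i] v x) 2
        (volume.restrict (cube d))) atTop (𝓝 0)

/-- `H¹₀(Ω)`. -/
def MemH10 (v : L2 d) : Prop := MemClosureTest Set.univ v

/-- `∂_i v ∈ L²(Ω)` and `v = 0` on the two faces `x_i = 0` and `x_i = 1` (and no condition on
the other faces). -/
def ZeroOnFaces (i : Fin d) (v : L2 d) : Prop := MemClosureTest {i} v

/-- Zero mean value. -/
def ZeroMean (q : L2 d) : Prop := ∫ x in cube d, q x = 0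

/-- The Laplacian, componentwise. -/
def lap (v : L2 d) : L2 d := ∑ j, WD [j, j] v

/-- The divergence. -/
def dvg (v : VF d) : L2 d := ∑ i, WD [i] (v i)

/-! ### The pressure operator `A` and the space `Y` -/

/-- `q = (1 - ∂_ii) p` with the Neumann condition `∂_i p = 0` on `x_i = 0, 1`. -/
def NeumannFactor (i : Fin d) (p q : L2 d) : Prop :=
  HasWD [i] p ∧ HasWD [i, i] p ∧ ZeroOnFaces i (WD [i] p) ∧ q = p - WD [i, i] p

/-- Successive application of Neumann factors, the head of the list first. -/
def NeumannChain : List (Fin d) → L2 d → L2 d → Prop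
  | [], p, g => g = p
  | i :: l, p, g => ∃ q, NeumannFactor i p q ∧ NeumannChain l q g

/-- `p ∈ D(A)` and `A p = g`, where `A = (1 - ∂_xx)(1 - ∂_yy)` for `d = 2` and
`A = (1 - ∂_xx)(1 - ∂_yy)(1 - ∂_zz)` for `d = 3`; the last direction is applied first. -/
def IsA (p g : L2 d) : Prop := ZeroMean p ∧ NeumannChain (List.finRange d).reverse p g

/-- The directions of the derivatives that enter `‖·‖_A` besides the function itself:
`∂_i`, `∂_ij` (`i < j`) and `∂_ijk` (`i < j < k`). -/
def YIndex (l : List (Fin d)) : Prop := l.length ≤ 3 ∧ l.Pairwise (· < ·)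

/-- The space `Y` (for `d = 2, 3`). -/
def MemY (q : L2 d) : Prop := ZeroMean q ∧ ∀ l, YIndex l → HasWD l q

/-- The norm of `Y`, the extension of `⟨A q, q⟩^{1/2}` (for `d = 2, 3`). -/
def normA (q : L2 d) : ℝ :=
  √(‖q‖ ^ 2 + ∑ i, ‖WD [i] q‖ ^ 2 + ∑ i, ∑ j ∈ Finset.Ioi i, ‖WD [i, j] q‖ ^ 2
    + ∑ i, ∑ j ∈ Finset.Ioi i, ∑ k ∈ Finset.Ioi j, ‖WD [i, j, k] q‖ ^ 2)

/-! ### The velocity operator `B` and the space `Z` -/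

/-- `B φ = ∑_{i<j} ∂_iijj φ - (τ/2) ∑_{i<j<k} ∂_iijjkk φ`; the last sum is empty for `d = 2`. -/
def classicalB (τ : ℝ) (φ : (Fin d → ℝ) → ℝ) (x : Fin d → ℝ) : ℝ :=
  ∑ i, ∑ j ∈ Finset.Ioi i, pderivs [i, i, j, j] φ x
    - τ / 2 * ∑ i, ∑ j ∈ Finset.Ioi i, ∑ k ∈ Finset.Ioi j, pderivs [i, i, j, j, k, k] φ x

/-- `v ∈ D(B)` and `B v = g` (for one component `v`): `v ∈ H¹₀(Ω)` and the distribution `B v` is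
the function `g ∈ L²(Ω)`. -/
def IsB (τ : ℝ) (v g : L2 d) : Prop :=
  MemH10 v ∧ ∀ φ : (Fin d → ℝ) → ℝ, IsTest φ →
    ∫ x in cube d, v x * classicalB τ φ x = ∫ x in cube d, g x * φ x

/-- The space on which `‖·‖_{L²}`, `‖·‖_{H¹}` and `‖·‖_B` are all finite (for `d = 2, 3`). -/
def MemZ (v : VF d) : Prop := ∀ i, MemH10 (v i) ∧ ∀ l, YIndex l → HasWD l (v i)

/-- `‖v‖_{L²}` for vector fields. -/
def normL2 (v : VF d) : ℝ := √(∑ m, ‖v m‖ ^ 2)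

/-- `‖v‖_{H¹} = ‖∇v‖_{L²}` for vector fields in `H¹₀`. -/
def normH1 (v : VF d) : ℝ := √(∑ m, ∑ i, ‖WD [i] (v m)‖ ^ 2)

/-- `‖v‖_B`, the extension of `⟨v, B v⟩^{1/2}`. -/
def normB (τ : ℝ) (v : VF d) : ℝ :=
  √(∑ m, (∑ i, ∑ j ∈ Finset.Ioi i, ‖WD [i, j] (v m)‖ ^ 2
    + τ / 2 * ∑ i, ∑ j ∈ Finset.Ioi i, ∑ k ∈ Finset.Ioi j, ‖WD [i, j, k] (v m)‖ ^ 2))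

/-! ### Regularity in time -/

/-- `ψ ∈ W^{1,∞}(0,T;E)`, in terms of its continuous representative: `ψ` is Lipschitz. -/
def MemW1Infty {E : Type*} [NormedAddCommGroup E] (T : ℝ) (ψ : ℝ → E) : Prop :=
  ∃ L, LipschitzOnWith L ψ (Set.Icc 0 T)

/-- `ψ ∈ W^{2,∞}(0,T;E)`, in terms of its continuously differentiable representative. -/
def MemW2Infty {E : Type*} [NormedAddCommGroup E] [NormedSpace ℝ E] (T : ℝ) (ψ : ℝ → E) : Prop :=
  ∃ ψ' : ℝ → E, (∀ t ∈ Set.Icc 0 T, HasDerivWithinAt ψ (ψ' t) (Set.Icc 0 T) t) ∧ MemW1Infty T ψ'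

/-! ### The Stokes problem -/

/-- `(u, p)` solves the time-dependent Stokes equations with source `f`, homogeneous Dirichlet
condition and initial velocity `u₀`; the momentum equation holds in `L²(Ω)^d` at each time. -/
structure IsStokesSolution (T : ℝ) (f : ℝ → VF d) (u₀ : VF d) (u : ℝ → VF d) (p : ℝ → L2 d) :
    Prop where
  diff_u : ∀ t ∈ Set.Ioc 0 T, ∀ m j, HasWD [j, j] (u t m)
  diff_p : ∀ t ∈ Set.Ioc 0 T, ∀ m, HasWD [m] (p t)
  momentum : ∀ t ∈ Set.Ioc 0 T, ∀ m, ∃ ut : L2 d,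
    HasDerivWithinAt (fun s => u s m) ut (Set.Icc 0 T) t ∧
      ut - lap (u t m) + WD [m] (p t) = f t m
  diff_div : ∀ t ∈ Set.Icc 0 T, ∀ m, HasWD [m] (u t m)
  incompressible : ∀ t ∈ Set.Icc 0 T, dvg (u t) = 0
  dirichlet : ∀ t ∈ Set.Ioc 0 T, ∀ m, MemH10 (u t m)
  initial : u 0 = u₀

/-- `f ∈ W^{2,∞}(L²)`, `u ∈ W^{2,∞}(H²) ∩ W^{1,∞}(D(B))` and `p ∈ W^{2,∞}(Y)`. A curve is
differentiable (Lipschitz) in a Sobolev norm iff all the spatial derivatives that enter the norm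
are so in `L²`. For `d = 3` the operator `B`, hence `D(B)`, depends on the time step `τ`. -/
structure IsSmoothEnough (T : ℝ) (f u : ℝ → VF d) (p : ℝ → L2 d) : Prop where
  source : ∀ m, MemW2Infty T (fun t => f t m)
  velocity_H2 : ∀ m, ∀ l : List (Fin d), l.length ≤ 2 →
    (∀ t ∈ Set.Icc 0 T, HasWD l (u t m)) ∧ MemW2Infty T (fun t => WD l (u t m))
  velocity_DB : ∀ τ : ℝ, 0 < τ → ∀ m, ∃ b : ℝ → L2 d,
    (∀ t ∈ Set.Icc 0 T, IsB τ (u t m) (b t)) ∧ MemW1Infty T b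
  pressure_Y : (∀ t ∈ Set.Icc 0 T, MemY (p t)) ∧
    ∀ l, YIndex l → MemW2Infty T (fun t => WD l (p t))

/-! ### The schemes

Indexing: `u k` is `u^k`; `p k` and `φ k` are `p^{k-1/2}` and `φ^{k-1/2}`, so that the pressure
predictor `p^{⋆,k+1/2}` is `p k + φ k`. Steps `k = 0, …, K-1` are performed. -/

/-- The time `t_{k+1/2}`. -/
def tHalf (τ : ℝ) (k : ℕ) : ℝ := ((k : ℝ) + 1 / 2) * τ

/-- The parts that do not depend on the dimension: initialization, the requirement that the
gradient of the pressure predictor and the divergence of the velocity are in `L²`, penalty step,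
pressure update. -/
structure IsPressureScheme (τ χ : ℝ) (K : ℕ) (u₀ : VF d) (p₀ φ₀ : L2 d)
    (u : ℕ → VF d) (p φ : ℕ → L2 d) : Prop where
  init_u : u 0 = u₀
  init_p : p 0 = p₀
  init_φ : φ 0 = φ₀
  diff_predictor : ∀ k < K, ∀ m, HasWD [m] (p k + φ k)
  diff_div : ∀ k ≤ K, ∀ m, HasWD [m] (u k m)
  penalty : ∀ k < K, IsA (φ (k + 1)) (-(1 / τ) • dvg (u (k + 1)))
  update : ∀ k < K,
    p (k + 1) = p k + φ (k + 1) - χ • dvg ((1 / 2 : ℝ) • (u (k + 1) + u k))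

/-- The two-dimensional scheme (Peaceman–Rachford momentum step); `uh k` is `u^{k+1/2}`. -/
structure IsScheme2D (τ χ : ℝ) (K : ℕ) (f : ℝ → VF 2) (u₀ : VF 2) (p₀ φ₀ : L2 2)
    (u uh : ℕ → VF 2) (p φ : ℕ → L2 2) : Prop
    extends IsPressureScheme τ χ K u₀ p₀ φ₀ u p φ where
  diff_u : ∀ k ≤ K, ∀ m, HasWD [1, 1] (u k m)
  diff_uh : ∀ k < K, ∀ m, HasWD [0, 0] (uh k m)
  bc_uh : ∀ k < K, ∀ m, ZeroOnFaces 0 (uh k m)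
  half_step : ∀ k < K, ∀ m,
    (1 / (τ / 2)) • (uh k m - u k m) - WD [0, 0] (uh k m) - WD [1, 1] (u k m)
      + WD [m] (p k + φ k) = f (tHalf τ k) m
  bc_u : ∀ k < K, ∀ m, ZeroOnFaces 1 (u (k + 1) m)
  full_step : ∀ k < K, ∀ m,
    (1 / (τ / 2)) • (u (k + 1) m - uh k m) - WD [0, 0] (uh k m) - WD [1, 1] (u (k + 1) m)
      + WD [m] (p k + φ k) = f (tHalf τ k) m

/-- The three-dimensional scheme (Douglas momentum step); `ξ (k+1)` is `ξ^{k+1}` etc. The equation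
for `ξ^{k+1}` is an explicit formula for a function that is merely in `L²`, so no boundary condition
is (or could be) imposed on it. -/
structure IsScheme3D (τ χ : ℝ) (K : ℕ) (f : ℝ → VF 3) (u₀ : VF 3) (p₀ φ₀ : L2 3)
    (u ξ η ζ : ℕ → VF 3) (p φ : ℕ → L2 3) : Prop
    extends IsPressureScheme τ χ K u₀ p₀ φ₀ u p φ where
  diff_u : ∀ k ≤ K, ∀ m j, HasWD [j, j] (u k m)
  xi_step : ∀ k < K, ∀ m,
    (1 / τ) • (ξ (k + 1) m - u k m) - lap (u k m) + WD [m] (p k + φ k) = f (tHalf τ k) m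
  diff_eta : ∀ k < K, ∀ m, HasWD [0, 0] (η (k + 1) m - u k m)
  bc_eta : ∀ k < K, ∀ m, ZeroOnFaces 0 (η (k + 1) m)
  eta_step : ∀ k < K, ∀ m,
    (1 / τ) • (η (k + 1) m - ξ (k + 1) m)
      - (1 / 2 : ℝ) • WD [0, 0] (η (k + 1) m - u k m) = 0
  diff_zeta : ∀ k < K, ∀ m, HasWD [1, 1] (ζ (k + 1) m - u k m)
  bc_zeta : ∀ k < K, ∀ m, ZeroOnFaces 1 (ζ (k + 1) m)
  zeta_step : ∀ k < K, ∀ m,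
    (1 / τ) • (ζ (k + 1) m - η (k + 1) m)
      - (1 / 2 : ℝ) • WD [1, 1] (ζ (k + 1) m - u k m) = 0
  diff_incr : ∀ k < K, ∀ m, HasWD [2, 2] (u (k + 1) m - u k m)
  bc_u : ∀ k < K, ∀ m, ZeroOnFaces 2 (u (k + 1) m)
  u_step : ∀ k < K, ∀ m,
    (1 / τ) • (u (k + 1) m - ζ (k + 1) m)
      - (1 / 2 : ℝ) • WD [2, 2] (u (k + 1) m - u k m) = 0

/-! ### Errors and discrete norms -/

/-- `e^k = u(t_k) - u^k`. -/
def velErr (τ : ℝ) (ue : ℝ → VF d) (u : ℕ → VF d) (k : ℕ) : VF d := ue (k * τ) - u k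

/-- `δe^{k+1} = e^{k+1} - e^k`. -/
def velErrIncr (τ : ℝ) (ue : ℝ → VF d) (u : ℕ → VF d) (k : ℕ) : VF d :=
  velErr τ ue u (k + 1) - velErr τ ue u k

/-- `ε^{k+1/2} = p(t_{k+1/2}) - p^{k+1/2}`. -/
def presErr (τ : ℝ) (pe : ℝ → L2 d) (p : ℕ → L2 d) (k : ℕ) : L2 d := pe (tHalf τ k) - p (k + 1)

/-- Maximum of `a 0, …, a (N-1)` for non-negative `a` (`0` if `N = 0`). -/
def linf (N : ℕ) (a : ℕ → ℝ) : ℝ := ⨆ k : Fin N, a k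

/-- `(τ ∑_{k<N} a_k²)^{1/2}`. -/
def l2 (τ : ℝ) (N : ℕ) (a : ℕ → ℝ) : ℝ := √(τ * ∑ k ∈ Finset.range N, a k ^ 2)

/-- The first-order error estimate with constant `c`, including the finiteness of the norms. -/
def ErrorEstimate (c τ : ℝ) (K : ℕ) (ue : ℝ → VF d) (pe : ℝ → L2 d)
    (u : ℕ → VF d) (p : ℕ → L2 d) : Prop :=
  (∀ k ≤ K, MemZ (velErr τ ue u k)) ∧
  (∀ k < K, MemY (presErr τ pe p k)) ∧
  linf (K + 1) (fun k => normL2 (velErr τ ue u k))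
    + l2 τ (K + 1) (fun k => normH1 (velErr τ ue u k))
    + τ * linf (K + 1) (fun k => normB τ (velErr τ ue u k))
    + τ * linf K (fun k => normA (presErr τ pe p k))
    + √τ * l2 τ K (fun k => normB τ (velErrIncr τ ue u k)) ≤ c * τ

end DirSplit

end

open DirSplit

noncomputable section

namespace DirSplit

variable {d : ℕ}

/-! ### Continuous functions as elements of `L²(Ω)` -/

/-! On the unit cube every operator of the problem is diagonal in products of sines or cosines.
Velocities are expanded in sine products and pressures in cosine products. Mixed derivatives,
Dirichlet and Neumann factors, `A` and `B` then multiply coefficients by symbols (`coef_wd`,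
`ZeroOnFaces.coef_wd_pair`, `IsA.coef_eq`, `IsB.coef_eq`), and Parseval turns the bilinear forms
into sums (`hasSum_inner_wd`). Conversely, square-summability of weighted coefficients yields weak
derivatives and membership in `H¹₀` (`hasWD_of_summable`, `memH10_of_summable`), so regularity of
the iterates is a question of decay.

Eliminating the intermediate velocities mode by mode shows that Peaceman–Rachford and Douglas have
the same form: Crank–Nicolson with the perturbation `(τ²/4) B (u^{k+1} - u^k)`, recorded as
`ModalStep`. The exact velocity satisfies this step with a residual `O(τ²)`
(`IsStokesSolution.exists_residual`). The errors therefore obey a linear recursion, whose structure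
is isolated in `Forms`: a momentum equation `Forms.Step` with predictor error `E + δ - φ`, where `δ`
is the increment of the exact pressure, and a penalty equation `Forms.Penalty`.

Stability comes from testing with the new error `e'` (`Forms.Step.energy_le`). The pressure terms
telescope in `τ² ‖E‖_A²` up to terms with `δ`, except for `τ² ‖φ' - φ‖_A²`, which has the wrong
sign; it is dominated by `‖e' - e‖²`, because the penalty equation and `|⟨∇·v, p⟩| ≤ ‖v‖ ‖p‖_A` give
`Forms.Penalty.sq_le`. No restriction on the time step arises.

In the first step the predictor error is small only in `L²`, so it is charged to the viscous term;
the energy after this step is `O(τ³)` (`Forms.Recursion.energy_one`) and stays `O(τ²)` afterwards.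
This bounds everything but the `H¹` norm, since the dissipation sees only the averages `e' + e`. The
same estimate applied to time differences of the recursion shows that the increments are `O(τ)` in
`H¹` (`Forms.Recursion.a1_sub_le`), which recovers `e'` from the averages. -/

lemma isOpen_cube : IsOpen (cube d) := isOpen_set_pi Set.finite_univ fun _ _ => isOpen_Ioo

lemma measurableSet_cube : MeasurableSet (cube d) := isOpen_cube.measurableSet

lemma cube_subset_Icc : cube d ⊆ Set.Icc 0 1 := fun _ hx =>
  ⟨fun i => (hx i trivial).1.le, fun i => (hx i trivial).2.le⟩

instance isFiniteMeasure_cube : IsFiniteMeasure (volume.restrict (cube d)) :=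
  ⟨by
    rw [Measure.restrict_apply_univ]
    exact (measure_mono cube_subset_Icc).trans_lt isCompact_Icc.measure_lt_top⟩

lemma exists_bound_on_cube {ψ : (Fin d → ℝ) → ℝ} (h : Continuous ψ) :
    ∃ C, ∀ x ∈ cube d, ‖ψ x‖ ≤ C := by
  obtain ⟨C, hC⟩ := (isCompact_Icc (a := (0 : Fin d → ℝ)) (b := 1)).exists_bound_of_continuousOn
    h.continuousOn
  exact ⟨C, fun x hx => hC x (cube_subset_Icc hx)⟩

lemma memLp_of_continuous {ψ : (Fin d → ℝ) → ℝ} (h : Continuous ψ) :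
    MemLp ψ 2 (volume.restrict (cube d)) := by
  obtain ⟨C, hC⟩ := exists_bound_on_cube h
  exact MemLp.of_bound h.aestronglyMeasurable C
    ((ae_restrict_iff' measurableSet_cube).2 (Eventually.of_forall hC))

open Classical in
/-- The class in `L²(Ω)` of a function (`0` if it is not square-integrable). -/
def cl (ψ : (Fin d → ℝ) → ℝ) : L2 d :=
  if h : MemLp ψ 2 (volume.restrict (cube d)) then h.toLp ψ else 0

lemma coeFn_cl {ψ : (Fin d → ℝ) → ℝ} (h : Continuous ψ) :
    cl ψ =ᵐ[volume.restrict (cube d)] ψ := by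
  rw [cl, dif_pos (memLp_of_continuous h)]
  exact MemLp.coeFn_toLp _

lemma inner_eq_integral (v w : L2 d) : inner ℝ v w = ∫ x in cube d, v x * w x := by
  rw [L2.inner_def]
  refine integral_congr_ae (Eventually.of_forall fun x => ?_)
  simp [mul_comm]

lemma inner_cl (v : L2 d) {ψ : (Fin d → ℝ) → ℝ} (h : Continuous ψ) :
    inner ℝ v (cl ψ) = ∫ x in cube d, v x * ψ x := by
  rw [inner_eq_integral]
  refine integral_congr_ae ?_
  filter_upwards [coeFn_cl h] with x hx
  rw [hx]

lemma cl_add {ψ χ : (Fin d → ℝ) → ℝ} (h : Continuous ψ) (h' : Continuous χ) :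
    cl (fun x => ψ x + χ x) = cl ψ + cl χ := by
  apply Lp.ext
  filter_upwards [coeFn_cl h, coeFn_cl h', coeFn_cl (h.add h'), Lp.coeFn_add (cl ψ) (cl χ)]
    with x h1 h2 h3 h4
  rw [h4, Pi.add_apply, h1, h2]
  exact h3

lemma cl_smul {ψ : (Fin d → ℝ) → ℝ} (h : Continuous ψ) (c : ℝ) :
    cl (fun x => c * ψ x) = c • cl ψ := by
  apply Lp.ext
  filter_upwards [coeFn_cl h, coeFn_cl (h.const_mul c), Lp.coeFn_smul c (cl ψ)] with x h1 h2 h3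
  rw [h3, Pi.smul_apply, h1, smul_eq_mul]
  exact h2

lemma integrable_coe (v : L2 d) : Integrable v (volume.restrict (cube d)) :=
  (Lp.memLp v).integrable (by norm_num)

lemma integrable_mul_continuous (v : L2 d) {ψ : (Fin d → ℝ) → ℝ} (h : Continuous ψ) :
    Integrable (fun x => v x * ψ x) (volume.restrict (cube d)) :=
  (Lp.memLp v).integrable_mul (memLp_of_continuous h)

/-- Bounded convergence against an `L²` function. -/
lemma tendsto_integral_mul (v : L2 d) {ψ : ℕ → (Fin d → ℝ) → ℝ} {χ : (Fin d → ℝ) → ℝ} {C : ℝ}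
    (hψ : ∀ n, Continuous (ψ n)) (hC : ∀ n, ∀ x ∈ cube d, ‖ψ n x‖ ≤ C)
    (hlim : ∀ x ∈ cube d, Tendsto (fun n => ψ n x) atTop (𝓝 (χ x))) :
    Tendsto (fun n => ∫ x in cube d, v x * ψ n x) atTop (𝓝 (∫ x in cube d, v x * χ x)) := by
  refine tendsto_integral_of_dominated_convergence (fun x => ‖v x‖ * C)
    (fun n => (integrable_mul_continuous v (hψ n)).aestronglyMeasurable)
    ((integrable_coe v).norm.mul_const C) (fun n => ?_) ?_
  · refine (ae_restrict_iff' measurableSet_cube).2 (Eventually.of_forall fun x hx => ?_)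
    rw [norm_mul]
    exact mul_le_mul_of_nonneg_left (hC n x hx) (norm_nonneg _)
  · refine (ae_restrict_iff' measurableSet_cube).2 (Eventually.of_forall fun x hx => ?_)
    exact (hlim x hx).const_mul _

/-! ### Test functions -/

lemma IsTest.continuous {φ : (Fin d → ℝ) → ℝ} (h : IsTest φ) : Continuous φ := h.1.continuous

lemma contDiff_pderiv (i : Fin d) {φ : (Fin d → ℝ) → ℝ} (h : ContDiff ℝ ∞ φ) :
    ContDiff ℝ ∞ (pderiv i φ) :=
  (h.fderiv_right (m := ∞) (by exact_mod_cast le_rfl)).clm_apply contDiff_const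

lemma IsTest.pderiv (i : Fin d) {φ : (Fin d → ℝ) → ℝ} (h : IsTest φ) : IsTest (pderiv i φ) :=
  ⟨contDiff_pderiv i h.1, h.2.1.fderiv_apply ℝ _, (tsupport_fderiv_apply_subset ℝ _).trans h.2.2⟩

lemma IsTest.pderivs (l : List (Fin d)) {φ : (Fin d → ℝ) → ℝ} (h : IsTest φ) :
    IsTest (pderivs l φ) := by
  induction l with
  | nil => exact h
  | cons i l ih => exact ih.pderiv i

lemma IsTest.add {φ ψ : (Fin d → ℝ) → ℝ} (h : IsTest φ) (h' : IsTest ψ) :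
    IsTest (fun x => φ x + ψ x) :=
  ⟨h.1.add h'.1, h.2.1.add h'.2.1, (tsupport_add φ ψ).trans (Set.union_subset h.2.2 h'.2.2)⟩

lemma IsTest.const_mul {φ : (Fin d → ℝ) → ℝ} (h : IsTest φ) (c : ℝ) :
    IsTest (fun x => c * φ x) :=
  ⟨contDiff_const.mul h.1, h.2.1.mul_left (f := fun _ => c),
    (closure_mono (Function.support_mul_subset_right (fun _ => c) φ)).trans h.2.2⟩

lemma pderiv_add (i : Fin d) {φ ψ : (Fin d → ℝ) → ℝ} (h : ContDiff ℝ ∞ φ) (h' : ContDiff ℝ ∞ ψ) :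
    pderiv i (fun x => φ x + ψ x) = fun x => pderiv i φ x + pderiv i ψ x := by
  funext x
  simp only [pderiv]
  rw [fderiv_fun_add (h.differentiable (by simp) x) (h'.differentiable (by simp) x)]
  rfl

lemma pderiv_const_mul (i : Fin d) {φ : (Fin d → ℝ) → ℝ} (h : ContDiff ℝ ∞ φ) (c : ℝ) :
    pderiv i (fun x => c * φ x) = fun x => c * pderiv i φ x := by
  funext x
  simp only [pderiv]
  rw [fderiv_const_mul (h.differentiable (by simp) x)]
  rfl

lemma setIntegral_test_mul {φ : (Fin d → ℝ) → ℝ} (h : IsTest φ) (ψ : (Fin d → ℝ) → ℝ) :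
    ∫ x in cube d, φ x * ψ x = ∫ x, φ x * ψ x := by
  apply setIntegral_eq_integral_of_forall_compl_eq_zero
  intro x hx
  rw [image_eq_zero_of_notMem_tsupport fun hx' => hx (h.2.2 hx'), zero_mul]

/-- Integration by parts of a test function against a smooth function. -/
lemma integral_pderiv_test_mul (i : Fin d) {φ ψ : (Fin d → ℝ) → ℝ} (h : IsTest φ)
    (hψ : ContDiff ℝ ∞ ψ) :
    ∫ x in cube d, pderiv i φ x * ψ x = -∫ x in cube d, φ x * pderiv i ψ x := by
  rw [setIntegral_test_mul h, setIntegral_test_mul (h.pderiv i)]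
  have int : ∀ {a b : (Fin d → ℝ) → ℝ}, IsTest a → Continuous b →
      Integrable (fun x => a x * b x) := fun ha hb =>
    (ha.continuous.mul hb).integrable_of_hasCompactSupport ha.2.1.mul_right
  have := integral_mul_fderiv_eq_neg_fderiv_mul_of_integrable (μ := volume) (f := φ) (g := ψ)
    (v := Pi.single i 1) (int (h.pderiv i) hψ.continuous)
    (int h (contDiff_pderiv i hψ).continuous) (int h hψ.continuous)
    (fun x _ => h.1.differentiable (by simp) x) (fun x _ => hψ.differentiable (by simp) x)
  simp only [pderiv]
  linarith

/-! ### Weak derivatives -/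

lemma eq_zero_of_forall_test {g : L2 d}
    (h : ∀ φ, IsTest φ → ∫ x in cube d, g x * φ x = 0) : g = 0 := by
  have hg : LocallyIntegrableOn g (cube d) volume :=
    IntegrableOn.locallyIntegrableOn (integrable_coe g)
  have := isOpen_cube.ae_eq_zero_of_integral_contDiff_smul_eq_zero hg fun φ h1 h2 h3 => by
    rw [← h φ ⟨h1, h2, h3⟩, ← setIntegral_eq_integral_of_forall_compl_eq_zero (s := cube d)]
    · simp only [smul_eq_mul, mul_comm]
    · intro x hx
      rw [image_eq_zero_of_notMem_tsupport fun hx' => hx (h3 hx'), zero_smul]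
  apply Lp.ext
  filter_upwards [(ae_restrict_iff' measurableSet_cube).2 this, Lp.coeFn_zero ℝ 2
    (volume.restrict (cube d))] with x h1 h2
  rw [h1, h2]
  rfl

lemma isWeakDeriv_iff (l : List (Fin d)) (v g : L2 d) : IsWeakDeriv l v g ↔
    ∀ φ, IsTest φ → inner ℝ v (cl (pderivs l φ)) = (-1) ^ l.length * inner ℝ g (cl φ) := by
  refine forall₂_congr fun φ hφ => ?_
  rw [inner_cl _ hφ.continuous, inner_cl _ (hφ.pderivs l).continuous]

lemma IsWeakDeriv.unique {l : List (Fin d)} {v g g' : L2 d} (h : IsWeakDeriv l v g)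
    (h' : IsWeakDeriv l v g') : g = g' := by
  rw [← sub_eq_zero]
  refine eq_zero_of_forall_test fun φ hφ => ?_
  have h1 := (isWeakDeriv_iff _ _ _).1 h φ hφ
  have h2 := (isWeakDeriv_iff _ _ _).1 h' φ hφ
  rw [← inner_cl _ hφ.continuous, inner_sub_left]
  rw [h1] at h2
  have : ((-1 : ℝ) ^ l.length) ≠ 0 := by simp
  linarith [mul_left_cancel₀ this h2]

lemma HasWD.isWeakDeriv {l : List (Fin d)} {v : L2 d} (h : HasWD l v) :
    IsWeakDeriv l v (WD l v) := by
  rw [WD, dif_pos h]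
  exact h.choose_spec

lemma IsWeakDeriv.hasWD {l : List (Fin d)} {v g : L2 d} (h : IsWeakDeriv l v g) : HasWD l v :=
  ⟨g, h⟩

lemma IsWeakDeriv.wd_eq {l : List (Fin d)} {v g : L2 d} (h : IsWeakDeriv l v g) : WD l v = g :=
  h.hasWD.isWeakDeriv.unique h

lemma IsWeakDeriv.add {l : List (Fin d)} {v g v' g' : L2 d} (h : IsWeakDeriv l v g)
    (h' : IsWeakDeriv l v' g') : IsWeakDeriv l (v + v') (g + g') := by
  rw [isWeakDeriv_iff] at *
  intro φ hφ
  rw [inner_add_left, inner_add_left, h φ hφ, h' φ hφ, mul_add]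

lemma IsWeakDeriv.smul {l : List (Fin d)} {v g : L2 d} (h : IsWeakDeriv l v g) (c : ℝ) :
    IsWeakDeriv l (c • v) (c • g) := by
  rw [isWeakDeriv_iff] at *
  intro φ hφ
  rw [real_inner_smul_left, real_inner_smul_left, h φ hφ]
  ring

lemma isWeakDeriv_nil (v : L2 d) : IsWeakDeriv [] v v := by
  intro φ _
  simp [pderivs]

lemma isWeakDeriv_zero (l : List (Fin d)) : IsWeakDeriv l (0 : L2 d) 0 := by
  rw [isWeakDeriv_iff]
  simp

@[simp] lemma wd_nil (v : L2 d) : WD [] v = v := (isWeakDeriv_nil v).wd_eq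

lemma HasWD.add {l : List (Fin d)} {v w : L2 d} (h : HasWD l v) (h' : HasWD l w) :
    HasWD l (v + w) := (h.isWeakDeriv.add h'.isWeakDeriv).hasWD

lemma HasWD.smul {l : List (Fin d)} {v : L2 d} (h : HasWD l v) (c : ℝ) : HasWD l (c • v) :=
  (h.isWeakDeriv.smul c).hasWD

lemma HasWD.sub {l : List (Fin d)} {v w : L2 d} (h : HasWD l v) (h' : HasWD l w) :
    HasWD l (v - w) := by
  rw [sub_eq_add_neg, ← neg_one_smul ℝ w]
  exact h.add (h'.smul _)

lemma wd_add {l : List (Fin d)} {v w : L2 d} (h : HasWD l v) (h' : HasWD l w) :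
    WD l (v + w) = WD l v + WD l w := (h.isWeakDeriv.add h'.isWeakDeriv).wd_eq

lemma wd_smul {l : List (Fin d)} {v : L2 d} (h : HasWD l v) (c : ℝ) :
    WD l (c • v) = c • WD l v := (h.isWeakDeriv.smul c).wd_eq

lemma wd_sub {l : List (Fin d)} {v w : L2 d} (h : HasWD l v) (h' : HasWD l w) :
    WD l (v - w) = WD l v - WD l w := by
  rw [sub_eq_add_neg, ← neg_one_smul ℝ w, wd_add h (h'.smul _), wd_smul h', neg_one_smul,
    sub_eq_add_neg]

/-- Test the first relation with `∂_i φ`. It serves to identify the iterated derivative `WD [i] (WD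
[i] p)` in a Neumann factor with `WD [i, i] p`. -/
lemma IsWeakDeriv.tail {i j : Fin d} {v g h : L2 d} (hg : IsWeakDeriv [j] v g)
    (hh : IsWeakDeriv [j, i] v h) : IsWeakDeriv [i] g h := by
  intro φ hφ
  have h1 := hg _ (hφ.pderiv i)
  have h2 := hh φ hφ
  simp only [pderivs, List.length_cons, List.length_nil] at *
  rw [h1] at h2
  norm_num at h2 ⊢
  linarith

/-! ### Closures of test functions -/

lemma tendsto_eLpNorm_iff {φ : ℕ → (Fin d → ℝ) → ℝ} (hφ : ∀ n, Continuous (φ n)) (v : L2 d) :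
    Tendsto (fun n => eLpNorm (fun x => φ n x - v x) 2 (volume.restrict (cube d))) atTop (𝓝 0) ↔
      Tendsto (fun n => cl (φ n)) atTop (𝓝 v) := by
  rw [Lp.tendsto_Lp_iff_tendsto_eLpNorm']
  refine tendsto_congr fun n => eLpNorm_congr_ae ?_
  filter_upwards [coeFn_cl (hφ n)] with x hx
  rw [Pi.sub_apply, hx]

/-- With convergence stated in the Hilbert space `L2 d`, identities for test functions pass to the
limit by continuity of the inner product. -/
lemma memClosureTest_iff (s : Set (Fin d)) (v : L2 d) : MemClosureTest s v ↔
    (∀ i ∈ s, HasWD [i] v) ∧ ∃ φ : ℕ → (Fin d → ℝ) → ℝ, (∀ n, IsTest (φ n)) ∧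
      Tendsto (fun n => cl (φ n)) atTop (𝓝 v) ∧
      ∀ i ∈ s, Tendsto (fun n => cl (pderiv i (φ n))) atTop (𝓝 (WD [i] v)) := by
  refine and_congr_right fun _ => exists_congr fun φ => and_congr_right fun hφ => ?_
  rw [tendsto_eLpNorm_iff fun n => (hφ n).continuous]
  refine and_congr_right fun _ => forall₂_congr fun i _ => ?_
  rw [tendsto_eLpNorm_iff fun n => ((hφ n).pderiv i).continuous]

lemma MemClosureTest.mono {s t : Set (Fin d)} {v : L2 d} (h : MemClosureTest s v) (hst : t ⊆ s) :
    MemClosureTest t v :=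
  ⟨fun i hi => h.1 i (hst hi), by
    obtain ⟨φ, h1, h2, h3⟩ := h.2
    exact ⟨φ, h1, h2, fun i hi => h3 i (hst hi)⟩⟩

lemma MemClosureTest.add {s : Set (Fin d)} {v w : L2 d} (hv : MemClosureTest s v)
    (hw : MemClosureTest s w) : MemClosureTest s (v + w) := by
  rw [memClosureTest_iff] at *
  obtain ⟨h1, φ, h2, h3, h4⟩ := hv
  obtain ⟨k1, ψ, k2, k3, k4⟩ := hw
  refine ⟨fun i hi => (h1 i hi).add (k1 i hi), fun n x => φ n x + ψ n x,
    fun n => (h2 n).add (k2 n), ?_, fun i hi => ?_⟩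
  · simp_rw [fun n => cl_add (h2 n).continuous (k2 n).continuous]
    exact h3.add k3
  · simp_rw [fun n => pderiv_add i (h2 n).1 (k2 n).1,
      fun n => cl_add ((h2 n).pderiv i).continuous ((k2 n).pderiv i).continuous]
    rw [wd_add (h1 i hi) (k1 i hi)]
    exact (h4 i hi).add (k4 i hi)

lemma MemClosureTest.smul {s : Set (Fin d)} {v : L2 d} (hv : MemClosureTest s v) (c : ℝ) :
    MemClosureTest s (c • v) := by
  rw [memClosureTest_iff] at *
  obtain ⟨h1, φ, h2, h3, h4⟩ := hv
  refine ⟨fun i hi => (h1 i hi).smul c, fun n x => c * φ n x,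
    fun n => (h2 n).const_mul c, ?_, fun i hi => ?_⟩
  · simp_rw [fun n => cl_smul (h2 n).continuous c]
    exact h3.const_smul c
  · simp_rw [fun n => pderiv_const_mul i (h2 n).1 c,
      fun n => cl_smul ((h2 n).pderiv i).continuous c]
    rw [wd_smul (h1 i hi)]
    exact (h4 i hi).const_smul c

lemma MemClosureTest.sub {s : Set (Fin d)} {v w : L2 d} (hv : MemClosureTest s v)
    (hw : MemClosureTest s w) : MemClosureTest s (v - w) := by
  rw [sub_eq_add_neg, ← neg_one_smul ℝ w]
  exact hv.add (hw.smul _)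

lemma memClosureTest_zero (s : Set (Fin d)) : MemClosureTest s (0 : L2 d) := by
  have h0 : IsTest (fun _ : Fin d → ℝ => (0 : ℝ)) :=
    ⟨contDiff_const, HasCompactSupport.zero, by simp [tsupport]⟩
  have hc : cl (fun _ : Fin d → ℝ => (0 : ℝ)) = 0 := by
    have := cl_smul (d := d) (ψ := fun _ => 0) continuous_const 0
    simpa using this
  rw [memClosureTest_iff]
  refine ⟨fun i _ => (isWeakDeriv_zero _).hasWD, fun _ _ => 0, fun _ => h0, ?_, fun i _ => ?_⟩
  · simp only [hc]
    exact tendsto_const_nhds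
  · have : pderiv i (fun _ : Fin d → ℝ => (0 : ℝ)) = fun _ => 0 := by
      funext x
      simp [pderiv]
    simp only [this, hc, (isWeakDeriv_zero _).wd_eq]
    exact tendsto_const_nhds

lemma MemH10.zeroOnFaces {v : L2 d} (h : MemH10 v) (i : Fin d) : ZeroOnFaces i v :=
  h.mono (Set.subset_univ _)

/-- Integration by parts of a weak derivative against a function vanishing on the faces. -/
lemma ZeroOnFaces.inner_wd {i : Fin d} {P w : L2 d} (hw : ZeroOnFaces i w) (hP : HasWD [i] P) :
    inner ℝ (WD [i] P) w = -inner ℝ P (WD [i] w) := by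
  obtain ⟨-, φ, h1, h2, h3⟩ := (memClosureTest_iff _ _).1 hw
  have e : ∀ n, inner ℝ P (cl (pderiv i (φ n))) = -inner ℝ (WD [i] P) (cl (φ n)) := fun n => by
    simpa [pderivs] using (isWeakDeriv_iff _ _ _).1 hP.isWeakDeriv (φ n) (h1 n)
  have a := (tendsto_const_nhds (x := P)).inner (𝕜 := ℝ) (h3 i rfl)
  simp_rw [e] at a
  have b := ((tendsto_const_nhds (x := WD [i] P)).inner (𝕜 := ℝ) h2).neg
  rw [tendsto_nhds_unique a b, neg_neg]

/-- Integration by parts of a function vanishing on the faces against a smooth function. -/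
lemma ZeroOnFaces.integral_wd_mul {i : Fin d} {v : L2 d} (hv : ZeroOnFaces i v)
    {ψ : (Fin d → ℝ) → ℝ} (hψ : ContDiff ℝ ∞ ψ) :
    ∫ x in cube d, WD [i] v x * ψ x = -∫ x in cube d, v x * pderiv i ψ x := by
  obtain ⟨-, φ, h1, h2, h3⟩ := (memClosureTest_iff _ _).1 hv
  have hψ' := (contDiff_pderiv i hψ).continuous
  rw [← inner_cl _ hψ.continuous, ← inner_cl _ hψ']
  have e : ∀ n, inner ℝ (cl (pderiv i (φ n))) (cl ψ) = -inner ℝ (cl (φ n)) (cl (pderiv i ψ)) := by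
    intro n
    have key := integral_pderiv_test_mul i (h1 n) hψ
    rw [inner_cl _ hψ.continuous, inner_cl _ hψ']
    rw [integral_congr_ae (g := fun x => pderiv i (φ n) x * ψ x), key]
    · congr 1
      refine integral_congr_ae ?_
      filter_upwards [coeFn_cl (h1 n).continuous] with x hx
      rw [hx]
    · filter_upwards [coeFn_cl ((h1 n).pderiv i).continuous] with x hx
      rw [hx]
  have a := (h3 i rfl).inner (𝕜 := ℝ) (tendsto_const_nhds (x := cl ψ))
  simp_rw [e] at a
  exact tendsto_nhds_unique a (h2.inner (𝕜 := ℝ) tendsto_const_nhds).neg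

/-! ### Products of functions of one variable -/

/-- The product `x ↦ ∏ f_i(x_i)`. -/
def prodFn (f : Fin d → ℝ → ℝ) (x : Fin d → ℝ) : ℝ := ∏ i, f i (x i)

lemma prodFn_update (f : Fin d → ℝ → ℝ) (i : Fin d) (g : ℝ → ℝ) (x : Fin d → ℝ) :
    prodFn (Function.update f i g) x = g (x i) * ∏ j ∈ Finset.univ.erase i, f j (x j) := by
  rw [prodFn, ← Finset.mul_prod_erase _ _ (Finset.mem_univ i), Function.update_self]
  congr 1
  refine Finset.prod_congr rfl fun j hj => ?_
  rw [Function.update_of_ne (Finset.ne_of_mem_erase hj)]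

lemma continuous_prodFn {f : Fin d → ℝ → ℝ} (h : ∀ i, Continuous (f i)) :
    Continuous (prodFn f) :=
  continuous_finsetProd _ fun i _ => (h i).comp (continuous_apply i)

lemma contDiff_prodFn {f : Fin d → ℝ → ℝ} (h : ∀ i, ContDiff ℝ ∞ (f i)) :
    ContDiff ℝ ∞ (prodFn f) :=
  contDiff_prod fun i _ => (h i).comp (contDiff_apply ℝ ℝ i)

lemma contDiff_deriv {f : ℝ → ℝ} (h : ContDiff ℝ ∞ f) : ContDiff ℝ ∞ (deriv f) :=
  ((contDiff_succ_iff_deriv (n := ∞)).1 (by simpa using h)).2.2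

lemma contDiff_iterate_deriv {f : ℝ → ℝ} (h : ContDiff ℝ ∞ f) (n : ℕ) :
    ContDiff ℝ ∞ (deriv^[n] f) := by
  induction n with
  | zero => exact h
  | succ n ih =>
    rw [Function.iterate_succ_apply']
    exact contDiff_deriv ih

lemma contDiff_update {f : Fin d → ℝ → ℝ} (h : ∀ i, ContDiff ℝ ∞ (f i)) (i : Fin d) {g : ℝ → ℝ}
    (hg : ContDiff ℝ ∞ g) (j : Fin d) : ContDiff ℝ ∞ (Function.update f i g j) := by
  rcases eq_or_ne j i with rfl | hj
  · rwa [Function.update_self]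
  · rw [Function.update_of_ne hj]
    exact h j

lemma pderiv_prodFn {f : Fin d → ℝ → ℝ} (h : ∀ i, ContDiff ℝ ∞ (f i)) (i : Fin d) :
    pderiv i (prodFn f) = prodFn (Function.update f i (deriv (f i))) := by
  funext x
  have hd : DifferentiableAt ℝ (prodFn f) x := (contDiff_prodFn h).differentiable (by simp) x
  rw [pderiv, ← hd.lineDeriv_eq_fderiv, lineDeriv, prodFn_update]
  have e : (fun t : ℝ => prodFn f (x + t • Pi.single i 1)) =
      fun t => f i (t + x i) * ∏ j ∈ Finset.univ.erase i, f j (x j) := by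
    funext t
    rw [prodFn, ← Finset.mul_prod_erase _ _ (Finset.mem_univ i)]
    congr 1
    · simp [add_comm]
    · refine Finset.prod_congr rfl fun j hj => ?_
      simp [Finset.ne_of_mem_erase hj]
  rw [e, deriv_mul_const, deriv_comp_add_const, zero_add]
  exact (((h i).differentiable (by simp)).comp (by fun_prop)) _

lemma pderivs_prodFn {f : Fin d → ℝ → ℝ} (h : ∀ i, ContDiff ℝ ∞ (f i)) (l : List (Fin d)) :
    pderivs l (prodFn f) = prodFn fun i => deriv^[l.count i] (f i) := by
  induction l with
  | nil => simp [pderivs]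
  | cons i l ih =>
    rw [pderivs, ih, pderiv_prodFn fun j => contDiff_iterate_deriv (h j) _]
    congr 1
    funext j
    rcases eq_or_ne j i with rfl | hj
    · rw [Function.update_self, List.count_cons_self, Function.iterate_succ_apply']
    · rw [Function.update_of_ne hj, List.count_cons_of_ne hj.symm]

lemma isTest_prodFn {f : Fin d → ℝ → ℝ} (h : ∀ i, ContDiff ℝ ∞ (f i))
    (hs : ∀ i, tsupport (f i) ⊆ Set.Ioo 0 1) : IsTest (prodFn f) := by
  have hc : ∀ i, IsCompact (tsupport (f i)) := fun i =>
    (isCompact_Icc (a := (0 : ℝ)) (b := 1)).of_isClosed_subset (isClosed_tsupport _)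
      ((hs i).trans Set.Ioo_subset_Icc_self)
  have hsub : tsupport (prodFn f) ⊆ Set.univ.pi fun i => tsupport (f i) := by
    refine closure_minimal (fun x hx i _ => subset_tsupport _ ?_)
      (isClosed_set_pi fun i _ => isClosed_tsupport _)
    exact fun h0 => hx (Finset.prod_eq_zero (Finset.mem_univ i) h0)
  exact ⟨contDiff_prodFn h, (isCompact_univ_pi hc).of_isClosed_subset (isClosed_tsupport _) hsub,
    hsub.trans (Set.pi_mono fun i _ => hs i)⟩

/-! ### Cut-off functions on the unit interval -/

/-- Smooth cut-off functions supported in `(0,1)` that converge to `1` there. -/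
def cut (m : ℕ) (x : ℝ) : ℝ :=
  Real.smoothTransition ((m + 3) * x - 1) * Real.smoothTransition ((m + 3) * (1 - x) - 1)

lemma contDiff_cut (m : ℕ) : ContDiff ℝ ∞ (cut m) := by
  unfold cut
  exact (Real.smoothTransition.contDiff.comp (by fun_prop)).mul
    (Real.smoothTransition.contDiff.comp (by fun_prop))

lemma tsupport_cut (m : ℕ) : tsupport (cut m) ⊆ Set.Ioo 0 1 := by
  have hm : (0 : ℝ) < m + 3 := by positivity
  have h1 : (0 : ℝ) < 1 / (m + 3) := by positivity
  have : tsupport (cut m) ⊆ Set.Icc (1 / (m + 3 : ℝ)) (1 - 1 / (m + 3)) := by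
    refine closure_minimal (fun x hx => ?_) isClosed_Icc
    constructor
    · by_contra! hlt
      rw [lt_div_iff₀ hm] at hlt
      exact hx (by rw [cut, Real.smoothTransition.zero_of_nonpos (by linarith), zero_mul])
    · by_contra! hlt
      have : 1 - x < 1 / (m + 3) := by linarith
      rw [lt_div_iff₀ hm] at this
      refine hx ?_
      rw [cut, Real.smoothTransition.zero_of_nonpos (x := (m + 3) * (1 - x) - 1) (by linarith),
        mul_zero]
  exact this.trans fun x hx => ⟨by linarith [hx.1], by linarith [hx.2]⟩

lemma abs_cut_le_one (m : ℕ) (x : ℝ) : |cut m x| ≤ 1 := by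
  rw [cut, abs_mul, abs_of_nonneg (Real.smoothTransition.nonneg _),
    abs_of_nonneg (Real.smoothTransition.nonneg _)]
  exact mul_le_one₀ (Real.smoothTransition.le_one _) (Real.smoothTransition.nonneg _)
    (Real.smoothTransition.le_one _)

lemma eventually_cut_arg {x : ℝ} (hx : 0 < x) : ∀ᶠ m : ℕ in atTop, 1 < ((m : ℝ) + 3) * x - 1 := by
  have := tendsto_natCast_atTop_atTop (R := ℝ) |>.eventually_gt_atTop (2 / x)
  filter_upwards [this] with m hm
  rw [div_lt_iff₀ hx] at hm
  nlinarith

lemma eventually_cut_eq_one {x : ℝ} (hx : x ∈ Set.Ioo (0 : ℝ) 1) :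
    ∀ᶠ m : ℕ in atTop, cut m x = 1 := by
  filter_upwards [eventually_cut_arg hx.1, eventually_cut_arg (sub_pos.2 hx.2)] with m h1 h2
  rw [cut, Real.smoothTransition.one_of_one_le h1.le, Real.smoothTransition.one_of_one_le h2.le,
    one_mul]

lemma deriv_smoothTransition_of_lt {t : ℝ} (h : 1 < t) : deriv Real.smoothTransition t = 0 := by
  have : Real.smoothTransition =ᶠ[𝓝 t] fun _ => 1 := by
    filter_upwards [lt_mem_nhds h] with s hs
    exact Real.smoothTransition.one_of_one_le hs.le
  rw [this.deriv_eq, deriv_const]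

/-- The scale-invariant quantity behind all cut-off estimates: for `t = (m + 3) y` it bounds `y`
times the derivative of the cut-off at distance `y` from an end, uniformly in `m`. The derivative
vanishes for `t > 2`, so only a compact interval matters. -/
lemma exists_bound_deriv_smoothTransition :
    ∃ C : ℝ, 0 ≤ C ∧ ∀ t, 0 ≤ t → |t * deriv Real.smoothTransition (t - 1)| ≤ C := by
  have hc : Continuous fun t : ℝ => t * deriv Real.smoothTransition (t - 1) :=
    continuous_id.mul ((contDiff_deriv Real.smoothTransition.contDiff).continuous.comp
      (continuous_id.sub continuous_const))
  obtain ⟨C, hC⟩ := (isCompact_Icc (a := (0 : ℝ)) (b := 2)).exists_bound_of_continuousOn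
    hc.continuousOn
  have hC0 : 0 ≤ C := (norm_nonneg _).trans (hC 0 (by norm_num))
  refine ⟨C, hC0, fun t ht => ?_⟩
  rcases le_or_gt t 2 with h | h
  · exact hC t ⟨ht, h⟩
  · rw [deriv_smoothTransition_of_lt (by linarith)]
    simpa using hC0

lemma deriv_cut (m : ℕ) (x : ℝ) : deriv (cut m) x =
    (m + 3) * deriv Real.smoothTransition ((m + 3) * x - 1) *
        Real.smoothTransition ((m + 3) * (1 - x) - 1)
      - Real.smoothTransition ((m + 3) * x - 1) *
        ((m + 3) * deriv Real.smoothTransition ((m + 3) * (1 - x) - 1)) := by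
  have hd : ∀ t, HasDerivAt Real.smoothTransition (deriv Real.smoothTransition t) t := fun t =>
    ((Real.smoothTransition.contDiff (n := 1)).differentiable (by simp) t).hasDerivAt
  have h1 : HasDerivAt (fun x : ℝ => ((m : ℝ) + 3) * x - 1) (m + 3) x := by
    simpa using ((hasDerivAt_id x).const_mul ((m : ℝ) + 3)).sub_const 1
  have h2 : HasDerivAt (fun x : ℝ => ((m : ℝ) + 3) * (1 - x) - 1) (-(m + 3)) x := by
    simpa using (((hasDerivAt_id x).const_sub 1).const_mul ((m : ℝ) + 3)).sub_const 1
  have := ((hd _).comp x h1).mul ((hd _).comp x h2)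
  have e := this.deriv
  simp only [Function.comp_def] at e
  have e' : deriv (cut m) x = _ := e
  rw [e']
  ring

lemma eventually_deriv_cut_eq_zero {x : ℝ} (hx : x ∈ Set.Ioo (0 : ℝ) 1) :
    ∀ᶠ m : ℕ in atTop, deriv (cut m) x = 0 := by
  filter_upwards [eventually_cut_arg hx.1, eventually_cut_arg (sub_pos.2 hx.2)] with m h1 h2
  rw [deriv_cut, deriv_smoothTransition_of_lt h1, deriv_smoothTransition_of_lt h2]
  ring

/-- `f` vanishes at both ends of the unit interval. -/
def Vanish (f : ℝ → ℝ) : Prop := f 0 = 0 ∧ f 1 = 0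

lemma exists_bound_cut_mul {f : ℝ → ℝ} (h : Continuous f) :
    ∃ C, ∀ m, ∀ x ∈ Set.Ioo (0 : ℝ) 1, ‖cut m x * f x‖ ≤ C := by
  obtain ⟨C, hC⟩ := (isCompact_Icc (a := (0 : ℝ)) (b := 1)).exists_bound_of_continuousOn
    h.continuousOn
  refine ⟨C, fun m x hx => ?_⟩
  rw [norm_mul]
  exact (mul_le_of_le_one_left (norm_nonneg _) (abs_cut_le_one m x)).trans (hC x ⟨hx.1.le, hx.2.le⟩)

lemma tendsto_cut_mul (f : ℝ → ℝ) {x : ℝ} (hx : x ∈ Set.Ioo (0 : ℝ) 1) :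
    Tendsto (fun m => cut m x * f x) atTop (𝓝 (f x)) := by
  refine tendsto_const_nhds.congr' ?_
  filter_upwards [eventually_cut_eq_one hx] with m hm
  rw [hm, one_mul]

lemma deriv_cut_mul {f : ℝ → ℝ} (h : ContDiff ℝ ∞ f) (m : ℕ) (x : ℝ) :
    deriv (fun x => cut m x * f x) x = deriv (cut m) x * f x + cut m x * deriv f x :=
  deriv_fun_mul ((contDiff_cut m).differentiable (by simp) x) (h.differentiable (by simp) x)

lemma tendsto_deriv_cut_mul {f : ℝ → ℝ} (h : ContDiff ℝ ∞ f) {x : ℝ}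
    (hx : x ∈ Set.Ioo (0 : ℝ) 1) :
    Tendsto (fun m => deriv (fun x => cut m x * f x) x) atTop (𝓝 (deriv f x)) := by
  refine tendsto_const_nhds.congr' ?_
  filter_upwards [eventually_cut_eq_one hx, eventually_deriv_cut_eq_zero hx] with m h1 h2
  rw [deriv_cut_mul h, h1, h2]
  ring

/-- The derivative of `cut m` blows up like the reciprocal distance to the boundary, but a smooth
function that vanishes at the ends is of the order of this distance, so the product stays bounded
uniformly in `m`. -/
lemma exists_bound_deriv_cut_mul {f : ℝ → ℝ} (h : ContDiff ℝ ∞ f) (hf : Vanish f) :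
    ∃ C, ∀ m, ∀ x ∈ Set.Ioo (0 : ℝ) 1, ‖deriv (fun x => cut m x * f x) x‖ ≤ C := by
  obtain ⟨L, hL⟩ := (isCompact_Icc (a := (0 : ℝ)) (b := 1)).exists_bound_of_continuousOn
    (contDiff_deriv h).continuous.continuousOn
  obtain ⟨C, hC0, hC⟩ := exists_bound_deriv_smoothTransition
  have hL0 : 0 ≤ L := (norm_nonneg _).trans (hL 0 (by norm_num))
  have lip : ∀ x ∈ Set.Icc (0 : ℝ) 1, ∀ y ∈ Set.Icc (0 : ℝ) 1, ‖f y - f x‖ ≤ L * ‖y - x‖ :=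
    fun x hx y hy => (convex_Icc (0 : ℝ) 1).norm_image_sub_le_of_norm_deriv_le
      (fun z _ => h.differentiable (by simp) z) hL hx hy
  refine ⟨L * C + L * C + L, fun m x hx => ?_⟩
  have hx' : x ∈ Set.Icc (0 : ℝ) 1 := ⟨hx.1.le, hx.2.le⟩
  have hm : (0 : ℝ) < m + 3 := by positivity
  have f0 : |f x| ≤ L * x := by
    have := lip 0 (by norm_num) x hx'
    rwa [hf.1, sub_zero, sub_zero, Real.norm_eq_abs, Real.norm_eq_abs, abs_of_pos hx.1] at this
  have f1 : |f x| ≤ L * (1 - x) := by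
    have := lip 1 (by norm_num) x hx'
    rwa [hf.2, sub_zero, Real.norm_eq_abs, Real.norm_eq_abs, abs_sub_comm,
      abs_of_pos (sub_pos.2 hx.2)] at this
  have key : ∀ y, 0 < y → |f x| ≤ L * y → ∀ s, |s| ≤ 1 →
      |((m + 3 : ℝ) * deriv Real.smoothTransition ((m + 3) * y - 1)) * s * f x| ≤ L * C := by
    intro y hy hfy s hs
    have hb := hC ((m + 3) * y) (by positivity)
    rw [abs_mul, abs_of_pos (by positivity : 0 < (m + 3 : ℝ) * y)] at hb
    rw [abs_mul, abs_mul, abs_mul, abs_of_pos hm]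
    set D := |deriv Real.smoothTransition ((m + 3) * y - 1)|
    have hD : 0 ≤ D := abs_nonneg _
    calc (m + 3) * D * |s| * |f x| ≤ (m + 3) * D * 1 * (L * y) := by gcongr
      _ = L * ((m + 3) * y * D) := by ring
      _ ≤ L * C := by gcongr
  rw [Real.norm_eq_abs, deriv_cut_mul h, deriv_cut]
  have st : ∀ t, |Real.smoothTransition t| ≤ 1 := fun t => by
    rw [abs_of_nonneg (Real.smoothTransition.nonneg _)]
    exact Real.smoothTransition.le_one _
  have k1 := key x hx.1 f0 _ (st ((m + 3) * (1 - x) - 1))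
  have k2 := key (1 - x) (sub_pos.2 hx.2) f1 _ (st ((m + 3) * x - 1))
  have k3 : |cut m x * deriv f x| ≤ L := by
    rw [abs_mul]
    exact (mul_le_of_le_one_left (abs_nonneg _) (abs_cut_le_one m x)).trans (hL x hx')
  rw [abs_le] at *
  constructor <;> linarith [k1.1, k1.2, k2.1, k2.2, k3.1, k3.2]

lemma contDiff_cut_mul {f : ℝ → ℝ} (h : ContDiff ℝ ∞ f) (m : ℕ) :
    ContDiff ℝ ∞ fun x => cut m x * f x := (contDiff_cut m).mul h

/-! ### Removal of cut-off functions -/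

lemma tendsto_integral_prodFn (v : L2 d) {h : Fin d → ℝ → ℝ} (hh : ∀ j, Continuous (h j))
    (i : Fin d) {g : ℕ → ℝ → ℝ} {g' : ℝ → ℝ} {C : ℝ} (hg : ∀ n, Continuous (g n))
    (hC : ∀ n, ∀ x ∈ Set.Ioo (0 : ℝ) 1, ‖g n x‖ ≤ C)
    (hlim : ∀ x ∈ Set.Ioo (0 : ℝ) 1, Tendsto (fun n => g n x) atTop (𝓝 (g' x))) :
    Tendsto (fun n => ∫ x in cube d, v x * prodFn (Function.update h i (g n)) x) atTop
      (𝓝 (∫ x in cube d, v x * prodFn (Function.update h i g') x)) := by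
  have hcont : Continuous fun x : Fin d → ℝ => ∏ j ∈ Finset.univ.erase i, h j (x j) :=
    continuous_finsetProd _ fun j _ => (hh j).comp (continuous_apply j)
  obtain ⟨D, hD⟩ := exists_bound_on_cube hcont
  simp only [prodFn_update]
  refine tendsto_integral_mul v (C := C * D)
    (fun n => ((hg n).comp (continuous_apply i)).mul hcont) (fun n x hx => ?_) fun x hx => ?_
  · rw [norm_mul]
    exact mul_le_mul (hC n _ (hx i trivial)) (hD x hx) (norm_nonneg _)
      ((norm_nonneg _).trans (hC n _ (hx i trivial)))
  · exact (hlim _ (hx i trivial)).mul_const _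

/-- A relation that holds for products of compactly supported functions extends to those products
for which the cut-off functions can be removed one direction at a time. -/
lemma eq_zero_of_cutoff {L : (Fin d → ℝ → ℝ) → ℝ} {C : Fin d → (ℝ → ℝ) → Prop}
    (h0 : ∀ f : Fin d → ℝ → ℝ, (∀ i, ContDiff ℝ ∞ (f i)) →
      (∀ i, tsupport (f i) ⊆ Set.Ioo 0 1) → L f = 0)
    (hlim : ∀ (i : Fin d) (f : Fin d → ℝ → ℝ), (∀ i, ContDiff ℝ ∞ (f i)) → C i (f i) →
      Tendsto (fun m => L (Function.update f i fun x => cut m x * f i x)) atTop (𝓝 (L f)))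
    (f : Fin d → ℝ → ℝ) (hf : ∀ i, ContDiff ℝ ∞ (f i)) (hC : ∀ i, C i (f i)) : L f = 0 := by
  -- Induction on the set `s` of directions in which the factor need not have compact support; each
  -- insertion removes the cut-off in one more direction.
  suffices H : ∀ (s : Finset (Fin d)) (f : Fin d → ℝ → ℝ), (∀ i, ContDiff ℝ ∞ (f i)) →
      (∀ i ∈ s, C i (f i)) → (∀ i ∉ s, tsupport (f i) ⊆ Set.Ioo 0 1) → L f = 0 from
    H Finset.univ f hf (fun i _ => hC i) fun i hi => absurd (Finset.mem_univ i) hi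
  intro s
  induction s using Finset.induction_on with
  | empty => exact fun f hf _ hs => h0 f hf fun i => hs i (Finset.notMem_empty i)
  | insert i s his ih =>
    intro f hf hfC hfs
    refine tendsto_nhds_unique (hlim i f hf (hfC i (Finset.mem_insert_self i s))) ?_
    refine tendsto_const_nhds.congr fun m => (ih _ ?_ ?_ ?_).symm
    · exact contDiff_update hf i (contDiff_cut_mul (hf i) m)
    · intro j hj
      rw [Function.update_of_ne (fun h : j = i => his (h ▸ hj))]
      exact hfC j (Finset.mem_insert_of_mem hj)
    · intro j hj
      rcases eq_or_ne j i with rfl | hji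
      · rw [Function.update_self]
        exact (tsupport_mul_subset_left).trans (tsupport_cut m)
      · rw [Function.update_of_ne hji]
        exact hfs j fun h => (Finset.mem_insert.1 h).elim hji hj

/-- Conditions under which a cut-off function in direction `i` can be removed from
`∫ v ∂^a f`, where `f` is a product and `a` is the order of differentiation in direction `i`. -/
def Removable (v : L2 d) (i : Fin d) (a : ℕ) (g : ℝ → ℝ) : Prop :=
  a = 0 ∨ (a = 1 ∧ (Vanish g ∨ ZeroOnFaces i v)) ∨ (a = 2 ∧ Vanish g ∧ ZeroOnFaces i v)

lemma ZeroOnFaces.integral_prodFn {v : L2 d} {i : Fin d} (hv : ZeroOnFaces i v)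
    {h : Fin d → ℝ → ℝ} (hh : ∀ j, ContDiff ℝ ∞ (h j)) {g : ℝ → ℝ} (hg : ContDiff ℝ ∞ g) :
    ∫ x in cube d, v x * prodFn (Function.update h i (deriv g)) x =
      -∫ x in cube d, WD [i] v x * prodFn (Function.update h i g) x := by
  have hu := contDiff_update hh i hg
  rw [hv.integral_wd_mul (contDiff_prodFn hu), pderiv_prodFn hu, Function.update_self,
    Function.update_idem, neg_neg]

/-- Dominated convergence in the single direction `i`. A derivative that falls on the cut-off is
harmless if the factor vanishes at the ends. If instead `v` vanishes on the faces, one derivative is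
moved to `v` beforehand. For second order both mechanisms are used, one per derivative. -/
lemma tendsto_cutoff {v : L2 d} {a : Fin d → ℕ} (i : Fin d) (f : Fin d → ℝ → ℝ)
    (hf : ∀ i, ContDiff ℝ ∞ (f i)) (h : Removable v i (a i) (f i)) :
    Tendsto (fun m => ∫ x in cube d, v x *
        prodFn (fun j => deriv^[a j] (Function.update f i (fun x => cut m x * f i x) j)) x) atTop
      (𝓝 (∫ x in cube d, v x * prodFn (fun j => deriv^[a j] (f j)) x)) := by
  set F : Fin d → ℝ → ℝ := fun j => deriv^[a j] (f j) with hF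
  have hFs : ∀ j, ContDiff ℝ ∞ (F j) := fun j => contDiff_iterate_deriv (hf j) _
  have e : ∀ g : ℝ → ℝ, (fun j => deriv^[a j] (Function.update f i g j)) =
      Function.update F i (deriv^[a i] g) := fun g => by
    funext j
    exact Function.apply_update (fun j => deriv^[a j]) f i g j
  have e' : F = Function.update F i (deriv^[a i] (f i)) := (Function.update_eq_self i F).symm
  simp only [e]
  rw [e']
  simp only [Function.update_idem]
  obtain ⟨C, hC⟩ := exists_bound_cut_mul (hf i).continuous
  rcases h with h | ⟨h, h' | h'⟩ | ⟨h, h', h''⟩ <;> rw [h]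
  · exact tendsto_integral_prodFn v (fun j => (hFs j).continuous) i
      (fun m => (contDiff_cut_mul (hf i) m).continuous) hC fun x hx => tendsto_cut_mul _ hx
  · obtain ⟨C', hC'⟩ := exists_bound_deriv_cut_mul (hf i) h'
    exact tendsto_integral_prodFn v (fun j => (hFs j).continuous) i
      (fun m => (contDiff_deriv (contDiff_cut_mul (hf i) m)).continuous) hC'
      fun x hx => tendsto_deriv_cut_mul (hf i) hx
  · simp only [Function.iterate_one]
    rw [h'.integral_prodFn hFs (hf i)]
    simp only [fun m => h'.integral_prodFn hFs (contDiff_cut_mul (hf i) m)]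
    exact (tendsto_integral_prodFn _ (fun j => (hFs j).continuous) i
      (fun m => (contDiff_cut_mul (hf i) m).continuous) hC fun x hx => tendsto_cut_mul _ hx).neg
  · obtain ⟨C', hC'⟩ := exists_bound_deriv_cut_mul (hf i) h'
    simp only [Function.iterate_succ, Function.iterate_zero, Function.comp_apply, id]
    rw [h''.integral_prodFn hFs (contDiff_deriv (hf i))]
    simp only [fun m => h''.integral_prodFn hFs (contDiff_deriv (contDiff_cut_mul (hf i) m))]
    exact (tendsto_integral_prodFn _ (fun j => (hFs j).continuous) i
      (fun m => (contDiff_deriv (contDiff_cut_mul (hf i) m)).continuous) hC'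
      fun x hx => tendsto_deriv_cut_mul (hf i) hx).neg

/-- A weak derivative may be tested with products of smooth functions that need not have compact
support, provided the cut-off functions are removable. -/
lemma IsWeakDeriv.integral_prodFn {l : List (Fin d)} {v g : L2 d} (h : IsWeakDeriv l v g)
    {f : Fin d → ℝ → ℝ} (hf : ∀ i, ContDiff ℝ ∞ (f i))
    (hr : ∀ i, Removable v i (l.count i) (f i)) :
    ∫ x in cube d, v x * prodFn (fun i => deriv^[l.count i] (f i)) x =
      (-1) ^ l.length * ∫ x in cube d, g x * prodFn f x := by
  rw [← sub_eq_zero]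
  refine eq_zero_of_cutoff (L := fun f => (∫ x in cube d, v x *
      prodFn (fun i => deriv^[l.count i] (f i)) x) - (-1) ^ l.length * ∫ x in cube d, g x * prodFn f x)
    (C := fun i => Removable v i (l.count i)) ?_ ?_ f hf hr
  · intro f hf hs
    rw [sub_eq_zero, ← pderivs_prodFn hf]
    exact h _ (isTest_prodFn hf hs)
  · intro i f hf hi
    refine (tendsto_cutoff i f hf hi).sub (Tendsto.const_mul _ ?_)
    exact tendsto_cutoff (a := fun _ => 0) i f hf (Or.inl rfl)

/-! ### Trigonometric functions on the unit interval -/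

/-- The `L²(0,1)`-normalized functions `√2 sin (π n x)` (`false`) and `√2 cos (π n x)` (`true`),
where the cosine with `n = 0` is `1`. -/
def trig : Bool → ℕ → ℝ → ℝ
  | false, n, x => √2 * Real.sin (Real.pi * n * x)
  | true, n, x => if n = 0 then 1 else √2 * Real.cos (Real.pi * n * x)

/-- The sign in the derivative of `trig`. -/
def dsgn (β : Bool) : ℝ := if β then -1 else 1

lemma trig_true_pos {n : ℕ} (h : n ≠ 0) :
    trig true n = fun x => √2 * Real.cos (Real.pi * n * x) := by
  funext x
  simp [trig, h]

lemma trig_true_zero : trig true 0 = fun _ => 1 := by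
  funext x
  simp [trig]

lemma trig_false_zero : trig false 0 = fun _ => 0 := by
  funext x
  simp [trig]

lemma contDiff_trig (β : Bool) (n : ℕ) : ContDiff ℝ ∞ (trig β n) := by
  cases β
  · unfold trig
    exact contDiff_const.mul (Real.contDiff_sin.comp (by fun_prop))
  · rcases eq_or_ne n 0 with rfl | h
    · rw [trig_true_zero]
      exact contDiff_const
    · rw [trig_true_pos h]
      exact contDiff_const.mul (Real.contDiff_cos.comp (by fun_prop))

lemma deriv_trig (β : Bool) (n : ℕ) :
    deriv (trig β n) = fun x => dsgn β * (Real.pi * n) * trig (!β) n x := by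
  funext x
  have hl : HasDerivAt (fun x : ℝ => Real.pi * n * x) (Real.pi * n) x := by
    simpa using (hasDerivAt_id x).const_mul (Real.pi * n)
  rcases eq_or_ne n 0 with rfl | h
  · cases β
    · rw [trig_false_zero]
      simp
    · rw [trig_true_zero]
      simp
  · cases β
    · have : HasDerivAt (trig false n) _ x := (hl.sin).const_mul √2
      rw [this.deriv, Bool.not_false, trig_true_pos h]
      simp [dsgn]
      ring
    · rw [trig_true_pos h]
      have : HasDerivAt (fun x => √2 * Real.cos (Real.pi * n * x)) _ x := (hl.cos).const_mul √2
      rw [this.deriv]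
      simp [dsgn, trig]
      ring

lemma vanish_trig_false (n : ℕ) : Vanish (trig false n) := by
  constructor
  · simp [trig]
  · simp [trig, mul_comm Real.pi, Real.sin_nat_mul_pi]

/-- Product-to-sum formula. The normalization of the constant mode makes `n = 0` and `n = 1`
separate cases. -/
lemma cos_mul_trig_true (n : ℕ) : ∃ (a b : ℝ) (m m' : ℕ), ∀ x,
    Real.cos (Real.pi * x) * trig true n x = a * trig true m x + b * trig true m' x := by
  have h2 : √2 * √2 = 2 := Real.mul_self_sqrt (by norm_num)
  rcases n with _ | _ | n
  · refine ⟨√2 / 2, 0, 1, 0, fun x => ?_⟩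
    simp only [trig]
    norm_num
    linear_combination (-1 / 2 * Real.cos (Real.pi * x)) * h2
  · refine ⟨1 / 2, √2 / 2, 2, 0, fun x => ?_⟩
    simp only [trig]
    norm_num
    have : Real.pi * 2 * x = 2 * (Real.pi * x) := by ring
    rw [this, Real.cos_two_mul]
    ring
  · refine ⟨1 / 2, 1 / 2, n + 1, n + 3, fun x => ?_⟩
    simp only [trig]
    norm_num
    have h1 : Real.pi * (n + 1) * x = Real.pi * (n + 2) * x - Real.pi * x := by ring
    have h3 : Real.pi * (n + 3) * x = Real.pi * (n + 2) * x + Real.pi * x := by ring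
    have h4 : (n : ℝ) + 1 + 1 = n + 2 := by ring
    rw [h1, h3, h4, Real.cos_sub, Real.cos_add]
    ring

/-- Multiplication by `sin (π x)` turns cosines into sines, which reduces completeness of the sines
to that of the cosines. -/
lemma sin_mul_trig_true (n : ℕ) : ∃ (a b : ℝ) (m m' : ℕ), ∀ x,
    Real.sin (Real.pi * x) * trig true n x = a * trig false m x + b * trig false m' x := by
  have h2 : √2 * √2 = 2 := Real.mul_self_sqrt (by norm_num)
  rcases n with _ | n
  · refine ⟨√2 / 2, 0, 1, 0, fun x => ?_⟩
    simp only [trig]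
    norm_num
    linear_combination (-1 / 2 * Real.sin (Real.pi * x)) * h2
  · refine ⟨1 / 2, -1 / 2, n + 2, n, fun x => ?_⟩
    simp only [trig]
    norm_num
    have h1 : Real.pi * n * x = Real.pi * (n + 1) * x - Real.pi * x := by ring
    have h3 : Real.pi * (n + 2) * x = Real.pi * (n + 1) * x + Real.pi * x := by ring
    rw [h1, h3, Real.sin_sub, Real.sin_add]
    ring

lemma integral_cos_int (k : ℤ) :
    ∫ x in (0 : ℝ)..1, Real.cos (Real.pi * k * x) = if k = 0 then 1 else 0 := by
  rcases eq_or_ne k 0 with rfl | h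
  · simp
  · have hk : Real.pi * k ≠ 0 := mul_ne_zero Real.pi_ne_zero (Int.cast_ne_zero.2 h)
    rw [intervalIntegral.integral_comp_mul_left _ hk, integral_cos, if_neg h]
    simp [mul_comm Real.pi, Real.sin_int_mul_pi]

lemma intervalIntegrable_cos (k : ℤ) :
    IntervalIntegrable (fun x => Real.cos (Real.pi * k * x)) volume 0 1 :=
  Continuous.intervalIntegrable (by fun_prop) _ _

/-- The sine with `n = 0` is the zero function and must be excluded for the normalization. -/
lemma integral_trig_mul_trig (β : Bool) (n m : ℕ) (hn : β = false → n ≠ 0) :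
    ∫ x in Set.Ioo (0 : ℝ) 1, trig β n x * trig β m x = if n = m then 1 else 0 := by
  have h2 : √2 * √2 = 2 := Real.mul_self_sqrt (by norm_num)
  rw [← integral_Ioc_eq_integral_Ioo, ← intervalIntegral.integral_of_le zero_le_one]
  have i1 := intervalIntegrable_cos (n - m)
  have i2 := intervalIntegrable_cos (n + m)
  have hsub := integral_cos_int (n - m)
  have hadd := integral_cos_int (n + m)
  have ec : ∀ x : ℝ, (√2 * Real.cos (Real.pi * n * x)) * (√2 * Real.cos (Real.pi * m * x)) =
      Real.cos (Real.pi * ((n - m : ℤ) : ℝ) * x) + Real.cos (Real.pi * ((n + m : ℤ) : ℝ) * x) := by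
    intro x
    have h1 : Real.pi * ((n - m : ℤ) : ℝ) * x = Real.pi * n * x - Real.pi * m * x := by
      push_cast; ring
    have h3 : Real.pi * ((n + m : ℤ) : ℝ) * x = Real.pi * n * x + Real.pi * m * x := by
      push_cast; ring
    rw [h1, h3, Real.cos_sub, Real.cos_add]
    linear_combination (Real.cos (Real.pi * n * x) * Real.cos (Real.pi * m * x)) * h2
  have es : ∀ x : ℝ, (√2 * Real.sin (Real.pi * n * x)) * (√2 * Real.sin (Real.pi * m * x)) =
      Real.cos (Real.pi * ((n - m : ℤ) : ℝ) * x) - Real.cos (Real.pi * ((n + m : ℤ) : ℝ) * x) := by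
    intro x
    have h1 : Real.pi * ((n - m : ℤ) : ℝ) * x = Real.pi * n * x - Real.pi * m * x := by
      push_cast; ring
    have h3 : Real.pi * ((n + m : ℤ) : ℝ) * x = Real.pi * n * x + Real.pi * m * x := by
      push_cast; ring
    rw [h1, h3, Real.cos_sub, Real.cos_add]
    linear_combination (Real.sin (Real.pi * n * x) * Real.sin (Real.pi * m * x)) * h2
  have hnm : ((n : ℤ) - m = 0) ↔ n = m := by omega
  cases β
  · have h0 : (n : ℤ) + m ≠ 0 := by have := hn rfl; omega
    simp only [trig, es]
    rw [intervalIntegral.integral_sub i1 i2, hsub, hadd, if_neg h0, sub_zero]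
    simp only [hnm]
  · rcases eq_or_ne n 0 with rfl | hn0 <;> rcases eq_or_ne m 0 with rfl | hm0
    · simp [trig]
    · have := integral_cos_int m
      simp only [trig_true_zero, trig_true_pos hm0, one_mul, intervalIntegral.integral_const_mul]
      rw [if_neg (Int.natCast_ne_zero.2 hm0)] at this
      rw [if_neg hm0.symm]
      simp only [Int.cast_natCast] at this
      rw [this, mul_zero]
    · have := integral_cos_int n
      simp only [trig_true_zero, trig_true_pos hn0, mul_one, intervalIntegral.integral_const_mul]
      rw [if_neg (Int.natCast_ne_zero.2 hn0)] at this
      rw [if_neg hn0]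
      simp only [Int.cast_natCast] at this
      rw [this, mul_zero]
    · have h0 : (n : ℤ) + m ≠ 0 := by omega
      simp only [trig_true_pos hn0, trig_true_pos hm0, ec]
      rw [intervalIntegral.integral_add i1 i2, hsub, hadd, if_neg h0, add_zero]
      simp only [hnm]

/-! ### Trigonometric products on the cube -/

/-- The product with sines in the directions where `β` is `false` and cosines elsewhere. -/
def mode (β : Fin d → Bool) (n : Fin d → ℕ) : (Fin d → ℝ) → ℝ := prodFn fun i => trig (β i) (n i)

lemma contDiff_mode (β : Fin d → Bool) (n : Fin d → ℕ) : ContDiff ℝ ∞ (mode β n) :=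
  contDiff_prodFn fun _ => contDiff_trig _ _

lemma continuous_mode (β : Fin d → Bool) (n : Fin d → ℕ) : Continuous (mode β n) :=
  (contDiff_mode β n).continuous

/-- The indices for which `mode β n` does not vanish identically. -/
def ModeIndex (β : Fin d → Bool) (n : Fin d → ℕ) : Prop := ∀ i, β i = false → n i ≠ 0

lemma mode_eq_zero {β : Fin d → Bool} {n : Fin d → ℕ} (h : ¬ModeIndex β n) :
    mode β n = fun _ => 0 := by
  simp only [ModeIndex, not_forall, not_not] at h
  obtain ⟨i, hi, hn⟩ := h
  funext x
  refine Finset.prod_eq_zero (Finset.mem_univ i) ?_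
  simp only [hi, hn, trig_false_zero]

lemma integral_cube_prodFn (f : Fin d → ℝ → ℝ) :
    ∫ x in cube d, prodFn f x = ∏ i, ∫ x in Set.Ioo (0 : ℝ) 1, f i x := by
  rw [cube, volume_pi, Measure.restrict_pi_pi]
  exact integral_fintype_prod_eq_prod f

/-- The Fourier coefficient of `v` with respect to `mode β n`. -/
def coef (β : Fin d → Bool) (n : Fin d → ℕ) (v : L2 d) : ℝ := ∫ x in cube d, v x * mode β n x

lemma coef_eq_inner (β : Fin d → Bool) (n : Fin d → ℕ) (v : L2 d) :
    coef β n v = inner ℝ v (cl (mode β n)) := (inner_cl v (continuous_mode β n)).symm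

lemma coef_eq_zero {β : Fin d → Bool} {n : Fin d → ℕ} (h : ¬ModeIndex β n) (v : L2 d) :
    coef β n v = 0 := by
  simp [coef, mode_eq_zero h]

lemma coef_add (β : Fin d → Bool) (n : Fin d → ℕ) (v w : L2 d) :
    coef β n (v + w) = coef β n v + coef β n w := by
  simp only [coef_eq_inner, inner_add_left]

lemma coef_sub (β : Fin d → Bool) (n : Fin d → ℕ) (v w : L2 d) :
    coef β n (v - w) = coef β n v - coef β n w := by
  simp only [coef_eq_inner, inner_sub_left]

lemma coef_smul (β : Fin d → Bool) (n : Fin d → ℕ) (c : ℝ) (v : L2 d) :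
    coef β n (c • v) = c * coef β n v := by
  simp only [coef_eq_inner, real_inner_smul_left]

lemma coef_sum (β : Fin d → Bool) (n : Fin d → ℕ) {ι : Type*} (s : Finset ι) (v : ι → L2 d) :
    coef β n (∑ i ∈ s, v i) = ∑ i ∈ s, coef β n (v i) := by
  simp only [coef_eq_inner, sum_inner]

lemma orthonormal_mode (β : Fin d → Bool) :
    Orthonormal ℝ fun n : {n : Fin d → ℕ // ModeIndex β n} => cl (mode β n.1) := by
  classical
  rw [orthonormal_iff_ite]
  rintro ⟨n, hn⟩ ⟨m, hm⟩
  rw [inner_cl _ (continuous_mode β m)]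
  have : ∫ x in cube d, cl (mode β n) x * mode β m x = ∫ x in cube d,
      prodFn (fun i x => trig (β i) (n i) x * trig (β i) (m i) x) x := by
    refine integral_congr_ae ?_
    filter_upwards [coeFn_cl (continuous_mode β n)] with x hx
    rw [hx, mode, mode, prodFn, prodFn, prodFn, Finset.prod_mul_distrib]
  rw [this, integral_cube_prodFn]
  simp only [fun i => integral_trig_mul_trig (β i) (n i) (m i) (hn i), Subtype.mk.injEq,
    Finset.prod_ite_zero, Finset.prod_const_one, Finset.mem_univ, true_implies, funext_iff]

/-! ### Completeness -/

lemma mode_update (β : Fin d → Bool) (n : Fin d → ℕ) (i : Fin d) (b : Bool) (k : ℕ)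
    (x : Fin d → ℝ) : mode (Function.update β i b) (Function.update n i k) x =
      trig b k (x i) * ∏ j ∈ Finset.univ.erase i, trig (β j) (n j) (x j) := by
  rw [← prodFn_update, mode]
  congr 1
  funext j
  rcases eq_or_ne j i with rfl | hj
  · simp
  · simp [hj]

lemma mode_update_index (β : Fin d → Bool) (n : Fin d → ℕ) (i : Fin d) (k : ℕ)
    (x : Fin d → ℝ) : mode β (Function.update n i k) x =
      trig (β i) k (x i) * ∏ j ∈ Finset.univ.erase i, trig (β j) (n j) (x j) := by
  rw [← mode_update, Function.update_eq_self]

/-- Polynomials in `cos (π x_i)` preserve orthogonality to the cosine products. -/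
lemma integral_polynomial_cos (v : L2 d) (p : C(Fin d → ℝ, ℝ))
    (hp : p ∈ Algebra.adjoin ℝ
      (Set.range fun i : Fin d => (⟨fun t => t i, continuous_apply i⟩ : C(Fin d → ℝ, ℝ)))) :
    ∀ h : (Fin d → ℝ) → ℝ, Continuous h →
      (∀ n, ∫ x in cube d, v x * (h x * mode (fun _ => true) n x) = 0) →
      ∀ n, ∫ x in cube d, v x * (h x * p (fun i => Real.cos (Real.pi * x i)) *
        mode (fun _ => true) n x) = 0 := by
  have hcos : Continuous fun (x : Fin d → ℝ) (i : Fin d) => Real.cos (Real.pi * x i) := by fun_prop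
  have hm := fun n => continuous_mode (fun _ : Fin d => true) n
  induction hp using Algebra.adjoin_induction with
  | mem p hp =>
    obtain ⟨i, rfl⟩ := hp
    intro h hh h0 n
    obtain ⟨a, b, m, m', hab⟩ := cos_mul_trig_true (n i)
    have e : ∀ x, v x * (h x * Real.cos (Real.pi * x i) * mode (fun _ => true) n x) =
        a * (v x * (h x * mode (fun _ => true) (Function.update n i m) x)) +
        b * (v x * (h x * mode (fun _ => true) (Function.update n i m') x)) := by
      intro x
      rw [mode_update_index, mode_update_index, ← Function.update_eq_self i n, mode_update_index,
        Function.update_eq_self]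
      linear_combination (v x * h x *
        ∏ j ∈ Finset.univ.erase i, trig true (n j) (x j)) * hab (x i)
    simp only [ContinuousMap.coe_mk, e]
    rw [integral_add, integral_const_mul, integral_const_mul, h0, h0]
    · simp
    · exact (integrable_mul_continuous v (hh.mul (hm _))).const_mul a
    · exact (integrable_mul_continuous v (hh.mul (hm _))).const_mul b
  | algebraMap r =>
    intro h hh h0 n
    have e : ∀ x, v x * (h x * r * mode (fun _ => true) n x) =
        r * (v x * (h x * mode (fun _ => true) n x)) := fun x => by ring
    have e' : ∀ t, (algebraMap ℝ C(Fin d → ℝ, ℝ) r) t = r := fun t => rfl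
    simp only [e', e, integral_const_mul, h0, mul_zero]
  | add p q _ _ ihp ihq =>
    intro h hh h0 n
    have e : ∀ x, v x * (h x * (p + q) (fun i => Real.cos (Real.pi * x i)) *
          mode (fun _ => true) n x) =
        v x * (h x * p (fun i => Real.cos (Real.pi * x i)) * mode (fun _ => true) n x) +
        v x * (h x * q (fun i => Real.cos (Real.pi * x i)) * mode (fun _ => true) n x) := by
      intro x
      rw [ContinuousMap.add_apply]
      ring
    simp only [e]
    rw [integral_add, ihp h hh h0, ihq h hh h0, add_zero]
    · exact integrable_mul_continuous v ((hh.mul (p.continuous.comp hcos)).mul (hm n))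
    · exact integrable_mul_continuous v ((hh.mul (q.continuous.comp hcos)).mul (hm n))
  | mul p q _ _ ihp ihq =>
    intro h hh h0 n
    -- The weight `h` is universally quantified in the induction precisely for this: the hypothesis
    -- for `q` is used with the weight `h * p`.
    have := ihq (fun x => h x * p fun i => Real.cos (Real.pi * x i))
      (hh.mul (p.continuous.comp hcos)) (ihp h hh h0) n
    simpa only [ContinuousMap.mul_apply, mul_assoc] using this

/-- The substitution `t_i = cos (π x_i)` maps the cube into `[-1, 1]^d`, where polynomials are dense
by Stone–Weierstrass. A function orthogonal to all cosine products is orthogonal to all polynomials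
in the `cos (π x_i)`, hence to every test function. -/
lemma eq_zero_of_cosine_coef {v : L2 d} (h : ∀ n, coef (fun _ => true) n v = 0) : v = 0 := by
  refine eq_zero_of_forall_test fun φ hφ => ?_
  have hcos : Continuous fun (x : Fin d → ℝ) (i : Fin d) => Real.cos (Real.pi * x i) := by fun_prop
  have harc : Continuous fun (t : Fin d → ℝ) (i : Fin d) => Real.arccos (t i) / Real.pi := by
    have := Real.continuous_arccos
    fun_prop
  set A := Algebra.adjoin ℝ
    (Set.range fun i : Fin d => (⟨fun t => t i, continuous_apply i⟩ : C(Fin d → ℝ, ℝ)))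
  have sep : A.SeparatesPoints := by
    intro s t hst
    obtain ⟨i, hi⟩ := Function.ne_iff.1 hst
    exact ⟨_, ⟨_, Algebra.subset_adjoin ⟨i, rfl⟩, rfl⟩, hi⟩
  have bound : ∀ ε > 0, |∫ x in cube d, v x * φ x| ≤ ε * ∫ x in cube d, ‖v x‖ := by
    intro ε hε
    obtain ⟨p, hp, hpε⟩ :=
      ContinuousMap.exists_mem_subalgebra_near_continuous_of_isCompact_of_separatesPoints sep
        ⟨fun t => φ fun i => Real.arccos (t i) / Real.pi, hφ.continuous.comp harc⟩
        (isCompact_Icc (a := (-1 : Fin d → ℝ)) (b := 1)) hε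
    have h0 := integral_polynomial_cos v p hp (fun _ => 1) continuous_const
      (fun n => by simpa [coef] using h n) 0
    have m0 : mode (fun _ : Fin d => true) 0 = fun _ => 1 := by
      funext x
      simp [mode, prodFn, trig]
    simp only [m0, one_mul, mul_one] at h0
    have near : ∀ x ∈ cube d, ‖φ x - p fun i => Real.cos (Real.pi * x i)‖ ≤ ε := by
      intro x hx
      have := hpε (fun i => Real.cos (Real.pi * x i))
        ⟨fun i => Real.neg_one_le_cos _, fun i => Real.cos_le_one _⟩
      have e : (fun i => Real.arccos (Real.cos (Real.pi * x i)) / Real.pi) = x := by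
        funext i
        have hxi := hx i trivial
        rw [Real.arccos_cos (mul_nonneg Real.pi_pos.le hxi.1.le)
          (mul_le_of_le_one_right Real.pi_pos.le hxi.2.le), mul_div_cancel_left₀ _ Real.pi_ne_zero]
      simp only [ContinuousMap.coe_mk, e] at this
      rw [norm_sub_rev]
      exact this.le
    have i1 := integrable_mul_continuous v hφ.continuous
    have i2 : Integrable (fun x => v x * p fun i => Real.cos (Real.pi * x i))
      (volume.restrict (cube d)) := integrable_mul_continuous v (p.continuous.comp hcos)
    have : ∫ x in cube d, v x * φ x =
        ∫ x in cube d, v x * (φ x - p fun i => Real.cos (Real.pi * x i)) := by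
      simp only [mul_sub]
      rw [integral_sub i1 i2, h0, sub_zero]
    rw [this, ← integral_const_mul, ← Real.norm_eq_abs]
    refine norm_integral_le_of_norm_le ((integrable_coe v).norm.const_mul ε)
      ((ae_restrict_iff' measurableSet_cube).2 (Eventually.of_forall fun x hx => ?_))
    rw [norm_mul, mul_comm]
    exact mul_le_mul_of_nonneg_right (near x hx) (norm_nonneg _)
  have hI : 0 ≤ ∫ x in cube d, ‖v x‖ := integral_nonneg fun _ => norm_nonneg _
  rw [← abs_eq_zero]
  refine le_antisymm (le_of_forall_pos_le_add fun δ hδ => ?_) (abs_nonneg _)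
  -- The `+ 1` keeps the denominator positive when the integral vanishes.
  have := bound (δ / ((∫ x in cube d, ‖v x‖) + 1)) (by positivity)
  refine this.trans ?_
  rw [zero_add, div_mul_eq_mul_div, div_le_iff₀ (by positivity)]
  nlinarith

/-- Induction on the set of sine directions. If `v` is orthogonal to the products with a sine in
direction `i`, then `sin (π x_i) v` is orthogonal to those with a cosine there, hence zero, and the
factor `sin (π x_i)` is positive on the cube. -/
lemma eq_zero_of_coef {β : Fin d → Bool} {v : L2 d} (h : ∀ n, coef β n v = 0) : v = 0 := by
  suffices H : ∀ (s : Finset (Fin d)) (v : L2 d),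
      (∀ n, coef (fun i => decide (i ∉ s)) n v = 0) → v = 0 by
    refine H (Finset.univ.filter fun i => β i = false) v fun n => ?_
    convert h n using 2
    funext i
    simp
  intro s
  induction s using Finset.induction_on with
  | empty => exact fun v hv => eq_zero_of_cosine_coef (by simpa using hv)
  | insert i s his ih =>
    intro v hv
    have hsin : Continuous fun x : Fin d → ℝ => Real.sin (Real.pi * x i) := by fun_prop
    have hmem : MemLp (fun x => Real.sin (Real.pi * x i) * v x) 2 (volume.restrict (cube d)) := by
      refine (Lp.memLp v).of_le (hsin.aestronglyMeasurable.mul (Lp.aestronglyMeasurable v))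
        (Eventually.of_forall fun x => ?_)
      rw [norm_mul]
      exact mul_le_of_le_one_left (norm_nonneg _) (Real.abs_sin_le_one _)
    have hz : hmem.toLp _ = 0 := by
      refine ih _ fun n => ?_
      obtain ⟨a, b, m, m', hab⟩ := sin_mul_trig_true (n i)
      set β : Fin d → Bool := fun j => decide (j ∉ s) with hβ
      have hβi : β i = true := by simp [hβ, his]
      have hβ' : (fun j => decide (j ∉ insert i s)) = Function.update β i false := by
        funext j
        rcases eq_or_ne j i with rfl | hj
        · simp
        · simp [hβ, hj]
      rw [hβ'] at hv
      have e : coef β n (hmem.toLp _) = ∫ x in cube d,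
          (a * (v x * mode (Function.update β i false) (Function.update n i m) x) +
          b * (v x * mode (Function.update β i false) (Function.update n i m') x)) := by
        refine integral_congr_ae ?_
        filter_upwards [hmem.coeFn_toLp] with x hx
        rw [hx, mode_update, mode_update, ← Function.update_eq_self i n, mode_update_index, hβi,
          Function.update_eq_self]
        linear_combination (v x * ∏ j ∈ Finset.univ.erase i, trig (β j) (n j) (x j)) * hab (x i)
      have hm := fun n => continuous_mode (Function.update β i false) n
      rw [e, integral_add, integral_const_mul, integral_const_mul]
      · have h1 := hv (Function.update n i m)
        have h2 := hv (Function.update n i m')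
        rw [coef] at h1 h2
        rw [h1, h2]
        simp
      · exact (integrable_mul_continuous v (hm _)).const_mul a
      · exact (integrable_mul_continuous v (hm _)).const_mul b
    apply Lp.ext
    have hz' : hmem.toLp _ =ᵐ[volume.restrict (cube d)] (0 : L2 d) := by rw [hz]
    filter_upwards [hmem.coeFn_toLp, hz', Lp.coeFn_zero ℝ 2 (volume.restrict (cube d)),
      ae_restrict_mem measurableSet_cube] with x h1 h2 h3 hx
    rw [h1, h3] at h2
    have hxi := hx i trivial
    have : Real.sin (Real.pi * x i) ≠ 0 := (Real.sin_pos_of_pos_of_lt_pi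
      (mul_pos Real.pi_pos hxi.1) (by nlinarith [Real.pi_pos, hxi.2])).ne'
    rw [h3]
    exact (mul_eq_zero.1 h2).resolve_left this

/-- The trigonometric products of type `β` as a Hilbert basis. -/
def modeBasis (β : Fin d → Bool) : HilbertBasis {n : Fin d → ℕ // ModeIndex β n} ℝ (L2 d) :=
  HilbertBasis.mkOfOrthogonalEqBot (orthonormal_mode β) (by
    rw [Submodule.eq_bot_iff]
    intro v hv
    refine eq_zero_of_coef (β := β) fun n => ?_
    by_cases hn : ModeIndex β n
    · rw [coef_eq_inner, real_inner_comm]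
      exact (Submodule.mem_orthogonal _ _).1 hv _ (Submodule.subset_span ⟨⟨n, hn⟩, rfl⟩)
    · exact coef_eq_zero hn v)

lemma modeBasis_apply (β : Fin d → Bool) (n : {n : Fin d → ℕ // ModeIndex β n}) :
    modeBasis β n = cl (mode β n.1) := by
  rw [modeBasis, HilbertBasis.coe_mkOfOrthogonalEqBot]

/-- Parseval, with the sum extended to all multi-indices: the additional modes vanish identically.
Sums over different types `β` can thereby be compared term by term. -/
lemma hasSum_coef_mul_coef (β : Fin d → Bool) (v w : L2 d) :
    HasSum (fun n => coef β n v * coef β n w) (inner ℝ v w) := by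
  have := (modeBasis β).hasSum_inner_mul_inner v w
  rw [← hasSum_subtype_iff_of_support_subset (s := {n | ModeIndex β n})]
  · have e : (fun n : {n : Fin d → ℕ // ModeIndex β n} => coef β n.1 v * coef β n.1 w) =
        fun n => inner ℝ v (modeBasis β n) * inner ℝ (modeBasis β n) w := by
      funext n
      rw [modeBasis_apply, coef_eq_inner, coef_eq_inner, real_inner_comm w]
    rw [← e] at this
    exact this
  · intro n hn
    by_contra h
    exact hn (by simp [coef_eq_zero h])

lemma hasSum_coef_smul (β : Fin d → Bool) (v : L2 d) :
    HasSum (fun n => coef β n v • cl (mode β n)) v := by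
  have := (modeBasis β).hasSum_repr v
  rw [← hasSum_subtype_iff_of_support_subset (s := {n | ModeIndex β n})]
  · have e : (fun n : {n : Fin d → ℕ // ModeIndex β n} => coef β n.1 v • cl (mode β n.1)) =
        fun n => (modeBasis β).repr v n • modeBasis β n := by
      funext n
      rw [HilbertBasis.repr_apply_apply, modeBasis_apply, coef_eq_inner, real_inner_comm]
    rw [← e] at this
    exact this
  · intro n hn
    by_contra h
    exact hn (by simp [coef_eq_zero h])

lemma summable_coef_sq (β : Fin d → Bool) (v : L2 d) : Summable fun n => coef β n v ^ 2 := by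
  simpa only [sq] using (hasSum_coef_mul_coef β v v).summable

/-- Riesz–Fischer; the prescribed values must vanish at the indices of the zero modes. -/
lemma exists_coef_eq {β : Fin d → Bool} {a : (Fin d → ℕ) → ℝ} (ha : Summable fun n => a n ^ 2)
    (h0 : ∀ n, ¬ModeIndex β n → a n = 0) : ∃ v : L2 d, ∀ n, coef β n v = a n := by
  have hmem : Memℓp (fun n : {n : Fin d → ℕ // ModeIndex β n} => a n.1) 2 := by
    refine memℓp_gen ?_
    have := ha.comp_injective (i := fun n : {n : Fin d → ℕ // ModeIndex β n} => n.1)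
      Subtype.val_injective
    simpa [Function.comp_def] using this
  refine ⟨(modeBasis β).repr.symm ⟨_, hmem⟩, fun n => ?_⟩
  by_cases hn : ModeIndex β n
  · have := (modeBasis β).repr_apply_apply ((modeBasis β).repr.symm ⟨_, hmem⟩) ⟨n, hn⟩
    rw [LinearIsometryEquiv.apply_symm_apply, modeBasis_apply] at this
    rw [coef_eq_inner, real_inner_comm, ← this]
  · rw [coef_eq_zero hn, h0 n hn]

/-! ### Fourier coefficients of weak derivatives -/

/-- The product of the frequencies `π n_i` over the directions in `l`. -/
def freq (l : List (Fin d)) (n : Fin d → ℕ) : ℝ := (l.map fun i => Real.pi * n i).prod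

/-- Type `b` in the directions outside `l`, the opposite type in the directions of `l`. -/
def typ (b : Bool) (l : List (Fin d)) (i : Fin d) : Bool := if i ∈ l then !b else b

/-- Each differentiated direction exchanges sine and cosine and contributes its frequency and a
sign; the type being constant along `l`, the signs collect to a power. -/
lemma prodFn_iterate_deriv_trig {l : List (Fin d)} (hl : l.Nodup) (β : Fin d → Bool) {b : Bool}
    (hβ : ∀ i ∈ l, β i = b) (n : Fin d → ℕ) (x : Fin d → ℝ) :
    prodFn (fun i => deriv^[l.count i] (trig (β i) (n i))) x =
      dsgn b ^ l.length * freq l n * mode (fun i => if i ∈ l then !(β i) else β i) n x := by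
  have h1 : ∀ i, deriv^[l.count i] (trig (β i) (n i)) (x i) =
      (if i ∈ l then dsgn b * (Real.pi * n i) else 1) *
        trig (if i ∈ l then !(β i) else β i) (n i) (x i) := by
    intro i
    by_cases hi : i ∈ l
    · rw [List.count_eq_one_of_mem hl hi, Function.iterate_one, deriv_trig, if_pos hi, if_pos hi,
        hβ i hi]
    · rw [List.count_eq_zero_of_not_mem hi, if_neg hi, if_neg hi, one_mul]
      rfl
  have h2 : ∏ i, (if i ∈ l then dsgn b * (Real.pi * n i) else 1) =
      dsgn b ^ l.length * freq l n := by
    rw [freq, ← List.prod_replicate, ← List.map_const', ← List.prod_map_mul,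
      ← List.prod_toFinset _ hl, ← Finset.prod_filter]
    exact Finset.prod_congr (by ext; simp) fun i _ => rfl
  rw [prodFn, mode, prodFn, ← h2, ← Finset.prod_mul_distrib]
  exact Finset.prod_congr rfl fun i _ => h1 i

lemma dsgn_mul_self (b : Bool) : dsgn b * dsgn b = 1 := by cases b <;> simp [dsgn]

lemma neg_dsgn (b : Bool) : -dsgn (!b) = dsgn b := by cases b <;> simp [dsgn]

/-- Coefficients of a weak derivative: sines are admissible in the directions of differentiation
for any function, cosines for functions vanishing on the boundary. -/
lemma coef_wd {b : Bool} {l : List (Fin d)} (hl : l.Nodup) {v : L2 d} (h : HasWD l v)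
    (hb : b = true ∨ MemH10 v) (n : Fin d → ℕ) :
    coef (typ b l) n (WD l v) = dsgn b ^ l.length * freq l n * coef (fun _ => b) n v := by
  have key := h.isWeakDeriv.integral_prodFn (f := fun i => trig (typ b l i) (n i))
    (fun _ => contDiff_trig _ _) (fun i => by
      by_cases hi : i ∈ l
      · refine Or.inr (Or.inl ⟨List.count_eq_one_of_mem hl hi, ?_⟩)
        rcases hb with rfl | hv
        · left
          simp only [typ, if_pos hi]
          exact vanish_trig_false _
        · exact Or.inr (hv.zeroOnFaces i)
      · exact Or.inl (List.count_eq_zero_of_not_mem hi))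
  have ht : (fun i => if i ∈ l then !(typ b l i) else typ b l i) = fun _ => b := by
    funext i
    by_cases hi : i ∈ l <;> simp [typ, hi]
  simp only [prodFn_iterate_deriv_trig hl (typ b l) (b := !b) (fun i hi => by simp [typ, hi]),
    ht] at key
  have e : ∀ x, v x * (dsgn (!b) ^ l.length * freq l n * mode (fun _ => b) n x) =
      (dsgn (!b) ^ l.length * freq l n) * (v x * mode (fun _ => b) n x) := fun x => by ring
  simp only [e, integral_const_mul] at key
  change dsgn (!b) ^ l.length * freq l n * coef (fun _ => b) n v =
    (-1) ^ l.length * coef (typ b l) n (WD l v) at key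
  have h1 : ((-1 : ℝ) ^ l.length) * (-1) ^ l.length = 1 := by
    rw [← mul_pow]
    simp
  -- The sign `(-1)^|l|` from integration by parts turns the derivative signs of the opposite type
  -- into those of type `b`.
  have h2 : dsgn b ^ l.length = (-1) ^ l.length * dsgn (!b) ^ l.length := by
    rw [← mul_pow, ← neg_dsgn]
    ring
  rw [h2]
  linear_combination (-(1 : ℝ)) ^ l.length * (-key) - coef (typ b l) n (WD l v) * h1

lemma integral_pderivs_test_mul (l : List (Fin d)) {φ ψ : (Fin d → ℝ) → ℝ} (h : IsTest φ)
    (hψ : ContDiff ℝ ∞ ψ) : ∫ x in cube d, pderivs l φ x * ψ x =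
      (-1) ^ l.length * ∫ x in cube d, φ x * pderivs l.reverse ψ x := by
  induction l generalizing ψ with
  | nil => simp [pderivs]
  | cons i l ih =>
    have e : ∀ (l : List (Fin d)) (ψ : (Fin d → ℝ) → ℝ),
        pderivs l (pderiv i ψ) = pderivs (l ++ [i]) ψ := by
      intro l ψ
      induction l with
      | nil => rfl
      | cons j l ih => rw [pderivs, ih]; rfl
    rw [pderivs, integral_pderiv_test_mul i (h.pderivs l) hψ, ih (contDiff_pderiv i hψ), e,
      List.reverse_cons, List.length_cons, pow_succ]
    ring

/-- Compact support lets all derivatives move onto the mode without boundary terms, so both types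
`b` are allowed. -/
lemma coef_pderivs_test {l : List (Fin d)} (hl : l.Nodup) (b : Bool) {φ : (Fin d → ℝ) → ℝ}
    (h : IsTest φ) (n : Fin d → ℕ) : coef (fun _ => b) n (cl (pderivs l φ)) =
      (-1) ^ l.length * (dsgn b ^ l.length * freq l n * coef (typ b l) n (cl φ)) := by
  have hcl : ∀ {ψ : (Fin d → ℝ) → ℝ} (_ : Continuous ψ) (β : Fin d → Bool),
      coef β n (cl ψ) = ∫ x in cube d, ψ x * mode β n x := fun hψ β => by
    refine integral_congr_ae ?_
    filter_upwards [coeFn_cl hψ] with x hx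
    rw [hx]
  rw [hcl (h.pderivs l).continuous, hcl h.continuous,
    integral_pderivs_test_mul l h (contDiff_mode _ n), mode,
    pderivs_prodFn fun _ => contDiff_trig _ _]
  simp only [List.count_reverse]
  simp only [prodFn_iterate_deriv_trig hl (fun _ => b) (b := b) (fun _ _ => rfl)]
  rw [← integral_const_mul (dsgn b ^ l.length * freq l n)]
  congr 1
  refine integral_congr_ae (Eventually.of_forall fun x => ?_)
  change φ x * (dsgn b ^ l.length * freq l n * mode (typ b l) n x) = _
  ring

/-- Parseval is applied to both sides of the defining relation, in the basis of type `b` for `v` and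
in that of type `typ b l` for `g`; the terms agree one by one. This is the converse of `coef_wd`. -/
lemma isWeakDeriv_of_coef {l : List (Fin d)} (hl : l.Nodup) {b : Bool} {v g : L2 d}
    (h : ∀ n, coef (typ b l) n g = dsgn b ^ l.length * freq l n * coef (fun _ => b) n v) :
    IsWeakDeriv l v g := by
  rw [isWeakDeriv_iff]
  intro φ hφ
  refine (hasSum_coef_mul_coef (fun _ => b) v (cl (pderivs l φ))).unique ?_
  have e : (fun n => coef (fun _ => b) n v * coef (fun _ => b) n (cl (pderivs l φ))) =
      fun n => (-1) ^ l.length * (coef (typ b l) n g * coef (typ b l) n (cl φ)) := by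
    funext n
    rw [coef_pderivs_test hl b hφ, h]
    ring
  rw [e]
  exact (hasSum_coef_mul_coef (typ b l) g (cl φ)).mul_left ((-1) ^ l.length)

lemma hasWD_of_summable {l : List (Fin d)} (hl : l.Nodup) (b : Bool) {v : L2 d}
    (h : Summable fun n => (freq l n * coef (fun _ => b) n v) ^ 2) : HasWD l v := by
  obtain ⟨g, hg⟩ := exists_coef_eq (β := typ b l)
    (a := fun n => dsgn b ^ l.length * freq l n * coef (fun _ => b) n v) (by
      have e : (dsgn b ^ l.length) ^ 2 = 1 := by
        rw [← pow_mul, mul_comm, pow_mul, sq, dsgn_mul_self, one_pow]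
      refine h.congr fun n => ?_
      rw [mul_assoc, mul_pow _ (_ * _), e, one_mul]) (fun n hn => by
      simp only [ModeIndex, not_forall, not_not] at hn
      obtain ⟨i, hi, hni⟩ := hn
      -- The target mode is zero because of a sine of frequency zero in direction `i`. For `i ∈ l`
      -- the product of frequencies vanishes; otherwise this sine is already present in the mode of
      -- `v`.
      by_cases hil : i ∈ l
      · have : freq l n = 0 := List.prod_eq_zero (List.mem_map.2 ⟨i, hil, by simp [hni]⟩)
        simp [this]
      · have : coef (fun _ => b) n v = 0 := coef_eq_zero (fun hm => by
          simp only [typ, if_neg hil] at hi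
          exact hm i hi hni) v
        simp [this])
  exact (isWeakDeriv_of_coef hl hg).hasWD

/-- Parseval for the derivatives; the signs appear squared. All forms of the energy argument are
combinations of such sums. -/
lemma hasSum_inner_wd {b : Bool} {l : List (Fin d)} (hl : l.Nodup) {v w : L2 d} (hv : HasWD l v)
    (hw : HasWD l w) (hbv : b = true ∨ MemH10 v) (hbw : b = true ∨ MemH10 w) :
    HasSum (fun n => freq l n ^ 2 * (coef (fun _ => b) n v * coef (fun _ => b) n w))
      (inner ℝ (WD l v) (WD l w)) := by
  convert hasSum_coef_mul_coef (typ b l) (WD l v) (WD l w) using 2 with n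
  rw [coef_wd hl hv hbv, coef_wd hl hw hbw]
  have e : (dsgn b ^ l.length) * (dsgn b ^ l.length) = 1 := by
    rw [← mul_pow, dsgn_mul_self, one_pow]
  linear_combination (-(freq l n ^ 2 * (coef (fun _ => b) n v * coef (fun _ => b) n w))) * e

lemma summable_freq_coef {b : Bool} {l : List (Fin d)} (hl : l.Nodup) {v : L2 d} (hv : HasWD l v)
    (hb : b = true ∨ MemH10 v) : Summable fun n => (freq l n * coef (fun _ => b) n v) ^ 2 :=
  (hasSum_inner_wd hl hv hv hb hb).summable.congr fun n => by ring

/-! ### Second derivatives and the operators of the schemes in terms of coefficients -/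

lemma iterate_two_deriv_trig (b : Bool) (n : ℕ) :
    deriv^[2] (trig b n) = fun x => -(Real.pi * n) ^ 2 * trig b n x := by
  have hd : dsgn b * dsgn (!b) = -1 := by cases b <;> simp [dsgn]
  rw [Function.iterate_succ_apply, Function.iterate_one, deriv_trig]
  funext x
  rw [deriv_const_mul _ ((contDiff_trig _ _).differentiable (by simp) x), deriv_trig, Bool.not_not]
  linear_combination ((Real.pi * n) ^ 2 * trig b n x) * hd

lemma prodFn_iterate_two_deriv_trig {l l' : List (Fin d)} (hl : l.Nodup)
    (hc : ∀ i, l'.count i = 2 * l.count i) (b : Bool) (n : Fin d → ℕ) (x : Fin d → ℝ) :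
    prodFn (fun i => deriv^[l'.count i] (trig b (n i))) x =
      (-1) ^ l.length * freq l n ^ 2 * mode (fun _ => b) n x := by
  have h1 : ∀ i, deriv^[l'.count i] (trig b (n i)) (x i) =
      (if i ∈ l then -(Real.pi * n i) ^ 2 else 1) * trig b (n i) (x i) := by
    intro i
    by_cases hi : i ∈ l
    · rw [hc, List.count_eq_one_of_mem hl hi, mul_one, iterate_two_deriv_trig, if_pos hi]
    · rw [hc, List.count_eq_zero_of_not_mem hi, if_neg hi, one_mul]
      rfl
  have h2 : ∏ i, (if i ∈ l then -(Real.pi * n i) ^ 2 else 1) =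
      (-1) ^ l.length * freq l n ^ 2 := by
    rw [freq, ← List.prod_replicate, ← List.map_const', sq, ← List.prod_map_mul,
      ← List.prod_map_mul, ← List.prod_toFinset _ hl, ← Finset.prod_filter]
    exact Finset.prod_congr (by ext; simp) fun i _ => by ring
  rw [prodFn, mode, prodFn, ← h2, ← Finset.prod_mul_distrib]
  exact Finset.prod_congr rfl fun i _ => h1 i

lemma count_pair (i j : Fin d) : [i, i].count j = 2 * [i].count j := by
  simp only [List.count_cons, List.count_nil]
  split <;> simp

/-- Tested against sines, of the two boundary terms one vanishes with `v` and the other with the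
sine. Only the two faces orthogonal to `i` enter. -/
lemma ZeroOnFaces.coef_wd_pair {i : Fin d} {v : L2 d} (hv : ZeroOnFaces i v) (h : HasWD [i, i] v)
    (n : Fin d → ℕ) : coef (fun _ => false) n (WD [i, i] v) =
      -(Real.pi * n i) ^ 2 * coef (fun _ => false) n v := by
  have key := h.isWeakDeriv.integral_prodFn (f := fun i => trig false (n i))
    (fun _ => contDiff_trig _ _) (fun j => by
      rcases eq_or_ne j i with rfl | hj
      · exact Or.inr (Or.inr ⟨by simp, vanish_trig_false _, hv⟩)
      · exact Or.inl (by simp [hj.symm]))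
  simp only [prodFn_iterate_two_deriv_trig (List.nodup_singleton i) (count_pair i)] at key
  have e : ∀ x, v x * ((-1) ^ [i].length * freq [i] n ^ 2 * mode (fun _ => false) n x) =
      (-(Real.pi * n i) ^ 2) * (v x * mode (fun _ => false) n x) := fun x => by
    simp [freq]
    ring
  simp only [e, integral_const_mul] at key
  simpa [coef, mode] using key.symm

/-- Tested against cosines, the first integration by parts uses that `∂_i p` vanishes on the faces;
the second moves a derivative from `p` onto a function proportional to a sine in direction `i`, so
`p` itself needs no boundary condition. -/
lemma NeumannFactor.coef_eq {i : Fin d} {p q : L2 d} (h : NeumannFactor i p q) (n : Fin d → ℕ) :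
    coef (fun _ => true) n q = (1 + (Real.pi * n i) ^ 2) * coef (fun _ => true) n p := by
  obtain ⟨h1, h2, h3, rfl⟩ := h
  have e : WD [i] (WD [i] p) = WD [i, i] p := (h1.isWeakDeriv.tail h2.isWeakDeriv).wd_eq
  set f : Fin d → ℝ → ℝ := fun j => trig true (n j) with hf
  have hfs : ∀ j, ContDiff ℝ ∞ (f j) := fun _ => contDiff_trig _ _
  set g := Function.update f i (deriv (f i)) with hg
  have hgs : ∀ j, ContDiff ℝ ∞ (g j) := contDiff_update hfs i (contDiff_deriv (hfs i))
  have k1 : ∫ x in cube d, WD [i, i] p x * prodFn f x =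
      -∫ x in cube d, WD [i] p x * prodFn g x := by
    rw [← e, h3.integral_wd_mul (contDiff_prodFn hfs), pderiv_prodFn hfs]
  have k2 := h1.isWeakDeriv.integral_prodFn hgs (fun j => by
    rcases eq_or_ne j i with rfl | hj
    · refine Or.inr (Or.inl ⟨by simp, Or.inl ?_⟩)
      have hv := vanish_trig_false (n j)
      simp only [hg, Function.update_self, hf, deriv_trig, Bool.not_true]
      exact ⟨by simp only [hv.1, mul_zero], by simp only [hv.2, mul_zero]⟩
    · exact Or.inl (by simp [hj.symm]))
  have e2 : (fun j => deriv^[[i].count j] (g j)) = fun j => deriv^[[i, i].count j] (f j) := by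
    funext j
    rcases eq_or_ne j i with rfl | hj
    · simp [hg]
    · simp [hg, hj, hj.symm]
  rw [e2] at k2
  simp only [hf, prodFn_iterate_two_deriv_trig (List.nodup_singleton i) (count_pair i)] at k2
  have e3 : ∀ x, p x * ((-1) ^ [i].length * freq [i] n ^ 2 * mode (fun _ => true) n x) =
      (-(Real.pi * n i) ^ 2) * (p x * mode (fun _ => true) n x) := fun x => by
    simp [freq]
    ring
  simp only [e3, integral_const_mul] at k2
  have k3 : coef (fun _ => true) n (WD [i, i] p) =
      -(Real.pi * n i) ^ 2 * coef (fun _ => true) n p := by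
    change ∫ x in cube d, WD [i, i] p x * prodFn f x = _
    rw [k1, coef, k2]
    simp
  rw [coef_sub, k3]
  ring

lemma NeumannChain.coef_eq {l : List (Fin d)} {p g : L2 d} (h : NeumannChain l p g)
    (n : Fin d → ℕ) : coef (fun _ => true) n g =
      (l.map fun i => 1 + (Real.pi * n i) ^ 2).prod * coef (fun _ => true) n p := by
  induction l generalizing p with
  | nil =>
    rw [show g = p from h]
    simp
  | cons i l ih =>
    obtain ⟨q, h1, h2⟩ := h
    rw [ih h2, h1.coef_eq, List.map_cons, List.prod_cons]
    ring

lemma IsA.coef_eq {p g : L2 d} (h : IsA p g) (n : Fin d → ℕ) :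
    coef (fun _ => true) n g =
      (∏ i, (1 + (Real.pi * n i) ^ 2)) * coef (fun _ => true) n p := by
  rw [h.2.coef_eq, List.map_reverse, List.prod_reverse, ← Fin.prod_univ_def]

/-- The symbol of `-Δ` on the sine products. -/
def symL (n : Fin d → ℕ) : ℝ := ∑ i, freq [i] n ^ 2

/-- The symbol of `B` on the sine products. -/
def symB (τ : ℝ) (n : Fin d → ℕ) : ℝ :=
  ∑ i, ∑ j ∈ Finset.Ioi i, freq [i, j] n ^ 2
    + τ / 2 * ∑ i, ∑ j ∈ Finset.Ioi i, ∑ k ∈ Finset.Ioi j, freq [i, j, k] n ^ 2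

lemma count_double_two (i j m : Fin d) : [i, i, j, j].count m = 2 * [i, j].count m := by
  simp only [List.count_cons, List.count_nil]
  split_ifs <;> simp

lemma count_double_three (i j k m : Fin d) :
    [i, i, j, j, k, k].count m = 2 * [i, j, k].count m := by
  simp only [List.count_cons, List.count_nil]
  split_ifs <;> simp

lemma nodup_two {i j : Fin d} (h : j ∈ Finset.Ioi i) : [i, j].Nodup := by
  simp [(Finset.mem_Ioi.1 h).ne]

lemma nodup_three {i j k : Fin d} (h : j ∈ Finset.Ioi i) (h' : k ∈ Finset.Ioi j) :
    [i, j, k].Nodup := by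
  rw [Finset.mem_Ioi] at h h'
  simp [h.ne, h'.ne, (h.trans h').ne]

lemma removable_of_count {v : L2 d} {l l' : List (Fin d)} (hl : l.Nodup)
    (hc : ∀ i, l'.count i = 2 * l.count i) {i : Fin d} {g : ℝ → ℝ} (hg : Vanish g)
    (hv : ZeroOnFaces i v) : Removable v i (l'.count i) g := by
  by_cases hi : i ∈ l
  · exact Or.inr (Or.inr ⟨by rw [hc, List.count_eq_one_of_mem hl hi], hg, hv⟩)
  · exact Or.inl (by rw [hc, List.count_eq_zero_of_not_mem hi])

/-- Only the sum `B v`, not its single terms, is known to be a function, so the cut-offs are removed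
in the whole relation at once. Each term carries at most two derivatives per direction; since the
sines and `v` both vanish on the boundary, `tendsto_cutoff` covers them. -/
lemma IsB.coef_eq {τ : ℝ} {v g : L2 d} (h : IsB τ v g) (n : Fin d → ℕ) :
    coef (fun _ => false) n g = symB τ n * coef (fun _ => false) n v := by
  set I : List (Fin d) → (Fin d → ℝ → ℝ) → ℝ := fun l f =>
    ∫ x in cube d, v x * prodFn (fun m => deriv^[l.count m] (f m)) x with hI
  set L : (Fin d → ℝ → ℝ) → ℝ := fun f =>
    (∑ i, ∑ j ∈ Finset.Ioi i, I [i, i, j, j] f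
      - τ / 2 * ∑ i, ∑ j ∈ Finset.Ioi i, ∑ k ∈ Finset.Ioi j, I [i, i, j, j, k, k] f)
      - ∫ x in cube d, g x * prodFn f x with hL
  have key : L (fun i => trig false (n i)) = 0 := by
    refine eq_zero_of_cutoff (L := L) (C := fun _ => Vanish) ?_ ?_ _
      (fun _ => contDiff_trig _ _) (fun _ => vanish_trig_false _)
    · intro f hf hs
      have hφ := isTest_prodFn hf hs
      have hint : ∀ l, Integrable (fun x => v x * pderivs l (prodFn f) x)
          (volume.restrict (cube d)) := fun l =>
        integrable_mul_continuous v (hφ.pderivs l).continuous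
      have e := h.2 _ hφ
      simp only [classicalB, mul_sub, Finset.mul_sum, mul_left_comm _ (τ / 2)] at e
      rw [integral_sub, integral_finsetSum, integral_finsetSum] at e
      · rw [hL]
        simp only [hI, ← pderivs_prodFn hf]
        rw [← e, sub_eq_zero, Finset.mul_sum]
        congr 1
        · refine Finset.sum_congr rfl fun i _ => ?_
          rw [integral_finsetSum _ fun j _ => hint _]
        · refine Finset.sum_congr rfl fun i _ => ?_
          rw [Finset.mul_sum, integral_finsetSum]
          · refine Finset.sum_congr rfl fun j _ => ?_
            rw [Finset.mul_sum, integral_finsetSum _ fun k _ => (hint _).const_mul _]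
            simp only [integral_const_mul]
          · exact fun j _ => integrable_finsetSum _ fun k _ => (hint _).const_mul _
      · exact fun i _ => integrable_finsetSum _ fun j _ => integrable_finsetSum _ fun k _ =>
          (hint _).const_mul _
      · exact fun i _ => integrable_finsetSum _ fun j _ => hint _
      · exact integrable_finsetSum _ fun i _ => integrable_finsetSum _ fun j _ => hint _
      · exact integrable_finsetSum _ fun i _ => integrable_finsetSum _ fun j _ =>
          integrable_finsetSum _ fun k _ => (hint _).const_mul _
    · intro i f hf hi
      have hz := h.1.zeroOnFaces i
      refine ((tendsto_finsetSum _ fun a _ => tendsto_finsetSum _ fun b hb => ?_).sub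
        (Tendsto.const_mul _ (tendsto_finsetSum _ fun a _ => tendsto_finsetSum _ fun b hb =>
          tendsto_finsetSum _ fun c hc => ?_))).sub ?_
      · exact tendsto_cutoff (a := fun m => [a, a, b, b].count m) i f hf
          (removable_of_count (nodup_two hb) (count_double_two a b) hi hz)
      · exact tendsto_cutoff (a := fun m => [a, a, b, b, c, c].count m) i f hf
          (removable_of_count (nodup_three hb hc) (count_double_three a b c) hi hz)
      · exact tendsto_cutoff (a := fun _ => 0) i f hf (Or.inl rfl)
  have hterm : ∀ {l l' : List (Fin d)}, l.Nodup → (∀ i, l'.count i = 2 * l.count i) →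
      I l' (fun i => trig false (n i)) =
        (-1) ^ l.length * freq l n ^ 2 * coef (fun _ => false) n v := by
    intro l l' hl hc
    simp only [hI, prodFn_iterate_two_deriv_trig hl hc]
    rw [coef, ← integral_const_mul]
    refine integral_congr_ae (Eventually.of_forall fun x => ?_)
    change v x * ((-1) ^ l.length * freq l n ^ 2 * mode (fun _ => false) n x) =
      (-1) ^ l.length * freq l n ^ 2 * (v x * mode (fun _ => false) n x)
    ring
  have s2 : ∑ i, ∑ j ∈ Finset.Ioi i, I [i, i, j, j] (fun i => trig false (n i)) =
      (∑ i, ∑ j ∈ Finset.Ioi i, freq [i, j] n ^ 2) * coef (fun _ => false) n v := by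
    simp only [Finset.sum_mul]
    refine Finset.sum_congr rfl fun i _ => Finset.sum_congr rfl fun j hj => ?_
    rw [hterm (nodup_two hj) (count_double_two i j)]
    simp
  have s3 : ∑ i, ∑ j ∈ Finset.Ioi i, ∑ k ∈ Finset.Ioi j,
      I [i, i, j, j, k, k] (fun i => trig false (n i)) =
      -((∑ i, ∑ j ∈ Finset.Ioi i, ∑ k ∈ Finset.Ioi j, freq [i, j, k] n ^ 2) *
        coef (fun _ => false) n v) := by
    simp only [Finset.sum_mul, ← Finset.sum_neg_distrib]
    refine Finset.sum_congr rfl fun i _ => Finset.sum_congr rfl fun j hj =>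
      Finset.sum_congr rfl fun k hk => ?_
    rw [hterm (nodup_three hj hk) (count_double_three i j k)]
    simp
    ring
  have hg : ∫ x in cube d, g x * prodFn (fun i => trig false (n i)) x =
      coef (fun _ => false) n g := rfl
  simp only [hL] at key
  rw [s2, s3, hg] at key
  rw [symB]
  linarith

/-! ### `H¹₀` in terms of sine coefficients -/

lemma norm_cl_sq {f : (Fin d → ℝ) → ℝ} (hf : Continuous f) :
    ‖cl f‖ ^ 2 = ∫ x in cube d, f x ^ 2 := by
  rw [← real_inner_self_eq_norm_sq, inner_cl _ hf]
  refine integral_congr_ae ?_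
  filter_upwards [coeFn_cl hf] with x hx
  rw [hx, sq]

lemma tendsto_cl {ψ : ℕ → (Fin d → ℝ) → ℝ} {χ : (Fin d → ℝ) → ℝ} {C : ℝ}
    (hψ : ∀ n, Continuous (ψ n)) (hχ : Continuous χ) (hC : ∀ n, ∀ x ∈ cube d, ‖ψ n x‖ ≤ C)
    (hlim : ∀ x ∈ cube d, Tendsto (fun n => ψ n x) atTop (𝓝 (χ x))) :
    Tendsto (fun n => cl (ψ n)) atTop (𝓝 (cl χ)) := by
  obtain ⟨D, hD⟩ := exists_bound_on_cube hχ
  rw [tendsto_iff_norm_sub_tendsto_zero]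
  have e : ∀ n, ‖cl (ψ n) - cl χ‖ ^ 2 = ∫ x in cube d, (ψ n x - χ x) ^ 2 := by
    intro n
    have hsub : Continuous fun x => ψ n x - χ x := (hψ n).sub hχ
    rw [← norm_cl_sq hsub, sub_eq_add_neg, ← neg_one_smul ℝ (cl χ), ← cl_smul hχ,
      ← cl_add (hψ n) (hχ.const_mul _)]
    congr 3
    funext x
    ring
  have h0 : Tendsto (fun n => ∫ x in cube d, (ψ n x - χ x) ^ 2) atTop
      (𝓝 (∫ x in cube d, (0 : ℝ))) := by
    refine tendsto_integral_of_dominated_convergence (fun _ => (C + D) ^ 2)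
      (fun n => (((hψ n).sub hχ).pow 2).aestronglyMeasurable) (integrable_const _)
      (fun n => ?_) ?_
    · refine (ae_restrict_iff' measurableSet_cube).2 (Eventually.of_forall fun x hx => ?_)
      rw [norm_pow]
      gcongr
      exact (norm_sub_le _ _).trans (add_le_add (hC n x hx) (hD x hx))
    · refine (ae_restrict_iff' measurableSet_cube).2 (Eventually.of_forall fun x hx => ?_)
      simpa using ((hlim x hx).sub_const (χ x)).pow 2
  simp only [← e, integral_zero] at h0
  have := h0.sqrt
  simpa [Real.sqrt_sq] using this

lemma tendsto_cl_prodFn {f : ℕ → Fin d → ℝ → ℝ} {g : Fin d → ℝ → ℝ}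
    (hf : ∀ m i, Continuous (f m i)) (hg : ∀ i, Continuous (g i))
    (hC : ∀ i, ∃ C, ∀ m, ∀ x ∈ Set.Ioo (0 : ℝ) 1, ‖f m i x‖ ≤ C)
    (hlim : ∀ i, ∀ x ∈ Set.Ioo (0 : ℝ) 1, Tendsto (fun m => f m i x) atTop (𝓝 (g i x))) :
    Tendsto (fun m => cl (prodFn (f m))) atTop (𝓝 (cl (prodFn g))) := by
  choose C hC using hC
  refine tendsto_cl (C := ∏ i, C i) (fun m => continuous_prodFn (hf m)) (continuous_prodFn hg)
    (fun m x hx => ?_) fun x hx => ?_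
  · rw [prodFn, norm_prod]
    exact Finset.prod_le_prod (fun _ _ => norm_nonneg _) fun i _ => hC i m _ (hx i trivial)
  · exact tendsto_finsetProd _ fun i _ => hlim i _ (hx i trivial)

/-- The test functions together with their gradients, as a subspace. -/
def testGraph (d : ℕ) : Submodule ℝ (L2 d × (Fin d → L2 d)) where
  carrier := {p | ∃ φ, IsTest φ ∧ p = (cl φ, fun i => cl (pderiv i φ))}
  add_mem' := by
    rintro _ _ ⟨φ, hφ, rfl⟩ ⟨ψ, hψ, rfl⟩
    refine ⟨_, hφ.add hψ, ?_⟩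
    ext1
    · exact (cl_add hφ.continuous hψ.continuous).symm
    · funext i
      change cl (pderiv i φ) + cl (pderiv i ψ) = _
      simp only [pderiv_add i hφ.1 hψ.1]
      rw [cl_add (hφ.pderiv i).continuous (hψ.pderiv i).continuous]
  zero_mem' := by
    have h0 : IsTest (fun _ : Fin d → ℝ => (0 : ℝ)) :=
      ⟨contDiff_const, HasCompactSupport.zero, by simp [tsupport]⟩
    have hc : cl (fun _ : Fin d → ℝ => (0 : ℝ)) = 0 := by
      simpa using cl_smul (d := d) (ψ := fun _ => 0) continuous_const 0
    refine ⟨_, h0, ?_⟩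
    ext1
    · exact hc.symm
    · funext i
      have : pderiv i (fun _ : Fin d → ℝ => (0 : ℝ)) = fun _ => 0 := by
        funext x
        simp [pderiv]
      simp only [this, hc]
      rfl
  smul_mem' := by
    rintro c _ ⟨φ, hφ, rfl⟩
    refine ⟨_, hφ.const_mul c, ?_⟩
    ext1
    · exact (cl_smul hφ.continuous c).symm
    · funext i
      change c • cl (pderiv i φ) = _
      simp only [pderiv_const_mul i hφ.1 c]
      rw [cl_smul (hφ.pderiv i).continuous]

/-- The graph of the gradient gives one sequence that approximates the function and all its
derivatives simultaneously. -/
lemma memH10_of_mem_closure {v : L2 d} (hv : ∀ i, HasWD [i] v)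
    (h : (v, fun i => WD [i] v) ∈ closure (testGraph d : Set (L2 d × (Fin d → L2 d)))) :
    MemH10 v := by
  rw [MemH10, memClosureTest_iff]
  refine ⟨fun i _ => hv i, ?_⟩
  obtain ⟨p, hp, hlim⟩ := mem_closure_iff_seq_limit.1 h
  choose φ hφ hpφ using hp
  refine ⟨φ, hφ, ?_, fun i _ => ?_⟩
  · have := (continuous_fst.tendsto _).comp hlim
    simpa only [Function.comp_def, hpφ] using this
  · have := ((continuous_apply i).comp continuous_snd).tendsto _ |>.comp hlim
    simpa only [Function.comp_def, hpφ] using this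

/-- Cut-off sine products are test functions; their derivatives converge in `L²` because sines
vanish at the ends. -/
lemma sine_mem_closure (n : Fin d → ℕ) :
    (cl (mode (fun _ => false) n), fun i => cl (pderiv i (mode (fun _ => false) n))) ∈
      closure (testGraph d : Set (L2 d × (Fin d → L2 d))) := by
  rw [mem_closure_iff_seq_limit]
  set f : Fin d → ℝ → ℝ := fun i => trig false (n i) with hf
  have hfs : ∀ i, ContDiff ℝ ∞ (f i) := fun _ => contDiff_trig _ _
  set g : ℕ → Fin d → ℝ → ℝ := fun m i x => cut m x * f i x with hg
  have hgs : ∀ m i, ContDiff ℝ ∞ (g m i) := fun m i => contDiff_cut_mul (hfs i) m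
  refine ⟨fun m => (cl (prodFn (g m)), fun i => cl (pderiv i (prodFn (g m)))), fun m => ?_, ?_⟩
  · exact ⟨_, isTest_prodFn (hgs m) fun i => tsupport_mul_subset_left.trans (tsupport_cut m), rfl⟩
  · refine Tendsto.prodMk_nhds ?_ (tendsto_pi_nhds.2 fun i => ?_)
    · exact tendsto_cl_prodFn (fun m i => (hgs m i).continuous) (fun i => (hfs i).continuous)
        (fun i => exists_bound_cut_mul (hfs i).continuous) fun i x hx => tendsto_cut_mul _ hx
    · have e : pderiv i (mode (fun _ => false) n) = _ := pderiv_prodFn hfs i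
      simp only [e, fun m => pderiv_prodFn (hgs m)]
      refine tendsto_cl_prodFn
        (fun m => fun j => (contDiff_update (hgs m) i (contDiff_deriv (hgs m i)) j).continuous)
        (fun j => (contDiff_update hfs i (contDiff_deriv (hfs i)) j).continuous) (fun j => ?_)
        fun j x hx => ?_
      · rcases eq_or_ne j i with rfl | hj
        · simp only [Function.update_self]
          exact exists_bound_deriv_cut_mul (hfs j) (vanish_trig_false _)
        · simp only [Function.update_of_ne hj]
          exact exists_bound_cut_mul (hfs j).continuous
      · rcases eq_or_ne j i with rfl | hj
        · simp only [Function.update_self]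
          exact tendsto_deriv_cut_mul (hfs j) hx
        · simp only [Function.update_of_ne hj]
          exact tendsto_cut_mul _ hx

lemma pderiv_sine (i : Fin d) (n : Fin d → ℕ) :
    pderiv i (mode (fun _ => false) n) = fun x => freq [i] n * mode (typ false [i]) n x := by
  funext x
  have h := pderivs_prodFn (f := fun i => trig false (n i)) (fun _ => contDiff_trig _ _) [i]
  have h' := prodFn_iterate_deriv_trig (List.nodup_singleton i) (fun _ => false) (b := false)
    (fun _ _ => rfl) n x
  rw [← h] at h'
  simpa [dsgn, pderivs, typ, mode] using h'

/-- The sine expansion of `v` and the expansions of its derivatives converge together, so `v` with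
its gradient lies in the closed span of the sine products with theirs, which is contained in the
closure of the test functions. -/
lemma memH10_of_summable {v : L2 d}
    (h : ∀ i, Summable fun n => (freq [i] n * coef (fun _ => false) n v) ^ 2) : MemH10 v := by
  have hWD : ∀ i, HasWD [i] v := fun i => hasWD_of_summable (List.nodup_singleton i) false (h i)
  -- `coef_wd` is not available here, as it presupposes membership in `H¹₀`; uniqueness of weak
  -- derivatives is used instead.
  have hc : ∀ i n, coef (typ false [i]) n (WD [i] v) =
      freq [i] n * coef (fun _ => false) n v := by
    intro i n
    obtain ⟨g, hg⟩ := exists_coef_eq (β := typ false [i])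
      (a := fun n => freq [i] n * coef (fun _ => false) n v) (h i) (fun n hn => by
        simp only [ModeIndex, not_forall, not_not] at hn
        obtain ⟨j, hj, hnj⟩ := hn
        have hji : j ≠ i := by
          rintro rfl
          simp [typ] at hj
        rw [coef_eq_zero (fun hm => hm j rfl hnj), mul_zero])
    have := isWeakDeriv_of_coef (List.nodup_singleton i) (b := false) (v := v) (g := g)
      (fun n => by rw [hg]; simp [dsgn])
    rw [this.wd_eq, hg]
  refine memH10_of_mem_closure hWD ?_
  have hs : HasSum (fun n => coef (fun _ => false) n v •
      ((cl (mode (fun _ => false) n), fun i => cl (pderiv i (mode (fun _ => false) n))) :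
        L2 d × (Fin d → L2 d))) (v, fun i => WD [i] v) := by
    refine (hasSum_coef_smul (fun _ => false) v).prodMk (Pi.hasSum.2 fun i => ?_)
    convert hasSum_coef_smul (typ false [i]) (WD [i] v) using 2 with n
    change coef (fun _ => false) n v • cl (pderiv i (mode (fun _ => false) n)) = _
    rw [hc, pderiv_sine]
    rw [cl_smul (continuous_mode _ _), smul_smul, mul_comm]
  rw [← Submodule.topologicalClosure_coe]
  refine (Submodule.isClosed_topologicalClosure _).mem_of_tendsto hs
    (Eventually.of_forall fun s => ?_)
  refine Submodule.sum_mem _ fun n _ => Submodule.smul_mem _ _ ?_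
  rw [← SetLike.mem_coe, Submodule.topologicalClosure_coe]
  exact sine_mem_closure n

/-! ### The energy estimate in abstract form -/

/-- Symmetric positive semidefinite bilinear forms on velocities (`L²`, `H¹` and `B`) and pressures
(`A`), and the pairing of pressures with divergences of velocities. -/
structure Forms (V Y : Type*) [AddCommGroup V] [Module ℝ V] [AddCommGroup Y] [Module ℝ Y] where
  a0 : V →ₗ[ℝ] V →ₗ[ℝ] ℝ
  a1 : V →ₗ[ℝ] V →ₗ[ℝ] ℝ
  aB : V →ₗ[ℝ] V →ₗ[ℝ] ℝ
  aA : Y →ₗ[ℝ] Y →ₗ[ℝ] ℝ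
  dv : V →ₗ[ℝ] Y →ₗ[ℝ] ℝ
  symm0 : ∀ v w, a0 v w = a0 w v
  symm1 : ∀ v w, a1 v w = a1 w v
  symmB : ∀ v w, aB v w = aB w v
  symmA : ∀ p q, aA p q = aA q p
  nonneg0 : ∀ v, 0 ≤ a0 v v
  nonneg1 : ∀ v, 0 ≤ a1 v v
  nonnegB : ∀ v, 0 ≤ aB v v
  nonnegA : ∀ p, 0 ≤ aA p p
  dv_sq_le : ∀ v p, dv v p ^ 2 ≤ a0 v v * aA p p

/-- Young's inequality, starting from a Cauchy–Schwarz inequality in squared form. -/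
lemma two_mul_le_of_sq_le {x A B θ : ℝ} (hA : 0 ≤ A) (hB : 0 ≤ B) (hθ : 0 < θ)
    (h : x ^ 2 ≤ A * B) : 2 * x ≤ θ * A + B / θ := by
  have h1 : 0 ≤ θ * A + B / θ := by positivity
  refine abs_le_of_sq_le_sq' ?_ h1 |>.2
  have h2 : θ * A * (B / θ) = A * B := by field_simp
  nlinarith [sq_nonneg (θ * A - B / θ)]

section

variable {V Y : Type*} [AddCommGroup V] [Module ℝ V] [AddCommGroup Y] [Module ℝ Y]

lemma form_sq_le {a : V →ₗ[ℝ] V →ₗ[ℝ] ℝ} (hs : ∀ v w, a v w = a w v) (hp : ∀ v, 0 ≤ a v v)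
    (v w : V) : a v w ^ 2 ≤ a v v * a w w := by
  have h := discrim_le_zero (a := a w w) (b := 2 * a v w) (c := a v v) fun t => by
    have := hp (v + t • w)
    simp only [map_add, map_smul, LinearMap.add_apply, LinearMap.smul_apply, smul_eq_mul,
      hs w v] at this
    linarith
  rw [discrim] at h
  linarith

lemma form_add_le {a : V →ₗ[ℝ] V →ₗ[ℝ] ℝ} (hs : ∀ v w, a v w = a w v) (hp : ∀ v, 0 ≤ a v v)
    (v w : V) : a (v + w) (v + w) ≤ 2 * a v v + 2 * a w w := by
  have := hp (v - w)
  simp only [map_add, map_sub, LinearMap.add_apply, LinearMap.sub_apply, hs w v] at *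
  linarith

lemma form_sub_le {a : V →ₗ[ℝ] V →ₗ[ℝ] ℝ} (hs : ∀ v w, a v w = a w v) (hp : ∀ v, 0 ≤ a v v)
    (v w : V) : a (v - w) (v - w) ≤ 2 * a v v + 2 * a w w := by
  have := hp (v + w)
  simp only [map_add, map_sub, LinearMap.add_apply, LinearMap.sub_apply, hs w v] at *
  linarith

/-- The energy of an error. -/
def Forms.energy (F : Forms V Y) (τ : ℝ) (e : V) (E : Y) : ℝ :=
  F.a0 e e + τ / 2 * F.a1 e e + τ ^ 2 / 4 * F.aB e e + τ ^ 2 * F.aA E E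

/-- The dissipation in one step. -/
def Forms.dissip (F : Forms V Y) (τ : ℝ) (e e' : V) : ℝ :=
  τ / 2 * F.a1 (e' + e) (e' + e) + τ ^ 2 / 4 * F.aB (e' - e) (e' - e)

lemma Forms.energy_nonneg (F : Forms V Y) {τ : ℝ} (hτ : 0 < τ) (e : V) (E : Y) :
    0 ≤ F.energy τ e E := by
  have := F.nonneg0 e
  have := F.nonneg1 e
  have := F.nonnegB e
  have := F.nonnegA E
  unfold Forms.energy
  positivity

lemma Forms.dissip_nonneg (F : Forms V Y) {τ : ℝ} (hτ : 0 < τ) (e e' : V) :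
    0 ≤ F.dissip τ e e' := by
  have := F.nonneg1 (e' + e)
  have := F.nonnegB (e' - e)
  unfold Forms.dissip
  positivity

lemma Forms.energy_sub_le (F : Forms V Y) {τ : ℝ} (hτ : 0 < τ) (e e' : V) (E E' : Y) :
    F.energy τ (e' - e) (E' - E) ≤ 2 * F.energy τ e' E' + 2 * F.energy τ e E := by
  have h0 := form_sub_le F.symm0 F.nonneg0 e' e
  have h1 := mul_le_mul_of_nonneg_left (form_sub_le F.symm1 F.nonneg1 e' e)
    (by positivity : 0 ≤ τ / 2)
  have hB := mul_le_mul_of_nonneg_left (form_sub_le F.symmB F.nonnegB e' e)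
    (by positivity : 0 ≤ τ ^ 2 / 4)
  have hA := mul_le_mul_of_nonneg_left (form_sub_le F.symmA F.nonnegA E' E) (sq_nonneg τ)
  unfold Forms.energy
  linarith

/-- One time step, in the form tested with velocities. -/
def Forms.Step (F : Forms V Y) (τ : ℝ) (e e' : V) (q : Y) (ρ : V →ₗ[ℝ] ℝ) : Prop :=
  ∀ w, F.a0 (e' - e) w + τ / 2 * F.a1 (e' + e) w + τ ^ 2 / 4 * F.aB (e' - e) w =
    τ * F.dv w q + τ * ρ w

/-- The penalty equation, in the form tested with pressures. -/
def Forms.Penalty (F : Forms V Y) (τ : ℝ) (e : V) (φ : Y) : Prop :=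
  ∀ P, F.dv e P = τ * F.aA P φ

lemma Forms.Penalty.sub {F : Forms V Y} {τ : ℝ} {e e' : V} {φ φ' : Y} (h' : F.Penalty τ e' φ')
    (h : F.Penalty τ e φ) : F.Penalty τ (e' - e) (φ' - φ) := by
  intro P
  rw [map_sub, LinearMap.sub_apply, h' P, h P, map_sub]
  ring

/-- Test the penalty equation with `φ` itself, bound the divergence pairing by `dv_sq_le`, and
divide by `aA φ φ` if this is not zero. -/
lemma Forms.Penalty.sq_le {F : Forms V Y} {τ : ℝ} {e : V} {φ : Y} (h : F.Penalty τ e φ) :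
    τ ^ 2 * F.aA φ φ ≤ F.a0 e e := by
  have h1 := F.dv_sq_le e φ
  rw [h φ] at h1
  rcases (F.nonnegA φ).eq_or_lt with h0 | h0
  · rw [← h0, mul_zero]
    exact F.nonneg0 e
  · refine le_of_mul_le_mul_right ?_ h0
    linarith

/-- Test with `2 e'`. By the penalty equation and `E + δ - φ = E' + φ' - φ`, twice the pressure term
is `2 τ² aA (E' + φ' - φ) φ'`, which equals `τ² (‖E + δ‖_A² - ‖E'‖_A² - ‖φ‖_A² + ‖φ' - φ‖_A²)`. The
last term is absorbed by `‖e' - e‖²` from the time derivative. The contributions of `δ` and `ρ` are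
split by Young's inequality. -/
lemma Forms.Step.energy_le {F : Forms V Y} {τ θ r D : ℝ} {e e' : V} {E E' φ φ' δ : Y}
    {ρ : V →ₗ[ℝ] ℝ} (hτ : 0 < τ) (hθ : 0 < θ) (h : F.Step τ e e' (E + δ - φ) ρ)
    (hE : E' = E + δ - φ') (hp : F.Penalty τ e φ) (hp' : F.Penalty τ e' φ')
    (hδ : F.aA δ δ ≤ D) (hρ : ∀ w, ρ w ^ 2 ≤ r * F.a0 w w) (hr : 0 ≤ r) :
    F.energy τ e' E' + F.dissip τ e e' ≤
      F.energy τ e E + τ * (2 * θ * F.energy τ e' E' + (2 * D + r) / θ) := by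
  have h1 := h e'
  rw [hp'] at h1
  have h2 := (hp'.sub hp).sq_le
  have hφ := hp' δ
  -- The weight is `θ τ` because this term carries `τ²`, one power of which must remain in front of
  -- `‖E'‖_A²` inside the energy.
  have y1 := two_mul_le_of_sq_le (F.nonnegA E') (F.nonnegA δ) (show 0 < θ * τ by positivity)
    (form_sq_le F.symmA F.nonnegA E' δ)
  have y2 := two_mul_le_of_sq_le (F.nonneg0 e') (F.nonnegA δ) hθ (F.dv_sq_le e' δ)
  have y3 := two_mul_le_of_sq_le (x := ρ e') (F.nonneg0 e') hr hθ
    ((hρ e').trans_eq (mul_comm _ _))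
  have dA := F.nonnegA δ
  have hD : F.aA δ δ / θ ≤ D / θ := by gcongr
  have y1' : 2 * τ ^ 2 * F.aA E' δ ≤ τ * (θ * (τ ^ 2 * F.aA E' E')) + τ * (D / θ) := by
    have e1 : F.aA δ δ / (θ * τ) * τ ^ 2 = τ * (F.aA δ δ / θ) := by field_simp
    have := mul_le_mul_of_nonneg_right y1 (sq_nonneg τ)
    rw [add_mul, e1] at this
    have := mul_le_mul_of_nonneg_left hD hτ.le
    linarith
  have y2' := mul_le_mul_of_nonneg_left (y2.trans (add_le_add_right hD _)) hτ.le
  have y3' := mul_le_mul_of_nonneg_left y3 hτ.le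
  have hsplit : (2 * D + r) / θ = 2 * (D / θ) + r / θ := by ring
  have n1 : 0 ≤ τ * (θ * (τ / 2 * F.a1 e' e')) := by
    have := F.nonneg1 e'
    positivity
  have n2 : 0 ≤ τ * (θ * (τ ^ 2 / 4 * F.aB e' e')) := by
    have := F.nonnegB e'
    positivity
  have n3 : 0 ≤ τ * (θ * (τ ^ 2 * F.aA E' E')) := by
    have := F.nonnegA E'
    positivity
  have n4 : 0 ≤ τ ^ 2 * F.aA δ δ := by positivity
  have n5 : 0 ≤ τ ^ 2 * F.aA φ φ := by
    have := F.nonnegA φ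
    positivity
  -- With `E` eliminated, every pressure pairing is expressed through quantities controlled above.
  have hE' : E = E' - δ + φ' := by
    rw [hE]
    abel
  unfold Forms.energy Forms.dissip
  rw [hsplit, hE']
  rw [hE'] at h1
  simp only [map_add, map_sub, LinearMap.add_apply, LinearMap.sub_apply, F.symm0 e e',
    F.symm1 e e', F.symmB e e', F.symmA φ φ', F.symmA E' φ', F.symmA δ φ', F.symmA δ E'] at *
  nlinarith

/-! ### Stability over many steps -/

/-- The implicit term is absorbed at the index of the largest `a`, which replaces Gronwall's lemma.
As `κ T ≤ 1/4` involves the whole interval and not the step size, no smallness of `τ` is needed. -/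
lemma discrete_energy {N : ℕ} {a S : ℕ → ℝ} {τ T κ G : ℝ} (hτ : 0 ≤ τ) (hκ : 0 ≤ κ)
    (hN : N * τ ≤ T) (hκT : κ * T ≤ 1 / 4) (hG : 0 ≤ G) (ha : ∀ k, 0 ≤ a k) (hS : ∀ k, 0 ≤ S k)
    (h : ∀ k < N, a (k + 1) + S k ≤ a k + τ * (κ * a (k + 1) + G)) :
    ∀ k ≤ N, a k + ∑ j ∈ Finset.range k, S j ≤ 2 * (a 0 + T * G) := by
  obtain ⟨m, hm, hmax⟩ := Finset.exists_max_image (Finset.range (N + 1)) a ⟨0, by simp⟩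
  have hm' : m ≤ N := by simpa [Nat.lt_succ_iff] using hm
  have main : ∀ k ≤ N, a k + ∑ j ∈ Finset.range k, S j ≤ a 0 + k * τ * (κ * a m + G) := by
    intro k
    induction k with
    | zero => simp
    | succ k ih =>
      intro hk
      have h1 := ih (by omega)
      have h2 := h k (by omega)
      have h3 := mul_le_mul_of_nonneg_left (mul_le_mul_of_nonneg_left
        (hmax (k + 1) (by simp; omega)) hκ) hτ
      rw [Finset.sum_range_succ]
      push_cast
      nlinarith
  have bound : ∀ k ≤ N, a k + ∑ j ∈ Finset.range k, S j ≤ a 0 + (1 / 4 * a m + T * G) := by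
    intro k hk
    have hkN : (k : ℝ) * τ ≤ T :=
      (mul_le_mul_of_nonneg_right (Nat.cast_le.2 hk) hτ).trans hN
    have h1 : (k : ℝ) * τ * (κ * a m + G) ≤ T * (κ * a m + G) :=
      mul_le_mul_of_nonneg_right hkN (add_nonneg (mul_nonneg hκ (ha m)) hG)
    have h2 := mul_le_mul_of_nonneg_right hκT (ha m)
    nlinarith [main k hk]
  intro k hk
  have hsum : 0 ≤ ∑ j ∈ Finset.range m, S j := Finset.sum_nonneg fun j _ => hS j
  have h1 := bound m hm'
  have h2 := bound k hk
  have hT : 0 ≤ T := le_trans (by positivity) hN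
  have h3 : 0 ≤ T * G := mul_nonneg hT hG
  linarith [ha 0]

lemma Forms.energy_bound {F : Forms V Y} {τ T r D : ℝ} {N : ℕ} {e : ℕ → V} {E φ δ : ℕ → Y}
    {ρ : ℕ → V →ₗ[ℝ] ℝ} (hτ : 0 < τ) (hT : 0 < T) (hN : N * τ ≤ T)
    (h : ∀ k < N, F.Step τ (e k) (e (k + 1)) (E k + δ k - φ k) (ρ k))
    (hE : ∀ k < N, E (k + 1) = E k + δ k - φ (k + 1)) (hp : ∀ k ≤ N, F.Penalty τ (e k) (φ k))
    (hD : 0 ≤ D) (hδ : ∀ k < N, F.aA (δ k) (δ k) ≤ D) (hr : 0 ≤ r)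
    (hρ : ∀ k < N, ∀ w, ρ k w ^ 2 ≤ r * F.a0 w w) : ∀ k ≤ N,
    F.energy τ (e k) (E k) + ∑ j ∈ Finset.range k, F.dissip τ (e j) (e (j + 1)) ≤
      2 * (F.energy τ (e 0) (E 0) + 8 * T ^ 2 * (2 * D + r)) := by
  -- The Young parameter is `θ = 1 / (8 T)`, so that `κ = 2 θ` satisfies `κ T = 1/4`.
  have key := discrete_energy (N := N) (a := fun k => F.energy τ (e k) (E k))
    (S := fun k => F.dissip τ (e k) (e (k + 1))) (τ := τ) (T := T) (κ := 2 * (1 / (8 * T)))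
    (G := (2 * D + r) / (1 / (8 * T))) hτ.le (by positivity) hN
    (by field_simp; norm_num) (by positivity) (fun k => F.energy_nonneg hτ _ _)
    (fun k => F.dissip_nonneg hτ _ _) (fun k hk => (h k hk).energy_le hτ (by positivity) (hE k hk)
      (hp k hk.le) (hp (k + 1) hk) (hδ k hk) (hρ k hk) hr)
  intro k hk
  refine (key k hk).trans_eq ?_
  field_simp

/-- The data of an error recursion of first order. -/
structure Forms.Recursion (F : Forms V Y) (c₁ Cd Cr T τ : ℝ) (K : ℕ) (e : ℕ → V)
    (E φ δ : ℕ → Y) (ρ : ℕ → V →ₗ[ℝ] ℝ) (σ : V →ₗ[ℝ] ℝ) : Prop where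
  e_zero : e 0 = 0
  E_zero : E 0 = 0
  E_succ : ∀ k < K, E (k + 1) = E k + δ k - φ (k + 1)
  penalty : ∀ k < K, F.Penalty τ (e (k + 1)) (φ (k + 1))
  step : ∀ k, 0 < k → k < K → F.Step τ (e k) (e (k + 1)) (E k + δ k - φ k) (ρ k)
  step_zero : 0 < K → ∀ w, F.a0 (e 1) w + τ / 2 * F.a1 (e 1) w + τ ^ 2 / 4 * F.aB (e 1) w =
    τ * σ w + τ * ρ 0 w
  σ_sq_le : 0 < K → ∀ w, σ w ^ 2 ≤ (c₁ * τ) ^ 2 * F.a1 w w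
  δ_le : ∀ k < K, F.aA (δ k) (δ k) ≤ (Cd * τ) ^ 2
  δ_sub_le : ∀ k, 0 < k → k + 1 < K → F.aA (δ (k + 1) - δ k) (δ (k + 1) - δ k) ≤ (Cd * τ ^ 2) ^ 2
  ρ_sq_le : ∀ k < K, ∀ w, ρ k w ^ 2 ≤ (Cr * τ ^ 2) ^ 2 * F.a0 w w

/-! ### Orders of convergence from the error recursion -/

variable {F : Forms V Y} {c₁ Cd Cr T τ : ℝ} {K : ℕ} {e : ℕ → V} {E φ δ : ℕ → Y}
  {ρ : ℕ → V →ₗ[ℝ] ℝ} {σ : V →ₗ[ℝ] ℝ}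

/-- The predictor error `σ` is controlled by the `H¹` form, hence `τ σ (e 1)` costs half of the
viscous term and a remainder `(c₁ τ)² τ`. The pressure error is `δ 0 - φ 1` since `E 0 = 0`, and
`Forms.Penalty.sq_le` bounds `φ 1` by `e 1`. -/
lemma Forms.Recursion.energy_one (h : F.Recursion c₁ Cd Cr T τ K e E φ δ ρ σ) (hτ : 0 < τ)
    (hτT : τ ≤ T) (hK : 0 < K) :
    F.energy τ (e 1) (E 1) ≤ (6 * (c₁ ^ 2 + Cr ^ 2 * T ^ 3) + 2 * Cd ^ 2 * T) * τ ^ 3 := by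
  have h1 := h.step_zero hK (e 1)
  have y1 := two_mul_le_of_sq_le (θ := 1 / 2) (F.nonneg1 (e 1)) (sq_nonneg (c₁ * τ)) (by norm_num)
    ((h.σ_sq_le hK (e 1)).trans_eq (mul_comm _ _))
  have y2 := two_mul_le_of_sq_le (x := τ * ρ 0 (e 1)) (θ := 1 / 2) (B := (τ * (Cr * τ ^ 2)) ^ 2)
    (F.nonneg0 (e 1)) (sq_nonneg _) (by norm_num) (by
      have := mul_le_mul_of_nonneg_left (h.ρ_sq_le 0 hK (e 1)) (sq_nonneg τ)
      calc (τ * ρ 0 (e 1)) ^ 2 = τ ^ 2 * ρ 0 (e 1) ^ 2 := by ring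
        _ ≤ _ := this
        _ = _ := by ring)
  have hpen := (h.penalty 0 hK).sq_le
  have hE : E 1 = δ 0 - φ 1 := by rw [h.E_succ 0 hK, h.E_zero, zero_add]
  have hA := form_sub_le F.symmA F.nonnegA (δ 0) (φ 1)
  rw [← hE] at hA
  have hA' := mul_le_mul_of_nonneg_left hA (sq_nonneg τ)
  have hδ := mul_le_mul_of_nonneg_left (h.δ_le 0 hK) (sq_nonneg τ)
  have t6 : τ ^ 6 ≤ T ^ 3 * τ ^ 3 := by
    calc τ ^ 6 = τ ^ 3 * τ ^ 3 := by ring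
      _ ≤ T ^ 3 * τ ^ 3 := by gcongr
  have t4 : τ ^ 4 ≤ T * τ ^ 3 := by
    calc τ ^ 4 = τ * τ ^ 3 := by ring
      _ ≤ T * τ ^ 3 := by gcongr
  have y1' := mul_le_mul_of_nonneg_left y1 hτ.le
  have n0 := F.nonneg0 (e 1)
  have n1 := mul_nonneg hτ.le (F.nonneg1 (e 1))
  have nB := mul_nonneg (sq_nonneg τ) (F.nonnegB (e 1))
  have c6 := mul_le_mul_of_nonneg_left t6 (sq_nonneg Cr)
  have c4 := mul_le_mul_of_nonneg_left t4 (sq_nonneg Cd)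
  have key : F.a0 (e 1) (e 1) + τ / 2 * F.a1 (e 1) (e 1) + τ ^ 2 / 4 * F.aB (e 1) (e 1) ≤
      2 * (c₁ ^ 2 + Cr ^ 2 * T ^ 3) * τ ^ 3 := by
    norm_num at y1' y2
    nlinarith
  have key0 : F.a0 (e 1) (e 1) ≤ 2 * (c₁ ^ 2 + Cr ^ 2 * T ^ 3) * τ ^ 3 := by linarith
  simp only [zero_add] at hpen
  unfold Forms.energy
  nlinarith

/-- The recursion is started at index 1, where the penalty equation is available for the old
pressure increment too. The horizon `S` is independent of `T`, since short horizons give a higher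
order. -/
lemma Forms.Recursion.energy_le (h : F.Recursion c₁ Cd Cr T τ K e E φ δ ρ σ) (hτ : 0 < τ)
    {S : ℝ} (hS : 0 < S) (hτT : τ ≤ T) (k : ℕ) (hk : k < K) (hkS : k * τ ≤ S) :
    F.energy τ (e (k + 1)) (E (k + 1)) +
        ∑ j ∈ Finset.range k, F.dissip τ (e (j + 1)) (e (j + 2)) ≤
      2 * (F.energy τ (e 1) (E 1) + 8 * S ^ 2 * ((2 * Cd ^ 2 + Cr ^ 2 * T ^ 2) * τ ^ 2)) := by
  have key := Forms.energy_bound (F := F) (τ := τ) (T := S) (r := (Cr * τ ^ 2) ^ 2)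
    (D := (Cd * τ) ^ 2) (N := k) (e := fun j => e (j + 1)) (E := fun j => E (j + 1))
    (φ := fun j => φ (j + 1)) (δ := fun j => δ (j + 1)) (ρ := fun j => ρ (j + 1)) hτ hS hkS
    (fun j hj => h.step (j + 1) (by omega) (by omega)) (fun j hj => h.E_succ (j + 1) (by omega))
    (fun j hj => h.penalty j (by omega)) (sq_nonneg _) (fun j hj => h.δ_le (j + 1) (by omega))
    (sq_nonneg _) (fun j hj => h.ρ_sq_le (j + 1) (by omega)) k le_rfl
  refine key.trans ?_
  have t4 : (Cr * τ ^ 2) ^ 2 ≤ Cr ^ 2 * T ^ 2 * τ ^ 2 := by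
    calc (Cr * τ ^ 2) ^ 2 = Cr ^ 2 * τ ^ 2 * τ ^ 2 := by ring
      _ ≤ Cr ^ 2 * T ^ 2 * τ ^ 2 := by gcongr
  have := mul_le_mul_of_nonneg_left t4 (by positivity : 0 ≤ 8 * S ^ 2)
  nlinarith

/-- Differences of consecutive errors satisfy the same linear recursion with data `O(τ²)` and
initial energy `O(τ³)`. Their energy is thus `O(τ³)`, and dividing by the factor `τ / 2` in front of
the `H¹` form leaves `O(τ²)`. -/
lemma Forms.Recursion.a1_sub_le (h : F.Recursion c₁ Cd Cr T τ K e E φ δ ρ σ) (hτ : 0 < τ)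
    (hT : 0 < T) (hKT : K * τ ≤ T) {C : ℝ} (k : ℕ) (hk : k + 2 ≤ K)
    (h1 : F.energy τ (e 1) (E 1) ≤ C * τ ^ 3) (h2 : F.energy τ (e 2) (E 2) ≤ C * τ ^ 3) :
    F.a1 (e (k + 2) - e (k + 1)) (e (k + 2) - e (k + 1)) ≤
      4 * (4 * C + 8 * T ^ 2 * (2 * Cd ^ 2 + 4 * Cr ^ 2) * T) * τ ^ 2 := by
  have hkT : (k : ℝ) * τ ≤ T := by
    refine le_trans (mul_le_mul_of_nonneg_right ?_ hτ.le) hKT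
    exact_mod_cast (by omega : k ≤ K)
  have hτT : τ ≤ T := by
    refine le_trans ?_ hKT
    have : (1 : ℝ) ≤ K := by exact_mod_cast (by omega : 1 ≤ K)
    nlinarith
  -- The residuals need no cancellation in time: both are `O(τ²)` already, which explains the factor
  -- 2 in `r`. The pressure data do gain one order, through `δ_sub_le`.
  have key := Forms.energy_bound (F := F) (τ := τ) (T := T) (r := (2 * (Cr * τ ^ 2)) ^ 2)
    (D := (Cd * τ ^ 2) ^ 2) (N := k) (e := fun j => e (j + 2) - e (j + 1))
    (E := fun j => E (j + 2) - E (j + 1)) (φ := fun j => φ (j + 2) - φ (j + 1))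
    (δ := fun j => δ (j + 2) - δ (j + 1)) (ρ := fun j => ρ (j + 2) - ρ (j + 1)) hτ hT hkT
    (fun j hj w => by
      have s2 := h.step (j + 2) (by omega) (by omega) w
      have s1 := h.step (j + 1) (by omega) (by omega) w
      simp only [map_add, map_sub, LinearMap.add_apply, LinearMap.sub_apply] at *
      ring_nf at s1 s2 ⊢
      linarith)
    (fun j hj => by
      have s2 := h.E_succ (j + 2) (by omega)
      have s1 := h.E_succ (j + 1) (by omega)
      simp only [s2]
      nth_rewrite 3 [s1]
      abel)
    (fun j hj => (h.penalty (j + 1) (by omega)).sub (h.penalty j (by omega))) (sq_nonneg _)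
    (fun j hj => h.δ_sub_le (j + 1) (by omega) (by omega)) (sq_nonneg _)
    (fun j hj w => by
      have s2 := h.ρ_sq_le (j + 2) (by omega) w
      have s1 := h.ρ_sq_le (j + 1) (by omega) w
      rw [LinearMap.sub_apply]
      nlinarith [sq_nonneg (ρ (j + 2) w + ρ (j + 1) w)]) k le_rfl
  have hsum : 0 ≤ ∑ j ∈ Finset.range k, F.dissip τ (e (j + 2) - e (j + 1))
      (e (j + 1 + 2) - e (j + 1 + 1)) := Finset.sum_nonneg fun j _ => F.dissip_nonneg hτ _ _
  have h0 := F.energy_sub_le hτ (e 1) (e 2) (E 1) (E 2)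
  simp only [zero_add] at key
  set v := e (k + 2) - e (k + 1)
  have t4 : τ ^ 4 ≤ T * τ ^ 3 := by
    calc τ ^ 4 = τ * τ ^ 3 := by ring
      _ ≤ T * τ ^ 3 := by gcongr
  have t4' := mul_le_mul_of_nonneg_left t4
    (by positivity : 0 ≤ 8 * T ^ 2 * (2 * Cd ^ 2 + 4 * Cr ^ 2))
  have hle : τ / 2 * F.a1 v v ≤ F.energy τ v (E (k + 2) - E (k + 1)) := by
    have := F.nonneg0 v
    have := mul_nonneg (sq_nonneg τ) (F.nonnegB v)
    have := mul_nonneg (sq_nonneg τ) (F.nonnegA (E (k + 2) - E (k + 1)))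
    unfold Forms.energy
    linarith
  have h3 : τ / 2 * F.a1 v v ≤
      τ / 2 * (4 * (4 * C + 8 * T ^ 2 * (2 * Cd ^ 2 + 4 * Cr ^ 2) * T) * τ ^ 2) := by
    have e1 : τ / 2 * (4 * (4 * C + 8 * T ^ 2 * (2 * Cd ^ 2 + 4 * Cr ^ 2) * T) * τ ^ 2) =
        2 * (4 * (C * τ ^ 3) + 8 * T ^ 2 * (2 * Cd ^ 2 + 4 * Cr ^ 2) * (T * τ ^ 3)) := by ring
    have e2 : 8 * T ^ 2 * (2 * (Cd * τ ^ 2) ^ 2 + (2 * (Cr * τ ^ 2)) ^ 2) =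
        8 * T ^ 2 * (2 * Cd ^ 2 + 4 * Cr ^ 2) * τ ^ 4 := by ring
    rw [e1]
    rw [e2] at key
    linarith
  exact le_of_mul_le_mul_left h3 (by positivity)

lemma Forms.Recursion.energy_two (h : F.Recursion c₁ Cd Cr T τ K e E φ δ ρ σ) (hτ : 0 < τ)
    (hτT : τ ≤ T) (hK : 1 < K) {C : ℝ} (h1 : F.energy τ (e 1) (E 1) ≤ C * τ ^ 3) :
    F.energy τ (e 2) (E 2) ≤ 2 * (C + 8 * T * (2 * Cd ^ 2 + Cr ^ 2 * T ^ 2)) * τ ^ 3 := by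
  -- The horizon is `τ`, a single step: the data then contribute `O(τ⁴)` instead of `O(τ²)`.
  have key := h.energy_le hτ hτ hτT 1 hK (by simp)
  have hs : 0 ≤ ∑ j ∈ Finset.range 1, F.dissip τ (e (j + 1)) (e (j + 2)) :=
    Finset.sum_nonneg fun j _ => F.dissip_nonneg hτ _ _
  have t4 : τ ^ 4 ≤ T * τ ^ 3 := by
    calc τ ^ 4 = τ * τ ^ 3 := by ring
      _ ≤ T * τ ^ 3 := by gcongr
  have h3 := mul_le_mul_of_nonneg_left t4 (by positivity : 0 ≤ 2 * Cd ^ 2 + Cr ^ 2 * T ^ 2)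
  have e1 : 8 * τ ^ 2 * ((2 * Cd ^ 2 + Cr ^ 2 * T ^ 2) * τ ^ 2) =
      8 * ((2 * Cd ^ 2 + Cr ^ 2 * T ^ 2) * τ ^ 4) := by ring
  rw [e1] at key
  linarith

/-- Write `e'` as half the sum plus half the difference: the dissipation contains the sum, and the
hypothesis bounds the difference. -/
lemma Forms.a1_le_dissip (F : Forms V Y) {τ C : ℝ} (hτ : 0 < τ) {e e' : V}
    (h : F.a1 (e' - e) (e' - e) ≤ C * τ ^ 2) :
    τ * F.a1 e' e' ≤ F.dissip τ e e' + τ * (C / 2 * τ ^ 2) := by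
  have hs := form_add_le F.symm1 F.nonneg1 ((1 / 2 : ℝ) • (e' + e)) ((1 / 2 : ℝ) • (e' - e))
  have hv : (1 / 2 : ℝ) • (e' + e) + (1 / 2 : ℝ) • (e' - e) = e' := by module
  rw [hv] at hs
  simp only [map_smul, LinearMap.smul_apply, smul_eq_mul] at hs
  have nB := mul_nonneg (sq_nonneg τ) (F.nonnegB (e' - e))
  have hs' := mul_le_mul_of_nonneg_left hs hτ.le
  have hd' := mul_le_mul_of_nonneg_left h hτ.le
  unfold Forms.dissip
  linarith

/-- The first-order error bounds that follow from the recursion. -/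
def Forms.Bounds (F : Forms V Y) (C τ : ℝ) (K : ℕ) (e : ℕ → V) (E : ℕ → Y) : Prop :=
  (∀ k ≤ K, F.a0 (e k) (e k) ≤ C * τ ^ 2) ∧ (∀ k ≤ K, F.aB (e k) (e k) ≤ C) ∧
  (∀ k ≤ K, F.aA (E k) (E k) ≤ C) ∧
  ∑ k ∈ Finset.range K, F.aB (e (k + 1) - e k) (e (k + 1) - e k) ≤ C ∧
  τ * ∑ k ∈ Finset.range (K + 1), F.a1 (e k) (e k) ≤ C * τ ^ 2

lemma Forms.Recursion.exists_bounds (c₁ Cd Cr T : ℝ) (hT : 0 < T) : ∃ C : ℝ, 0 ≤ C ∧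
    ∀ {F : Forms V Y} {τ : ℝ} {K : ℕ} {e : ℕ → V} {E φ δ : ℕ → Y} {ρ : ℕ → V →ₗ[ℝ] ℝ}
      {σ : V →ₗ[ℝ] ℝ}, 0 < τ → K * τ ≤ T → F.Recursion c₁ Cd Cr T τ K e E φ δ ρ σ →
      F.Bounds C τ K e E := by
  -- `C₁ τ³` bounds the energy after the first step, `C₂ τ²` the later energies with the accumulated
  -- dissipation, `C₃ τ³` the energy after the second step, and `C₄ τ²` the squared `H¹` norm of the
  -- increments.
  set C₁ := 6 * (c₁ ^ 2 + Cr ^ 2 * T ^ 3) + 2 * Cd ^ 2 * T with hC₁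
  set H := 2 * Cd ^ 2 + Cr ^ 2 * T ^ 2 with hH
  set C₂ := 2 * (C₁ * T + 8 * T ^ 2 * H) with hC₂
  set C₃ := 2 * (C₁ + 8 * T * H) with hC₃
  set C₄ := 4 * (4 * C₃ + 8 * T ^ 2 * (2 * Cd ^ 2 + 4 * Cr ^ 2) * T) with hC₄
  have p1 : 0 ≤ C₁ := by positivity
  have pH : 0 ≤ H := by positivity
  have p2 : 0 ≤ C₂ := by positivity
  have p3 : 0 ≤ C₃ := by positivity
  have p4 : 0 ≤ C₄ := by positivity
  refine ⟨4 * (C₁ * T + C₂) + 2 * C₁ * T + T * C₄ + C₂, by positivity, ?_⟩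
  intro F τ K e E φ δ ρ σ hτ hKT h
  set C := 4 * (C₁ * T + C₂) + 2 * C₁ * T + T * C₄ + C₂ with hC
  have pC : 0 ≤ C := by positivity
  rcases Nat.eq_zero_or_pos K with rfl | hK
  · refine ⟨fun k hk => ?_, fun k hk => ?_, fun k hk => ?_, by simpa using pC, ?_⟩
    · rw [Nat.le_zero.1 hk, h.e_zero]
      simp only [map_zero]
      positivity
    · rw [Nat.le_zero.1 hk, h.e_zero]
      simpa using pC
    · rw [Nat.le_zero.1 hk, h.E_zero]
      simpa using pC
    · simp only [zero_add, Finset.range_one, Finset.sum_singleton, h.e_zero, map_zero, mul_zero]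
      positivity
  have hτT : τ ≤ T := by
    refine le_trans ?_ hKT
    have : (1 : ℝ) ≤ K := by exact_mod_cast hK
    nlinarith
  have t3 : τ ^ 3 ≤ T * τ ^ 2 := by
    calc τ ^ 3 = τ * τ ^ 2 := by ring
      _ ≤ T * τ ^ 2 := by gcongr
  have N1 := h.energy_one hτ hτT hK
  rw [← hC₁] at N1
  have Nk : ∀ k < K, F.energy τ (e (k + 1)) (E (k + 1)) +
      ∑ j ∈ Finset.range k, F.dissip τ (e (j + 1)) (e (j + 2)) ≤ C₂ * τ ^ 2 := by
    intro k hk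
    have hkT : (k : ℝ) * τ ≤ T := by
      refine le_trans (mul_le_mul_of_nonneg_right ?_ hτ.le) hKT
      exact_mod_cast hk.le
    refine (h.energy_le hτ hT hτT k hk hkT).trans ?_
    have := mul_le_mul_of_nonneg_left t3 p1
    rw [hC₂]
    linarith
  have hsum0 : ∀ k, 0 ≤ ∑ j ∈ Finset.range k, F.dissip τ (e (j + 1)) (e (j + 2)) := fun k =>
    Finset.sum_nonneg fun j _ => F.dissip_nonneg hτ _ _
  have parts : ∀ k < K, F.a0 (e (k + 1)) (e (k + 1)) ≤ C₂ * τ ^ 2 ∧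
      τ ^ 2 * F.aB (e (k + 1)) (e (k + 1)) ≤ τ ^ 2 * (4 * C₂) ∧
      τ ^ 2 * F.aA (E (k + 1)) (E (k + 1)) ≤ τ ^ 2 * C₂ := by
    intro k hk
    have h1 := Nk k hk
    have h2 := hsum0 k
    have n0 := F.nonneg0 (e (k + 1))
    have n1 := mul_nonneg hτ.le (F.nonneg1 (e (k + 1)))
    have nB := mul_nonneg (sq_nonneg τ) (F.nonnegB (e (k + 1)))
    have nA := mul_nonneg (sq_nonneg τ) (F.nonnegA (E (k + 1)))
    unfold Forms.energy at h1
    refine ⟨?_, ?_, ?_⟩ <;> linarith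
  have hτ2 : 0 < τ ^ 2 := by positivity
  have q1 : 0 ≤ C₁ * T := by positivity
  have q4 : 0 ≤ T * C₄ := by positivity
  have c2C : C₂ ≤ C := by rw [hC]; linarith
  have c24C : 4 * C₂ ≤ C := by rw [hC]; linarith
  refine ⟨fun k hk => ?_, fun k hk => ?_, fun k hk => ?_, ?_, ?_⟩
  · rcases k with _ | k
    · rw [h.e_zero]
      simp only [map_zero]
      positivity
    · exact (parts k hk).1.trans (by gcongr)
  · rcases k with _ | k
    · rw [h.e_zero]
      simpa using pC
    · exact (le_of_mul_le_mul_left (parts k hk).2.1 hτ2).trans c24C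
  · rcases k with _ | k
    · rw [h.E_zero]
      simpa using pC
    · exact (le_of_mul_le_mul_left (parts k hk).2.2 hτ2).trans c2C
  · obtain ⟨M, rfl⟩ : ∃ M, K = M + 1 := ⟨K - 1, by omega⟩
    rw [Finset.sum_range_succ', h.e_zero, zero_add, sub_zero]
    have hS : τ ^ 2 / 4 * ∑ k ∈ Finset.range M,
        F.aB (e (k + 1 + 1) - e (k + 1)) (e (k + 1 + 1) - e (k + 1)) ≤ C₂ * τ ^ 2 := by
      have h1 := Nk M (by omega)
      have h2 := F.energy_nonneg hτ (e (M + 1)) (E (M + 1))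
      refine le_trans ?_ (by linarith : ∑ j ∈ Finset.range M,
        F.dissip τ (e (j + 1)) (e (j + 2)) ≤ C₂ * τ ^ 2)
      rw [Finset.mul_sum]
      refine Finset.sum_le_sum fun j _ => ?_
      unfold Forms.dissip
      have := mul_nonneg hτ.le (F.nonneg1 (e (j + 2) + e (j + 1)))
      linarith
    have hB1 : τ ^ 2 / 4 * F.aB (e 1) (e 1) ≤ C₁ * T * τ ^ 2 := by
      have n0 := F.nonneg0 (e 1)
      have n1 := mul_nonneg hτ.le (F.nonneg1 (e 1))
      have nA := mul_nonneg (sq_nonneg τ) (F.nonnegA (E 1))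
      have := mul_le_mul_of_nonneg_left t3 p1
      unfold Forms.energy at N1
      linarith
    refine le_of_mul_le_mul_left (a := τ ^ 2 / 4) ?_ (by positivity)
    have := mul_nonneg hτ2.le p2
    have := mul_nonneg hτ2.le q1
    have := mul_nonneg hτ2.le q4
    rw [hC]
    linarith
  · obtain ⟨M, rfl⟩ : ∃ M, K = M + 1 := ⟨K - 1, by omega⟩
    rw [Finset.sum_range_succ', h.e_zero, Finset.sum_range_succ']
    simp only [map_zero, add_zero, zero_add]
    have ha1 : F.a1 (e 1) (e 1) ≤ 2 * C₁ * τ ^ 2 := by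
      refine le_of_mul_le_mul_left (a := τ / 2) ?_ (by positivity)
      have n0 := F.nonneg0 (e 1)
      have nB := mul_nonneg hτ2.le (F.nonnegB (e 1))
      have nA := mul_nonneg (sq_nonneg τ) (F.nonnegA (E 1))
      unfold Forms.energy at N1
      linarith
    have hterm : ∀ k ∈ Finset.range M, τ * F.a1 (e (k + 1 + 1)) (e (k + 1 + 1)) ≤
        F.dissip τ (e (k + 1)) (e (k + 2)) + τ * (C₄ / 2 * τ ^ 2) := by
      intro k hk
      have hkM : k < M := Finset.mem_range.1 hk
      have N2 : F.energy τ (e 2) (E 2) ≤ C₃ * τ ^ 3 := h.energy_two hτ hτT (by omega) N1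
      have N1' : F.energy τ (e 1) (E 1) ≤ C₃ * τ ^ 3 := by
        refine N1.trans ?_
        have : C₁ ≤ C₃ := by
          have : 0 ≤ T * H := by positivity
          rw [hC₃]
          linarith
        gcongr
      have hd := h.a1_sub_le hτ hT hKT k (by omega) N1' N2
      exact F.a1_le_dissip hτ hd
    have hS : ∑ j ∈ Finset.range M, F.dissip τ (e (j + 1)) (e (j + 2)) ≤ C₂ * τ ^ 2 := by
      have h1 := Nk M (by omega)
      have h2 := F.energy_nonneg hτ (e (M + 1)) (E (M + 1))
      linarith
    rw [mul_add, Finset.mul_sum]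
    have hall := Finset.sum_le_sum hterm
    rw [Finset.sum_add_distrib, Finset.sum_const, Finset.card_range, nsmul_eq_mul] at hall
    have hMT : (M : ℝ) * τ ≤ T := by
      push_cast at hKT
      linarith
    have h5 := mul_le_mul_of_nonneg_right hMT (by positivity : 0 ≤ C₄ / 2 * τ ^ 2)
    have h6 := mul_le_mul_of_nonneg_left ha1 hτ.le
    have h7 := mul_le_mul_of_nonneg_left t3 p1
    have := mul_nonneg hτ2.le p2
    have := mul_nonneg hτ2.le q1
    have := mul_nonneg hτ2.le q4
    rw [hC]
    linarith

end

/-! ### Differences of curves that are regular in time -/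

section

variable {E : Type*} [NormedAddCommGroup E] {T : ℝ} {ψ χ : ℝ → E}

lemma MemW1Infty.exists_bound (h : MemW1Infty T ψ) :
    ∃ C, 0 ≤ C ∧ ∀ x ∈ Set.Icc 0 T, ∀ y ∈ Set.Icc 0 T, ‖ψ y - ψ x‖ ≤ C * |y - x| := by
  obtain ⟨L, hL⟩ := h
  exact ⟨L, L.2, fun x hx y hy => by simpa [dist_eq_norm] using hL.dist_le_mul y hy x hx⟩

lemma MemW1Infty.add (h : MemW1Infty T ψ) (h' : MemW1Infty T χ) :
    MemW1Infty T (fun t => ψ t + χ t) := by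
  obtain ⟨L, hL⟩ := h
  obtain ⟨L', hL'⟩ := h'
  refine ⟨L + L', LipschitzOnWith.of_dist_le_mul fun x hx y hy => ?_⟩
  have h1 := hL.dist_le_mul x hx y hy
  have h2 := hL'.dist_le_mul x hx y hy
  push_cast
  rw [add_mul]
  exact (dist_add_add_le _ _ _ _).trans (add_le_add h1 h2)

lemma MemW1Infty.neg (h : MemW1Infty T ψ) : MemW1Infty T (fun t => -ψ t) := by
  obtain ⟨L, hL⟩ := h
  refine ⟨L, LipschitzOnWith.of_dist_le_mul fun x hx y hy => ?_⟩
  rw [dist_neg_neg]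
  exact hL.dist_le_mul x hx y hy

variable [NormedSpace ℝ E]

lemma MemW2Infty.add (h : MemW2Infty T ψ) (h' : MemW2Infty T χ) :
    MemW2Infty T (fun t => ψ t + χ t) := by
  obtain ⟨f, hf, hf'⟩ := h
  obtain ⟨g, hg, hg'⟩ := h'
  exact ⟨_, fun t ht => (hf t ht).add (hg t ht), hf'.add hg'⟩

lemma MemW2Infty.neg (h : MemW2Infty T ψ) : MemW2Infty T (fun t => -ψ t) := by
  obtain ⟨f, hf, hf'⟩ := h
  exact ⟨_, fun t ht => (hf t ht).neg, hf'.neg⟩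

lemma memW2Infty_sum {ι : Type*} (s : Finset ι) {ψ : ι → ℝ → E}
    (h : ∀ i ∈ s, MemW2Infty T (ψ i)) : MemW2Infty T (fun t => ∑ i ∈ s, ψ i t) := by
  classical
  induction s using Finset.induction_on with
  | empty =>
    simp only [Finset.sum_empty]
    exact ⟨fun _ => 0, fun t _ => hasDerivWithinAt_const _ _ _, 0, (LipschitzWith.const 0).lipschitzOnWith⟩
  | insert i s hi ih =>
    simp only [Finset.sum_insert hi]
    exact (h i (Finset.mem_insert_self i s)).add
      (ih fun j hj => h j (Finset.mem_insert_of_mem hj))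

lemma MemW2Infty.continuousOn (h : MemW2Infty T ψ) : ContinuousOn ψ (Set.Icc 0 T) := by
  obtain ⟨f, hf, -⟩ := h
  exact fun t ht => (hf t ht).continuousWithinAt

/-- Mean value inequality for `ψ` minus its linear part at `x`, whose derivative `ψ' t - ψ' x` is at
most a multiple of `|y - x|` between the two points. -/
lemma exists_taylor_bound {ψ' : ℝ → E}
    (hψ : ∀ t ∈ Set.Icc 0 T, HasDerivWithinAt ψ (ψ' t) (Set.Icc 0 T) t) (h : MemW1Infty T ψ') :
    ∃ C, 0 ≤ C ∧ ∀ x ∈ Set.Icc 0 T, ∀ y ∈ Set.Icc 0 T,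
      ‖ψ y - ψ x - (y - x) • ψ' x‖ ≤ C * (y - x) ^ 2 := by
  obtain ⟨C, hC0, hC⟩ := h.exists_bound
  refine ⟨C, hC0, fun x hx y hy => ?_⟩
  have hsub : Set.uIcc x y ⊆ Set.Icc 0 T := Set.uIcc_subset_Icc hx hy
  have hd : ∀ t ∈ Set.uIcc x y, HasDerivWithinAt (fun s => ψ s - s • ψ' x)
      (ψ' t - (1 : ℝ) • ψ' x) (Set.uIcc x y) t := fun t ht =>
    ((hψ t (hsub ht)).mono hsub).sub ((hasDerivWithinAt_id t _).smul_const _)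
  have hb : ∀ t ∈ Set.uIcc x y, ‖ψ' t - (1 : ℝ) • ψ' x‖ ≤ C * |y - x| := by
    intro t ht
    rw [one_smul]
    refine (hC x hx t (hsub ht)).trans (mul_le_mul_of_nonneg_left ?_ hC0)
    exact Set.abs_sub_left_of_mem_uIcc ht
  have := (convex_uIcc x y).norm_image_sub_le_of_norm_hasDerivWithin_le hd hb
    Set.left_mem_uIcc Set.right_mem_uIcc
  have e : ψ y - y • ψ' x - (ψ x - x • ψ' x) = ψ y - ψ x - (y - x) • ψ' x := by
    rw [sub_smul]
    abel
  rw [e, Real.norm_eq_abs, mul_assoc, ← abs_mul, ← sq, abs_of_nonneg (sq_nonneg _)] at this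
  exact this

lemma MemW2Infty.exists_lipschitz_bound (h : MemW2Infty T ψ) :
    ∃ C, 0 ≤ C ∧ ∀ x ∈ Set.Icc 0 T, ∀ y ∈ Set.Icc 0 T, ‖ψ y - ψ x‖ ≤ C * |y - x| := by
  obtain ⟨f, hf, L, hL⟩ := h
  obtain ⟨C, hC⟩ := isCompact_Icc.exists_bound_of_continuousOn hL.continuousOn
  refine ⟨|C|, abs_nonneg C, fun x hx y hy => ?_⟩
  exact (convex_Icc 0 T).norm_image_sub_le_of_norm_hasDerivWithin_le hf
    (fun t ht => (hC t ht).trans (le_abs_self C)) hx hy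

lemma MemW2Infty.exists_second_difference_bound (h : MemW2Infty T ψ) :
    ∃ C, 0 ≤ C ∧ ∀ m s, m - s ∈ Set.Icc 0 T → m ∈ Set.Icc 0 T → m + s ∈ Set.Icc 0 T →
      ‖ψ (m + s) + ψ (m - s) - (2 : ℝ) • ψ m‖ ≤ C * s ^ 2 := by
  obtain ⟨f, hf, hf'⟩ := h
  obtain ⟨C, hC0, hC⟩ := exists_taylor_bound hf hf'
  refine ⟨2 * C, by positivity, fun m s h1 h2 h3 => ?_⟩
  have k1 := hC m h2 _ h3
  have k2 := hC m h2 _ h1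
  have e : ψ (m + s) + ψ (m - s) - (2 : ℝ) • ψ m = (ψ (m + s) - ψ m - (m + s - m) • f m) +
      (ψ (m - s) - ψ m - (m - s - m) • f m) := by module
  rw [e]
  refine (norm_add_le _ _).trans ((add_le_add k1 k2).trans_eq ?_)
  ring

/-- As a function of `s`, the left side vanishes at zero and has as derivative the second difference
of `ψ'`, which is `O(s²)`; the mean value inequality supplies the third power. -/
lemma exists_midpoint_bound {ψ' : ℝ → E}
    (hψ : ∀ t ∈ Set.Icc 0 T, HasDerivWithinAt ψ (ψ' t) (Set.Icc 0 T) t) (h : MemW2Infty T ψ') :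
    ∃ C, 0 ≤ C ∧ ∀ m s, 0 ≤ s → m - s ∈ Set.Icc 0 T → m + s ∈ Set.Icc 0 T →
      ‖ψ (m + s) - ψ (m - s) - (2 * s) • ψ' m‖ ≤ C * s ^ 3 := by
  obtain ⟨C, hC0, hC⟩ := h.exists_second_difference_bound
  refine ⟨C, hC0, fun m s hs h1 h2 => ?_⟩
  have hp : Set.MapsTo (fun r : ℝ => m + r) (Set.Icc 0 s) (Set.Icc 0 T) := fun r hr =>
    ⟨by linarith [hr.1, hr.2, h1.1], by linarith [hr.1, hr.2, h2.2]⟩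
  have hm : Set.MapsTo (fun r : ℝ => m - r) (Set.Icc 0 s) (Set.Icc 0 T) := fun r hr =>
    ⟨by linarith [hr.1, hr.2, h1.1], by linarith [hr.1, hr.2, h2.2]⟩
  have hd : ∀ r ∈ Set.Icc 0 s, HasDerivWithinAt
      (fun r => ψ (m + r) - ψ (m - r) - (2 * r) • ψ' m)
      ((1 : ℝ) • ψ' (m + r) - (-1 : ℝ) • ψ' (m - r) - (2 * 1 : ℝ) • ψ' m) (Set.Icc 0 s) r := by
    intro r hr
    have d1 : HasDerivWithinAt (fun r : ℝ => m + r) 1 (Set.Icc 0 s) r :=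
      (hasDerivWithinAt_id r _).const_add m
    have d2 : HasDerivWithinAt (fun r : ℝ => m - r) (-1) (Set.Icc 0 s) r :=
      (hasDerivWithinAt_id r _).const_sub m
    have d3 : HasDerivWithinAt (fun r : ℝ => 2 * r) (2 * 1) (Set.Icc 0 s) r :=
      (hasDerivWithinAt_id r _).const_mul 2
    exact ((HasDerivWithinAt.scomp r (hψ _ (hp hr)) d1 hp).sub
      (HasDerivWithinAt.scomp r (hψ _ (hm hr)) d2 hm)).sub (d3.smul_const _)
  have hb : ∀ r ∈ Set.Icc 0 s,
      ‖(1 : ℝ) • ψ' (m + r) - (-1 : ℝ) • ψ' (m - r) - (2 * 1 : ℝ) • ψ' m‖ ≤ C * s ^ 2 := by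
    intro r hr
    have e : (1 : ℝ) • ψ' (m + r) - (-1 : ℝ) • ψ' (m - r) - (2 * 1 : ℝ) • ψ' m =
        ψ' (m + r) + ψ' (m - r) - (2 : ℝ) • ψ' m := by module
    rw [e]
    refine (hC m r (hm hr) ?_ (hp hr)).trans ?_
    · exact ⟨by linarith [h1.1], by linarith [h2.2]⟩
    · have := hr.1
      have := hr.2
      gcongr
  have := (convex_Icc 0 s).norm_image_sub_le_of_norm_hasDerivWithin_le hd hb
    (Set.left_mem_Icc.2 hs) (Set.right_mem_Icc.2 hs)
  simp only [add_zero, sub_zero, mul_zero, zero_smul, sub_self, Real.norm_eq_abs,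
    abs_of_nonneg hs] at this
  refine this.trans_eq ?_
  ring

end

/-! ### The spaces of velocities and pressures -/

lemma YIndex.nodup {l : List (Fin d)} (h : YIndex l) : l.Nodup :=
  h.2.imp fun hab => hab.ne

lemma yIndex_nil : YIndex ([] : List (Fin d)) := ⟨by simp, List.Pairwise.nil⟩

lemma yIndex_one (i : Fin d) : YIndex [i] := ⟨by simp, by simp⟩

lemma yIndex_two {i j : Fin d} (h : j ∈ Finset.Ioi i) : YIndex [i, j] :=
  ⟨by simp, by simpa using h⟩

lemma yIndex_three {i j k : Fin d} (h : j ∈ Finset.Ioi i) (h' : k ∈ Finset.Ioi j) :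
    YIndex [i, j, k] := by
  rw [Finset.mem_Ioi] at h h'
  exact ⟨by simp, by simp [h, h', h.trans h']⟩

/-- Membership in the velocity space, for one component. -/
def MemZ1 (v : L2 d) : Prop := MemH10 v ∧ ∀ l, YIndex l → HasWD l v

/-- The velocity space as a submodule. -/
def Zsub (d : ℕ) : Submodule ℝ (VF d) where
  carrier := {v | MemZ v}
  add_mem' hv hw m := ⟨(hv m).1.add (hw m).1, fun l hl => ((hv m).2 l hl).add ((hw m).2 l hl)⟩
  zero_mem' _ := ⟨memClosureTest_zero _, fun l _ => (isWeakDeriv_zero l).hasWD⟩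
  smul_mem' c _ hv m := ⟨(hv m).1.smul c, fun l hl => ((hv m).2 l hl).smul c⟩

/-- The pressure space as a submodule. -/
def Ysub (d : ℕ) : Submodule ℝ (L2 d) where
  carrier := {q | MemY q}
  add_mem' {p q} hp hq := by
    refine ⟨?_, fun l hl => (hp.2 l hl).add (hq.2 l hl)⟩
    rw [ZeroMean, integral_congr_ae (Lp.coeFn_add p q)]
    simp only [Pi.add_apply]
    rw [integral_add (integrable_coe p) (integrable_coe q), hp.1, hq.1, add_zero]
  zero_mem' := by
    refine ⟨?_, fun l _ => (isWeakDeriv_zero l).hasWD⟩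
    rw [ZeroMean, integral_congr_ae (Lp.coeFn_zero ℝ 2 (volume.restrict (cube d)))]
    simp
  smul_mem' c q hq := by
    refine ⟨?_, fun l hl => (hq.2 l hl).smul c⟩
    rw [ZeroMean, integral_congr_ae (Lp.coeFn_smul c q)]
    simp only [Pi.smul_apply, smul_eq_mul]
    rw [integral_const_mul, hq.1, mul_zero]

open Classical in
/-- The weak derivative as a linear map on the velocity space. -/
def wdZ (l : List (Fin d)) (m : Fin d) : Zsub d →ₗ[ℝ] L2 d :=
  if h : YIndex l then
    { toFun := fun v => WD l (v.1 m)
      map_add' := fun v w => wd_add ((v.2 m).2 l h) ((w.2 m).2 l h)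
      map_smul' := fun c v => wd_smul ((v.2 m).2 l h) c }
  else 0

lemma wdZ_apply {l : List (Fin d)} (h : YIndex l) (m : Fin d) (v : Zsub d) :
    wdZ l m v = WD l (v.1 m) := by
  rw [wdZ, dif_pos h]
  rfl

open Classical in
/-- The weak derivative as a linear map on the pressure space. -/
def wdY (l : List (Fin d)) : Ysub d →ₗ[ℝ] L2 d :=
  if h : YIndex l then
    { toFun := fun q => WD l q.1
      map_add' := fun p q => wd_add (p.2.2 l h) (q.2.2 l h)
      map_smul' := fun c q => wd_smul (q.2.2 l h) c }
  else 0

lemma wdY_apply {l : List (Fin d)} (h : YIndex l) (q : Ysub d) : wdY l q = WD l q.1 := by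
  rw [wdY, dif_pos h]
  rfl

/-! ### The bilinear forms -/

/-- The `L²` product of the images under two linear maps. -/
def pair {V W : Type*} [AddCommGroup V] [Module ℝ V] [AddCommGroup W] [Module ℝ W]
    (D : V →ₗ[ℝ] L2 d) (D' : W →ₗ[ℝ] L2 d) : V →ₗ[ℝ] W →ₗ[ℝ] ℝ :=
  (innerₗ (L2 d)).compl₁₂ D D'

@[simp] lemma pair_apply {V W : Type*} [AddCommGroup V] [Module ℝ V] [AddCommGroup W] [Module ℝ W]
    (D : V →ₗ[ℝ] L2 d) (D' : W →ₗ[ℝ] L2 d) (v : V) (w : W) :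
    pair D D' v w = inner ℝ (D v) (D' w) := rfl

/-- The `L²` form on velocities. -/
def form0 (d : ℕ) : Zsub d →ₗ[ℝ] Zsub d →ₗ[ℝ] ℝ := ∑ m, pair (wdZ [] m) (wdZ [] m)

/-- The `H¹` form on velocities. -/
def form1 (d : ℕ) : Zsub d →ₗ[ℝ] Zsub d →ₗ[ℝ] ℝ := ∑ m, ∑ i, pair (wdZ [i] m) (wdZ [i] m)

/-- The form of `B` on velocities. -/
def formB (d : ℕ) (τ : ℝ) : Zsub d →ₗ[ℝ] Zsub d →ₗ[ℝ] ℝ :=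
  ∑ m, (∑ i, ∑ j ∈ Finset.Ioi i, pair (wdZ [i, j] m) (wdZ [i, j] m)
    + (τ / 2) • ∑ i, ∑ j ∈ Finset.Ioi i, ∑ k ∈ Finset.Ioi j,
      pair (wdZ [i, j, k] m) (wdZ [i, j, k] m))

/-- The form of `A` on pressures. -/
def formA (d : ℕ) : Ysub d →ₗ[ℝ] Ysub d →ₗ[ℝ] ℝ :=
  pair (wdY []) (wdY []) + ∑ i, pair (wdY [i]) (wdY [i])
    + ∑ i, ∑ j ∈ Finset.Ioi i, pair (wdY [i, j]) (wdY [i, j])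
    + ∑ i, ∑ j ∈ Finset.Ioi i, ∑ k ∈ Finset.Ioi j, pair (wdY [i, j, k]) (wdY [i, j, k])

/-- The pairing of the divergence with pressures. -/
def formDiv (d : ℕ) : Zsub d →ₗ[ℝ] Ysub d →ₗ[ℝ] ℝ := ∑ m, pair (wdZ [m] m) (wdY [])

lemma form0_apply (v w : Zsub d) : form0 d v w = ∑ m, inner ℝ (v.1 m) (w.1 m) := by
  simp [form0, wdZ_apply yIndex_nil]

lemma form1_apply (v w : Zsub d) :
    form1 d v w = ∑ m, ∑ i, inner ℝ (WD [i] (v.1 m)) (WD [i] (w.1 m)) := by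
  simp [form1, wdZ_apply (yIndex_one _)]

/-- The form of `B` for one component. -/
def innerB (τ : ℝ) (v w : L2 d) : ℝ :=
  ∑ i, ∑ j ∈ Finset.Ioi i, inner ℝ (WD [i, j] v) (WD [i, j] w)
    + τ / 2 * ∑ i, ∑ j ∈ Finset.Ioi i, ∑ k ∈ Finset.Ioi j,
      inner ℝ (WD [i, j, k] v) (WD [i, j, k] w)

lemma formB_apply (τ : ℝ) (v w : Zsub d) :
    formB d τ v w = ∑ m, innerB τ (v.1 m) (w.1 m) := by
  simp only [formB, LinearMap.sum_apply, LinearMap.add_apply, LinearMap.smul_apply, pair_apply,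
    smul_eq_mul, innerB]
  refine Finset.sum_congr rfl fun m _ => ?_
  congr 1
  · refine Finset.sum_congr rfl fun i _ => Finset.sum_congr rfl fun j hj => ?_
    rw [wdZ_apply (yIndex_two hj), wdZ_apply (yIndex_two hj)]
  · congr 1
    refine Finset.sum_congr rfl fun i _ => Finset.sum_congr rfl fun j hj =>
      Finset.sum_congr rfl fun k hk => ?_
    rw [wdZ_apply (yIndex_three hj hk), wdZ_apply (yIndex_three hj hk)]

lemma formA_apply (p q : Ysub d) : formA d p q =
    inner ℝ p.1 q.1 + ∑ i, inner ℝ (WD [i] p.1) (WD [i] q.1)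
    + ∑ i, ∑ j ∈ Finset.Ioi i, inner ℝ (WD [i, j] p.1) (WD [i, j] q.1)
    + ∑ i, ∑ j ∈ Finset.Ioi i, ∑ k ∈ Finset.Ioi j,
      inner ℝ (WD [i, j, k] p.1) (WD [i, j, k] q.1) := by
  simp only [formA, LinearMap.sum_apply, LinearMap.add_apply, pair_apply, wdY_apply yIndex_nil,
    wdY_apply (yIndex_one _), wd_nil]
  congr 1
  · congr 1
    refine Finset.sum_congr rfl fun i _ => Finset.sum_congr rfl fun j hj => ?_
    rw [wdY_apply (yIndex_two hj), wdY_apply (yIndex_two hj)]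
  · refine Finset.sum_congr rfl fun i _ => Finset.sum_congr rfl fun j hj =>
      Finset.sum_congr rfl fun k hk => ?_
    rw [wdY_apply (yIndex_three hj hk), wdY_apply (yIndex_three hj hk)]

lemma formDiv_apply (v : Zsub d) (p : Ysub d) :
    formDiv d v p = ∑ m, inner ℝ (WD [m] (v.1 m)) p.1 := by
  simp [formDiv, wdZ_apply (yIndex_one _), wdY_apply yIndex_nil]

lemma normL2_sq (v : Zsub d) : normL2 v.1 ^ 2 = form0 d v v := by
  rw [normL2, Real.sq_sqrt (by positivity), form0_apply]
  simp only [real_inner_self_eq_norm_sq]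

lemma normH1_sq (v : Zsub d) : normH1 v.1 ^ 2 = form1 d v v := by
  rw [normH1, Real.sq_sqrt (by positivity), form1_apply]
  simp only [real_inner_self_eq_norm_sq]

lemma normB_sq {τ : ℝ} (hτ : 0 ≤ τ) (v : Zsub d) : normB τ v.1 ^ 2 = formB d τ v v := by
  rw [normB, Real.sq_sqrt (by positivity), formB_apply]
  simp only [innerB, real_inner_self_eq_norm_sq]

lemma normA_sq (q : Ysub d) : normA q.1 ^ 2 = formA d q q := by
  rw [normA, Real.sq_sqrt (by positivity), formA_apply]
  simp only [real_inner_self_eq_norm_sq]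

lemma sum_inner_sq_le {ι : Type*} (s : Finset ι) (v w : ι → L2 d) :
    (∑ m ∈ s, inner ℝ (v m) (w m)) ^ 2 ≤ (∑ m ∈ s, ‖v m‖ ^ 2) * ∑ m ∈ s, ‖w m‖ ^ 2 := by
  have h : |∑ m ∈ s, inner ℝ (v m) (w m)| ≤ ∑ m ∈ s, ‖v m‖ * ‖w m‖ :=
    (Finset.abs_sum_le_sum_abs _ _).trans
      (Finset.sum_le_sum fun m _ => abs_real_inner_le_norm _ _)
  rw [← sq_abs]
  exact (pow_le_pow_left₀ (abs_nonneg _) h 2).trans (Finset.sum_mul_sq_le_sq_mul_sq s _ _)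

lemma sum_norm_wd_sq_le (p : Ysub d) : ∑ m, ‖WD [m] p.1‖ ^ 2 ≤ formA d p p := by
  rw [formA_apply]
  simp only [real_inner_self_eq_norm_sq]
  have h1 : 0 ≤ ∑ i, ∑ j ∈ Finset.Ioi i, ‖WD [i, j] p.1‖ ^ 2 :=
    Finset.sum_nonneg fun i _ => Finset.sum_nonneg fun j _ => sq_nonneg _
  have h2 : 0 ≤ ∑ i, ∑ j ∈ Finset.Ioi i, ∑ k ∈ Finset.Ioi j, ‖WD [i, j, k] p.1‖ ^ 2 :=
    Finset.sum_nonneg fun i _ => Finset.sum_nonneg fun j _ => Finset.sum_nonneg fun k _ =>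
      sq_nonneg _
  linarith [sq_nonneg ‖p.1‖]

/-- Since `v` vanishes on the boundary, the divergence moves to a gradient on `p`, and the norm of
`Y` contains the gradient. This inequality is what makes the penalty with `A` stable. -/
lemma formDiv_sq_le (v : Zsub d) (p : Ysub d) :
    formDiv d v p ^ 2 ≤ form0 d v v * formA d p p := by
  have e : formDiv d v p = -∑ m, inner ℝ (v.1 m) (WD [m] p.1) := by
    rw [formDiv_apply, ← Finset.sum_neg_distrib]
    refine Finset.sum_congr rfl fun m _ => ?_
    rw [real_inner_comm (WD [m] p.1),
      ((v.2 m).1.zeroOnFaces m).inner_wd (p.2.2 _ (yIndex_one m)), neg_neg, real_inner_comm]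
  have h0 : form0 d v v = ∑ m, ‖v.1 m‖ ^ 2 := by
    rw [form0_apply]
    simp only [real_inner_self_eq_norm_sq]
  rw [e, neg_sq, h0]
  exact (sum_inner_sq_le _ _ _).trans (mul_le_mul_of_nonneg_left (sum_norm_wd_sq_le p)
    (Finset.sum_nonneg fun m _ => sq_nonneg _))

/-- The forms of the velocity and pressure spaces. -/
def cubeForms (d : ℕ) {τ : ℝ} (hτ : 0 ≤ τ) : Forms (Zsub d) (Ysub d) where
  a0 := form0 d
  a1 := form1 d
  aB := formB d τ
  aA := formA d
  dv := formDiv d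
  symm0 v w := by simp only [form0_apply, real_inner_comm]
  symm1 v w := by simp only [form1_apply, real_inner_comm]
  symmB v w := by simp only [formB_apply, innerB, real_inner_comm]
  symmA p q := by simp only [formA_apply, real_inner_comm]
  nonneg0 v := by
    rw [← normL2_sq]
    positivity
  nonneg1 v := by
    rw [← normH1_sq]
    positivity
  nonnegB v := by
    rw [← normB_sq hτ]
    positivity
  nonnegA q := by
    rw [← normA_sq]
    positivity
  dv_sq_le := formDiv_sq_le

/-! ### Forms in terms of coefficients -/

/-- The left side is one of the nonnegative terms in the expansion of the product. -/
lemma freq_sq_le {a : ℝ} (ha : 0 ≤ a) {l : List (Fin d)} (hl : l.Nodup) (n : Fin d → ℕ) :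
    a ^ l.length * freq l n ^ 2 ≤ ∏ i, (1 + a * (Real.pi * n i) ^ 2) := by
  have e : a ^ l.length * freq l n ^ 2 = ∏ i ∈ l.toFinset, a * (Real.pi * n i) ^ 2 := by
    rw [freq, ← List.prod_replicate, ← List.map_const', sq, ← List.prod_map_mul,
      ← List.prod_map_mul, ← List.prod_toFinset _ hl]
    exact Finset.prod_congr rfl fun i _ => by ring
  rw [e]
  calc ∏ i ∈ l.toFinset, a * (Real.pi * n i) ^ 2
      ≤ ∏ i ∈ l.toFinset, (1 + a * (Real.pi * n i) ^ 2) :=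
        Finset.prod_le_prod (fun i _ => by positivity) fun i _ => by linarith
    _ ≤ ∏ i, (1 + a * (Real.pi * n i) ^ 2) :=
        Finset.prod_le_prod_of_subset_of_one_le (Finset.subset_univ _) (fun i _ => by positivity)
          fun i _ _ => le_add_of_nonneg_right (by positivity)

lemma one_le_prod {a : ℝ} (ha : 0 ≤ a) (n : Fin d → ℕ) :
    1 ≤ ∏ i, (1 + a * (Real.pi * n i) ^ 2) := by
  simpa [freq] using freq_sq_le ha List.nodup_nil n

/-- Division of square-summable coefficients by the symbol of the factorized operator. -/
lemma summable_freq_mul {a : ℝ} (ha : 0 < a) {l : List (Fin d)} (hl : l.Nodup)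
    {x y : (Fin d → ℕ) → ℝ} (hy : Summable fun n => y n ^ 2)
    (h : ∀ n, (∏ i, (1 + a * (Real.pi * n i) ^ 2)) * x n = y n) :
    Summable fun n => (freq l n * x n) ^ 2 := by
  refine Summable.of_nonneg_of_le (fun n => sq_nonneg _) (fun n => ?_)
    (hy.mul_left ((a ^ l.length)⁻¹))
  have h1 := freq_sq_le ha.le hl n
  have h2 := one_le_prod ha.le n
  rw [← h n]
  set P := ∏ i, (1 + a * (Real.pi * n i) ^ 2)
  have hal : 0 < a ^ l.length := by positivity
  rw [inv_mul_eq_div, le_div_iff₀ hal]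
  calc (freq l n * x n) ^ 2 * a ^ l.length = a ^ l.length * freq l n ^ 2 * x n ^ 2 := by ring
    _ ≤ P * x n ^ 2 := by gcongr
    _ ≤ P ^ 2 * x n ^ 2 := by
      gcongr
      nlinarith
    _ = (P * x n) ^ 2 := by ring

lemma memZ1_of_summable {v : L2 d}
    (h : ∀ l, YIndex l → Summable fun n => (freq l n * coef (fun _ => false) n v) ^ 2) :
    MemZ1 v :=
  ⟨memH10_of_summable fun i => h _ (yIndex_one i),
    fun l hl => hasWD_of_summable hl.nodup false (h l hl)⟩

lemma MemZ1.summable {v : L2 d} (h : MemZ1 v) {l : List (Fin d)} (hl : YIndex l) :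
    Summable fun n => (freq l n * coef (fun _ => false) n v) ^ 2 :=
  summable_freq_coef hl.nodup (h.2 l hl) (Or.inr h.1)

/-- Division by the product symbol `P`: the ratio `r / P` is at most one in modulus and preserves
the regularity of `u`, while `1 / P` gains every mixed derivative on the `L²` function `g`. This
includes the boundary condition on all faces, which the last substep imposes only in one direction.
-/
lemma MemZ1.of_coef {a : ℝ} (ha : 0 < a) {u u' g : L2 d} (hu : MemZ1 u) {r : (Fin d → ℕ) → ℝ}
    (hr : ∀ n, |r n| ≤ ∏ i, (1 + a * (Real.pi * n i) ^ 2))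
    (h : ∀ n, (∏ i, (1 + a * (Real.pi * n i) ^ 2)) * coef (fun _ => false) n u' =
      r n * coef (fun _ => false) n u + coef (fun _ => false) n g) : MemZ1 u' := by
  refine memZ1_of_summable fun l hl => ?_
  set P : (Fin d → ℕ) → ℝ := fun n => ∏ i, (1 + a * (Real.pi * n i) ^ 2) with hP
  have hP1 : ∀ n, 1 ≤ P n := fun n => one_le_prod ha.le n
  have hP0 : ∀ n, P n ≠ 0 := fun n => (zero_lt_one.trans_le (hP1 n)).ne'
  have h1 := summable_freq_mul ha hl.nodup (summable_coef_sq (fun _ => false) g)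
    (x := fun n => coef (fun _ => false) n g / P n) (fun n => mul_div_cancel₀ _ (hP0 n))
  refine Summable.of_nonneg_of_le (fun n => sq_nonneg _) (fun n => ?_)
    (((hu.summable hl).mul_left 2).add (h1.mul_left 2))
  have e : coef (fun _ => false) n u' = r n / P n * coef (fun _ => false) n u +
      coef (fun _ => false) n g / P n := by
    field_simp [hP0 n]
    rw [← h n, mul_comm]
  have hq : (r n / P n) ^ 2 ≤ 1 := by
    rw [sq_le_one_iff_abs_le_one, abs_div, abs_of_pos (zero_lt_one.trans_le (hP1 n)),
      div_le_one (zero_lt_one.trans_le (hP1 n))]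
    exact hr n
  rw [e]
  set x := coef (fun _ => false) n u
  set y := coef (fun _ => false) n g / P n
  have : (r n / P n) ^ 2 * (freq l n * x) ^ 2 ≤ (freq l n * x) ^ 2 :=
    mul_le_of_le_one_left (sq_nonneg _) hq
  nlinarith [sq_nonneg (freq l n * (r n / P n * x) - freq l n * y)]

lemma hasSum_inner1 {v w : L2 d} (hv : MemZ1 v) (hw : MemZ1 w) :
    HasSum (fun n => symL n * (coef (fun _ => false) n v * coef (fun _ => false) n w))
      (∑ i, inner ℝ (WD [i] v) (WD [i] w)) := by
  simp only [symL, Finset.sum_mul]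
  exact hasSum_sum fun i _ => hasSum_inner_wd (List.nodup_singleton i) (hv.2 _ (yIndex_one i))
    (hw.2 _ (yIndex_one i)) (Or.inr hv.1) (Or.inr hw.1)

lemma hasSum_innerB (τ : ℝ) {v w : L2 d} (hv : MemZ1 v) (hw : MemZ1 w) :
    HasSum (fun n => symB τ n * (coef (fun _ => false) n v * coef (fun _ => false) n w))
      (innerB τ v w) := by
  simp only [symB, innerB, add_mul, Finset.sum_mul, mul_assoc]
  refine (hasSum_sum fun i _ => hasSum_sum fun j hj => ?_).add
    (HasSum.mul_left _ (hasSum_sum fun i _ => hasSum_sum fun j hj => hasSum_sum fun k hk => ?_))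
  · exact hasSum_inner_wd (nodup_two hj) (hv.2 _ (yIndex_two hj)) (hw.2 _ (yIndex_two hj))
      (Or.inr hv.1) (Or.inr hw.1)
  · exact hasSum_inner_wd (nodup_three hj hk) (hv.2 _ (yIndex_three hj hk))
      (hw.2 _ (yIndex_three hj hk)) (Or.inr hv.1) (Or.inr hw.1)

/-- A time step in terms of sine coefficients. -/
def ModalStep (τ : ℝ) (u u' X : L2 d) : Prop :=
  ∀ n, coef (fun _ => false) n (u' - u) + τ / 2 * (symL n * coef (fun _ => false) n (u' + u))
    + τ ^ 2 / 4 * (symB τ n * coef (fun _ => false) n (u' - u)) = coef (fun _ => false) n X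

lemma ModalStep.sub {τ : ℝ} {u u' X v v' X' : L2 d} (h : ModalStep τ u u' X)
    (h' : ModalStep τ v v' X') : ModalStep τ (u - v) (u' - v') (X - X') := by
  intro n
  have h1 := h n
  have h2 := h' n
  simp only [coef_sub, coef_add] at *
  linear_combination h1 - h2

/-- Multiply by the coefficients of `w` and sum: Parseval converts the modal equation into the
variational one. -/
lemma ModalStep.inner_eq {τ : ℝ} {u u' X w : L2 d} (h : ModalStep τ u u' X) (hu : MemZ1 u)
    (hu' : MemZ1 u') (hw : MemZ1 w) :
    inner ℝ (u' - u) w + τ / 2 * ∑ i, inner ℝ (WD [i] (u' + u)) (WD [i] w)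
      + τ ^ 2 / 4 * innerB τ (u' - u) w = inner ℝ X w := by
  have hs : MemZ1 (u' - u) := ⟨hu'.1.sub hu.1, fun l hl => (hu'.2 l hl).sub (hu.2 l hl)⟩
  have ha : MemZ1 (u' + u) := ⟨hu'.1.add hu.1, fun l hl => (hu'.2 l hl).add (hu.2 l hl)⟩
  refine HasSum.unique (((hasSum_coef_mul_coef (fun _ => false) (u' - u) w).add
    ((hasSum_inner1 ha hw).mul_left _)).add ((hasSum_innerB τ hs hw).mul_left _)) ?_
  refine (hasSum_coef_mul_coef (fun _ => false) X w).congr_fun fun n => ?_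
  rw [← h n]
  ring

/-- The symbol of `A` is the sum of the symbols in the norm of `Y`. -/
def SymbolIdentity (d : ℕ) : Prop := ∀ n : Fin d → ℕ, ∏ i, (1 + (Real.pi * n i) ^ 2) =
  1 + ∑ i, freq [i] n ^ 2 + ∑ i, ∑ j ∈ Finset.Ioi i, freq [i, j] n ^ 2
    + ∑ i, ∑ j ∈ Finset.Ioi i, ∑ k ∈ Finset.Ioi j, freq [i, j, k] n ^ 2

/-- The symbol of `A` dominates every squared frequency product, so division by it gains all the
derivatives in the norm of `Y`. -/
lemma IsA.memY {p g : L2 d} (h : IsA p g) : MemY p :=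
  ⟨h.1, fun l hl => hasWD_of_summable hl.nodup true
    (summable_freq_mul one_pos hl.nodup (summable_coef_sq (fun _ => true) g) fun n => by
      simp only [one_mul]
      exact (h.coef_eq n).symm)⟩

/-- Both sides are the same cosine series, the symbol of `A` being the sum of the squared
frequencies in the form. -/
lemma IsA.inner_eq (hd : SymbolIdentity d) {g : L2 d} {φ : Ysub d} (h : IsA φ.1 g) (P : Ysub d) :
    inner ℝ P.1 g = formA d P φ := by
  have hsum : ∀ {l : List (Fin d)}, YIndex l → HasSum (fun n => freq l n ^ 2 *
      (coef (fun _ => true) n P.1 * coef (fun _ => true) n φ.1))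
      (inner ℝ (WD l P.1) (WD l φ.1)) := fun hl =>
    hasSum_inner_wd hl.nodup (P.2.2 _ hl) (φ.2.2 _ hl) (Or.inl rfl) (Or.inl rfl)
  rw [formA_apply]
  refine HasSum.unique (hasSum_coef_mul_coef (fun _ => true) P.1 g) ?_
  have key := (((hasSum_coef_mul_coef (fun _ => true) P.1 φ.1).add
    (hasSum_sum (s := Finset.univ) fun i _ => hsum (yIndex_one i))).add
    (hasSum_sum (s := Finset.univ) fun i _ => hasSum_sum (s := Finset.Ioi i) fun j hj =>
      hsum (yIndex_two hj))).add
    (hasSum_sum (s := Finset.univ) fun i _ => hasSum_sum (s := Finset.Ioi i) fun j hj =>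
      hasSum_sum (s := Finset.Ioi j) fun k hk => hsum (yIndex_three hj hk))
  refine key.congr_fun fun n => ?_
  rw [h.coef_eq, hd n]
  simp only [← Finset.sum_mul]
  ring

/-! ### Symbols in two and three dimensions -/

lemma symL_two (n : Fin 2 → ℕ) : symL n = (Real.pi * n 0) ^ 2 + (Real.pi * n 1) ^ 2 := by
  simp [symL, freq, Fin.sum_univ_two]

lemma symB_two (τ : ℝ) (n : Fin 2 → ℕ) :
    symB τ n = (Real.pi * n 0) ^ 2 * (Real.pi * n 1) ^ 2 := by
  have h0 : Finset.Ioi (0 : Fin 2) = {1} := by decide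
  have h1 : Finset.Ioi (1 : Fin 2) = ∅ := by decide
  simp [symB, freq, Fin.sum_univ_two, h0, h1, mul_pow]

/-- The product over the directions expands into elementary symmetric polynomials of the squared
frequencies. -/
lemma symbolIdentity_two : SymbolIdentity 2 := by
  intro n
  have h0 : Finset.Ioi (0 : Fin 2) = {1} := by decide
  have h1 : Finset.Ioi (1 : Fin 2) = ∅ := by decide
  simp [freq, Fin.sum_univ_two, Fin.prod_univ_two, h0, h1]
  ring

lemma symL_three (n : Fin 3 → ℕ) :
    symL n = (Real.pi * n 0) ^ 2 + (Real.pi * n 1) ^ 2 + (Real.pi * n 2) ^ 2 := by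
  simp [symL, freq, Fin.sum_univ_three]

lemma symB_three (τ : ℝ) (n : Fin 3 → ℕ) :
    symB τ n = (Real.pi * n 0) ^ 2 * (Real.pi * n 1) ^ 2 + (Real.pi * n 0) ^ 2 * (Real.pi * n 2) ^ 2
      + (Real.pi * n 1) ^ 2 * (Real.pi * n 2) ^ 2
      + τ / 2 * ((Real.pi * n 0) ^ 2 * (Real.pi * n 1) ^ 2 * (Real.pi * n 2) ^ 2) := by
  have h0 : Finset.Ioi (0 : Fin 3) = {1, 2} := by decide
  have h1 : Finset.Ioi (1 : Fin 3) = {2} := by decide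
  have h2 : Finset.Ioi (2 : Fin 3) = ∅ := by decide
  simp [symB, freq, Fin.sum_univ_three, h0, h1, h2]
  ring

lemma symbolIdentity_three : SymbolIdentity 3 := by
  intro n
  have h0 : Finset.Ioi (0 : Fin 3) = {1, 2} := by decide
  have h1 : Finset.Ioi (1 : Fin 3) = {2} := by decide
  have h2 : Finset.Ioi (2 : Fin 3) = ∅ := by decide
  simp [freq, Fin.sum_univ_three, Fin.prod_univ_three, h0, h1, h2]
  ring

/-- The operators for `τ = 1` and `τ = 2` determine `B` for all `τ`; this makes the consistency
constants independent of the time step. -/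
lemma symB_affine (τ : ℝ) (n : Fin d → ℕ) :
    symB τ n = (2 - τ) * symB 1 n + (τ - 1) * symB 2 n := by
  unfold symB
  ring

/-! ### The exact solution -/

lemma IsSmoothEnough.memH10 {T : ℝ} {f u : ℝ → VF d} {p : ℝ → L2 d} (h : IsSmoothEnough T f u p)
    {t : ℝ} (ht : t ∈ Set.Icc 0 T) (m : Fin d) : MemH10 (u t m) := by
  obtain ⟨b, hb, -⟩ := h.velocity_DB 1 one_pos m
  exact (hb t ht).1

lemma freq_three_sq_le (n : Fin d → ℕ) {i j k : Fin d} (hj : j ∈ Finset.Ioi i)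
    (hk : k ∈ Finset.Ioi j) : freq [i, j, k] n ^ 2 ≤
      ∑ i, ∑ j ∈ Finset.Ioi i, ∑ k ∈ Finset.Ioi j, freq [i, j, k] n ^ 2 := by
  calc freq [i, j, k] n ^ 2 ≤ ∑ k ∈ Finset.Ioi j, freq [i, j, k] n ^ 2 :=
        Finset.single_le_sum (f := fun k => freq [i, j, k] n ^ 2) (fun _ _ => sq_nonneg _) hk
    _ ≤ ∑ j ∈ Finset.Ioi i, ∑ k ∈ Finset.Ioi j, freq [i, j, k] n ^ 2 :=
        Finset.single_le_sum (f := fun j => ∑ k ∈ Finset.Ioi j, freq [i, j, k] n ^ 2)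
          (fun _ _ => Finset.sum_nonneg fun _ _ => sq_nonneg _) hj
    _ ≤ _ :=
        Finset.single_le_sum
          (f := fun i => ∑ j ∈ Finset.Ioi i, ∑ k ∈ Finset.Ioi j, freq [i, j, k] n ^ 2)
          (fun _ _ => Finset.sum_nonneg fun _ _ => Finset.sum_nonneg fun _ _ => sq_nonneg _)
          (Finset.mem_univ i)

/-- The difference of the operators for `τ = 2` and `τ = 1` is half the sixth-order part. With `s`
its symbol, `s x²` is bounded by `(s x)² + x²`, a summable sequence. -/
lemma hasWD_three_of_isB {v b₁ b₂ : L2 d} (h₁ : IsB 1 v b₁) (h₂ : IsB 2 v b₂) {i j k : Fin d}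
    (hj : j ∈ Finset.Ioi i) (hk : k ∈ Finset.Ioi j) : HasWD [i, j, k] v := by
  refine hasWD_of_summable (nodup_three hj hk) false ?_
  refine Summable.of_nonneg_of_le (fun n => sq_nonneg _) (fun n => ?_)
    ((summable_coef_sq (fun _ => false) ((2 : ℝ) • (b₂ - b₁))).add
      (summable_coef_sq (fun _ => false) v))
  rw [coef_smul, coef_sub, h₁.coef_eq, h₂.coef_eq]
  set x := coef (fun _ => false) n v
  set s := ∑ i, ∑ j ∈ Finset.Ioi i, ∑ k ∈ Finset.Ioi j, freq [i, j, k] n ^ 2 with hs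
  have e : 2 * (symB 2 n * x - symB 1 n * x) = s * x := by
    rw [symB, symB, ← hs]
    ring
  have h1 := mul_le_mul_of_nonneg_right (freq_three_sq_le n hj hk) (sq_nonneg x)
  rw [← hs] at h1
  rw [e, mul_pow]
  nlinarith [sq_nonneg (s * x - x), sq_nonneg (s * x), sq_nonneg x]

lemma IsSmoothEnough.memZ1 {T : ℝ} {f u : ℝ → VF d} {p : ℝ → L2 d} (h : IsSmoothEnough T f u p)
    {t : ℝ} (ht : t ∈ Set.Icc 0 T) (m : Fin d) : MemZ1 (u t m) := by
  refine ⟨h.memH10 ht m, fun l hl => ?_⟩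
  match l, hl with
  | [], _ => exact (h.velocity_H2 m [] (by simp)).1 t ht
  | [i], _ => exact (h.velocity_H2 m [i] (by simp)).1 t ht
  | [i, j], _ => exact (h.velocity_H2 m [i, j] (by simp)).1 t ht
  | [i, j, k], hl =>
    have hp := hl.2
    simp only [List.pairwise_cons, List.mem_cons, List.not_mem_nil, or_false] at hp
    obtain ⟨b₁, h₁, -⟩ := h.velocity_DB 1 one_pos m
    obtain ⟨b₂, h₂, -⟩ := h.velocity_DB 2 two_pos m
    exact hasWD_three_of_isB (h₁ t ht) (h₂ t ht) (Finset.mem_Ioi.2 (hp.1 j (Or.inl rfl)))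
      (Finset.mem_Ioi.2 (hp.2.1 k rfl))
  | _ :: _ :: _ :: _ :: _, hl => exact absurd hl.1 (by simp)

lemma coef_lap {v : L2 d} (hv : MemH10 v) (h : ∀ j, HasWD [j, j] v) (n : Fin d → ℕ) :
    coef (fun _ => false) n (lap v) = -(symL n * coef (fun _ => false) n v) := by
  rw [lap, coef_sum, symL, Finset.sum_mul, ← Finset.sum_neg_distrib]
  refine Finset.sum_congr rfl fun j _ => ?_
  rw [(hv.zeroOnFaces j).coef_wd_pair (h j)]
  simp [freq]

/-- The time derivative of the exact velocity is twice weakly differentiable in time. -/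
lemma IsStokesSolution.exists_deriv {T : ℝ} {f : ℝ → VF d} {u₀ : VF d} {u : ℝ → VF d}
    {p : ℝ → L2 d} (hT : 0 < T) (hS : IsStokesSolution T f u₀ u p) (h : IsSmoothEnough T f u p)
    (m : Fin d) : MemW2Infty T (fun t => lap (u t m) + f t m + -WD [m] (p t)) ∧
      ∀ t ∈ Set.Icc 0 T, HasDerivWithinAt (fun s => u s m)
        (lap (u t m) + f t m + -WD [m] (p t)) (Set.Icc 0 T) t := by
  have hG : MemW2Infty T (fun t => lap (u t m) + f t m + -WD [m] (p t)) :=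
    ((memW2Infty_sum _ fun j _ => (h.velocity_H2 m [j, j] (by simp)).2).add (h.source m)).add
      (h.pressure_Y.2 [m] (yIndex_one m)).neg
  refine ⟨hG, ?_⟩
  obtain ⟨g, hg, L, hL⟩ := (h.velocity_H2 m [] (by simp)).2
  simp only [wd_nil] at hg
  -- The momentum equation holds only for positive times; continuity of both sides extends it to `t
  -- = 0`. Its right side lies in `W^{2,∞}(L²)`, so the velocity gains one time derivative.
  have heq : Set.EqOn g (fun t => lap (u t m) + f t m + -WD [m] (p t)) (Set.Icc 0 T) := by
    refine Set.EqOn.of_subset_closure (s := Set.Ioc 0 T) (fun t ht => ?_) hL.continuousOn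
      hG.continuousOn Set.Ioc_subset_Icc_self (by rw [closure_Ioc hT.ne])
    obtain ⟨ut, hut, hmom⟩ := hS.momentum t ht m
    have ht' := Set.Ioc_subset_Icc_self ht
    have : g t = ut := (uniqueDiffOn_Icc hT t ht').eq_deriv _ (hg t ht') hut
    rw [this]
    simp only [← hmom]
    abel
  intro t ht
  have := heq ht
  simp only at this
  rw [← this]
  exact hg t ht

lemma exists_uniform {ι : Type*} [Finite ι] {P : ι → ℝ → Prop}
    (h : ∀ i, ∃ C, 0 ≤ C ∧ P i C) (mono : ∀ i C C', C ≤ C' → P i C → P i C') :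
    ∃ C, 0 ≤ C ∧ ∀ i, P i C := by
  have := Fintype.ofFinite ι
  choose C h0 hC using h
  exact ⟨∑ i, C i, Finset.sum_nonneg fun i _ => h0 i, fun i => mono i _ _
    (Finset.single_le_sum (fun j _ => h0 j) (Finset.mem_univ i)) (hC i)⟩

/-- Consistency: the exact velocity satisfies a time step with a residual of second order. -/
lemma IsStokesSolution.exists_residual {T : ℝ} {f : ℝ → VF d} {u₀ : VF d} {u : ℝ → VF d}
    {p : ℝ → L2 d} (hT : 0 < T) (hS : IsStokesSolution T f u₀ u p) (h : IsSmoothEnough T f u p) :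
    ∃ C, 0 ≤ C ∧ ∀ m, ∀ (τ : ℝ) (k : ℕ), 0 < τ → ((k : ℝ) + 1) * τ ≤ T →
      ∃ R : L2 d, ‖R‖ ≤ C * τ ^ 2 ∧ ModalStep τ (u (k * τ) m) (u ((k + 1 : ℕ) * τ) m)
        (τ • (R + (f (tHalf τ k) m - WD [m] (p (tHalf τ k))))) := by
  refine exists_uniform (P := fun m C => ∀ (τ : ℝ) (k : ℕ), 0 < τ → ((k : ℝ) + 1) * τ ≤ T →
      ∃ R : L2 d, ‖R‖ ≤ C * τ ^ 2 ∧ ModalStep τ (u (k * τ) m) (u ((k + 1 : ℕ) * τ) m)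
        (τ • (R + (f (tHalf τ k) m - WD [m] (p (tHalf τ k)))))) (fun m => ?_) ?_
  swap
  · intro m C C' hCC hC τ k hτ hk
    obtain ⟨R, hR, hmod⟩ := hC τ k hτ hk
    exact ⟨R, hR.trans (by gcongr), hmod⟩
  obtain ⟨hG, hderiv⟩ := hS.exists_deriv hT h m
  obtain ⟨C₁, hC₁, bound₁⟩ := exists_midpoint_bound hderiv hG
  have hlap : MemW2Infty T (fun t => lap (u t m)) :=
    memW2Infty_sum _ fun j _ => (h.velocity_H2 m [j, j] (by simp)).2
  obtain ⟨C₂, hC₂, bound₂⟩ := hlap.exists_second_difference_bound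
  obtain ⟨b₁, hb₁, lb₁⟩ := h.velocity_DB 1 one_pos m
  obtain ⟨b₂, hb₂, lb₂⟩ := h.velocity_DB 2 two_pos m
  obtain ⟨L₁, hL₁, lip₁⟩ := lb₁.exists_bound
  obtain ⟨L₂, hL₂, lip₂⟩ := lb₂.exists_bound
  refine ⟨C₁ + C₂ + (2 + T) * (L₁ + L₂), by positivity, fun τ k hτ hk => ?_⟩
  have hk0 : (0 : ℝ) ≤ k := Nat.cast_nonneg k
  have hkτ : 0 ≤ (k : ℝ) * τ := by positivity
  set t₀ := (k : ℝ) * τ with ht₀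
  set t₁ := ((k + 1 : ℕ) : ℝ) * τ with ht₁
  set t := tHalf τ k with ht
  have e₀ : t - τ / 2 = t₀ := by rw [ht, tHalf, ht₀]; ring
  have e₁ : t + τ / 2 = t₁ := by rw [ht, tHalf, ht₁]; push_cast; ring
  have e₁₀ : t₁ - t₀ = τ := by rw [← e₀, ← e₁]; ring
  have ht₁T : t₁ ≤ T := by rw [ht₁]; push_cast; exact hk
  have m₀ : t₀ ∈ Set.Icc 0 T := ⟨hkτ, by linarith⟩
  have m₁ : t₁ ∈ Set.Icc 0 T := ⟨by linarith, ht₁T⟩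
  have mt : t ∈ Set.Icc 0 T := ⟨by linarith, by linarith⟩
  have hτT : τ ≤ T := by linarith
  -- This represents `B u` for the current `τ`; the weights are bounded by `2 + T`, hence the
  -- Lipschitz constant is uniform in `τ`.
  set b : ℝ → L2 d := fun t => (2 - τ) • b₁ t + (τ - 1) • b₂ t with hb
  set X : L2 d := (u t₁ m - u t₀ m) - (τ / 2) • (lap (u t₁ m) + lap (u t₀ m))
    + (τ ^ 2 / 4) • (b t₁ - b t₀) with hX
  set R : L2 d := τ⁻¹ • X - (f t m - WD [m] (p t)) with hR
  refine ⟨R, ?_, ?_⟩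
  · have hb' : ‖b t₁ - b t₀‖ ≤ (2 + T) * (L₁ + L₂) * τ := by
      have e : b t₁ - b t₀ = (2 - τ) • (b₁ t₁ - b₁ t₀) + (τ - 1) • (b₂ t₁ - b₂ t₀) := by
        simp only [hb]
        module
      have l₁ := lip₁ t₀ m₀ t₁ m₁
      have l₂ := lip₂ t₀ m₀ t₁ m₁
      rw [e₁₀, abs_of_pos hτ] at l₁ l₂
      have a₁ : |2 - τ| ≤ 2 + T := abs_le.2 ⟨by linarith, by linarith⟩
      have a₂ : |τ - 1| ≤ 2 + T := abs_le.2 ⟨by linarith, by linarith⟩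
      rw [e]
      calc ‖(2 - τ) • (b₁ t₁ - b₁ t₀) + (τ - 1) • (b₂ t₁ - b₂ t₀)‖
          ≤ |2 - τ| * ‖b₁ t₁ - b₁ t₀‖ + |τ - 1| * ‖b₂ t₁ - b₂ t₀‖ := by
            refine (norm_add_le _ _).trans_eq ?_
            rw [norm_smul, norm_smul, Real.norm_eq_abs, Real.norm_eq_abs]
        _ ≤ (2 + T) * (L₁ * τ) + (2 + T) * (L₂ * τ) := by gcongr
        _ = _ := by ring
    have k₁ := bound₁ t (τ / 2) (by positivity) (by rwa [e₀]) (by rwa [e₁])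
    have k₂ := bound₂ t (τ / 2) (by rwa [e₀]) mt (by rwa [e₁])
    rw [e₀, e₁] at k₁ k₂
    -- Three errors, each `O(τ³)`: the midpoint rule for the time derivative, the trapezoidal
    -- average of the Laplacian, and the splitting term, where `τ²` meets the Lipschitz continuity
    -- of `B u`.
    have e : τ • R = (u t₁ m - u t₀ m - (2 * (τ / 2)) • (lap (u t m) + f t m + -WD [m] (p t)))
        - (τ / 2) • (lap (u t₁ m) + lap (u t₀ m) - (2 : ℝ) • lap (u t m))
        + (τ ^ 2 / 4) • (b t₁ - b t₀) := by
      rw [hR, smul_sub, smul_smul, mul_inv_cancel₀ hτ.ne', one_smul, hX]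
      module
    have hn : τ * ‖R‖ ≤ τ * ((C₁ + C₂ + (2 + T) * (L₁ + L₂)) * τ ^ 2) := by
      have : τ * ‖R‖ = ‖τ • R‖ := by rw [norm_smul, Real.norm_eq_abs, abs_of_pos hτ]
      rw [this, e]
      refine (norm_add_le _ _).trans ?_
      refine (add_le_add_left (norm_sub_le _ _) _).trans ?_
      rw [norm_smul (τ / 2), norm_smul (τ ^ 2 / 4), Real.norm_eq_abs, Real.norm_eq_abs,
        abs_of_pos (by positivity : 0 < τ / 2), abs_of_pos (by positivity : 0 < τ ^ 2 / 4)]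
      have k₂' := mul_le_mul_of_nonneg_left k₂ (by positivity : 0 ≤ τ / 2)
      have k₃' := mul_le_mul_of_nonneg_left hb' (by positivity : 0 ≤ τ ^ 2 / 4)
      have p₁ : 0 ≤ C₁ * τ ^ 3 := by positivity
      have p₂ : 0 ≤ C₂ * τ ^ 3 := by positivity
      have p₃ : 0 ≤ (2 + T) * (L₁ + L₂) * τ ^ 3 := by positivity
      linarith
    exact le_of_mul_le_mul_left hn hτ
  · intro n
    have eX : τ • (R + (f t m - WD [m] (p t))) = X := by
      rw [hR, sub_add_cancel, smul_smul, mul_inv_cancel₀ hτ.ne', one_smul]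
    have hl := fun {s : ℝ} (hs : s ∈ Set.Icc 0 T) =>
      coef_lap (h.memH10 hs m) (fun j => (h.velocity_H2 m [j, j] (by simp)).1 s hs) n
    have hbc : ∀ s ∈ Set.Icc 0 T, coef (fun _ => false) n (b s) =
        symB τ n * coef (fun _ => false) n (u s m) := by
      intro s hs
      rw [hb, coef_add, coef_smul, coef_smul, (hb₁ s hs).coef_eq, (hb₂ s hs).coef_eq,
        symB_affine τ n]
      ring
    rw [eX, hX]
    simp only [coef_add, coef_sub, coef_smul, hl m₀, hl m₁, hbc _ m₀, hbc _ m₁]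
    ring

/-! ### The schemes in terms of sine coefficients -/

/-- What the velocity steps of both schemes have in common. -/
structure IsVelocityScheme (τ : ℝ) (K : ℕ) (f : ℝ → VF d) (u : ℕ → VF d) (p φ : ℕ → L2 d) :
    Prop where
  memZ1 : ∀ k ≤ K, ∀ m, MemZ1 (u k m)
  modal : ∀ k < K, ∀ m, ModalStep τ (u k m) (u (k + 1) m)
    (τ • (f (tHalf τ k) m - WD [m] (p k + φ k)))

lemma abs_one_sub_le {x : ℝ} (hx : 0 ≤ x) : |1 - x| ≤ 1 + x :=
  abs_le.2 ⟨by linarith, by linarith⟩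

/-- On each mode the half-step value is a number `y` in two linear equations; eliminating it gives a
two-factor formula. Regularity is proved by induction along the steps, as the sine coefficients of
`∂_yy u^k` need the boundary values of `u^k`. -/
lemma IsScheme2D.isVelocityScheme {τ χ : ℝ} {K : ℕ} {f : ℝ → VF 2} {u₀ : VF 2} {p₀ φ₀ : L2 2}
    {u uh : ℕ → VF 2} {p φ : ℕ → L2 2} (hτ : 0 < τ)
    (h : IsScheme2D τ χ K f u₀ p₀ φ₀ u uh p φ) (h0 : ∀ m, MemZ1 (u₀ m)) :
    IsVelocityScheme τ K f u p φ := by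
  have coefs : ∀ k < K, ∀ m, MemZ1 (u k m) → ∀ n, ∃ y : ℝ,
      y - coef (fun _ => false) n (u k m) + τ / 2 * ((Real.pi * n 0) ^ 2 * y
        + (Real.pi * n 1) ^ 2 * coef (fun _ => false) n (u k m)) =
        τ / 2 * coef (fun _ => false) n (f (tHalf τ k) m - WD [m] (p k + φ k)) ∧
      coef (fun _ => false) n (u (k + 1) m) - y + τ / 2 * ((Real.pi * n 0) ^ 2 * y
        + (Real.pi * n 1) ^ 2 * coef (fun _ => false) n (u (k + 1) m)) =
        τ / 2 * coef (fun _ => false) n (f (tHalf τ k) m - WD [m] (p k + φ k)) := by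
    intro k hk m hu n
    have c1 := (h.bc_uh k hk m).coef_wd_pair (h.diff_uh k hk m) n
    have c2 := (hu.1.zeroOnFaces 1).coef_wd_pair (h.diff_u k hk.le m) n
    have c3 := (h.bc_u k hk m).coef_wd_pair (h.diff_u (k + 1) hk m) n
    have s1 := congrArg (coef (fun _ => false) n) (h.half_step k hk m)
    have s2 := congrArg (coef (fun _ => false) n) (h.full_step k hk m)
    refine ⟨coef (fun _ => false) n (uh k m), ?_, ?_⟩
    · simp only [coef_add, coef_sub, coef_smul, c1, c2] at s1 ⊢
      rw [← s1]
      field_simp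
      ring
    · simp only [coef_add, coef_sub, coef_smul, c1, c3] at s2 ⊢
      rw [← s2]
      field_simp
      ring
  have hZ : ∀ k ≤ K, ∀ m, MemZ1 (u k m) := by
    intro k
    induction k with
    | zero =>
      intro _ m
      rw [h.init_u]
      exact h0 m
    | succ k ih =>
      intro hk m
      have hu := ih (by omega) m
      refine MemZ1.of_coef (a := τ / 2) (by positivity) hu
        (r := fun n => (1 - τ / 2 * (Real.pi * n 0) ^ 2) * (1 - τ / 2 * (Real.pi * n 1) ^ 2))
        (g := τ • (f (tHalf τ k) m - WD [m] (p k + φ k))) (fun n => ?_) fun n => ?_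
      · rw [abs_mul, Fin.prod_univ_two]
        exact mul_le_mul (abs_one_sub_le (by positivity)) (abs_one_sub_le (by positivity))
          (abs_nonneg _) (by positivity)
      · obtain ⟨y, h1, h2⟩ := coefs k (by omega) m hu n
        rw [Fin.prod_univ_two, coef_smul]
        -- The multipliers are chosen to cancel `y`; what remains is the amplification factor, with
        -- the numerator `(1 - τ λ₀ / 2) (1 - τ λ₁ / 2)`.
        linear_combination (1 + τ / 2 * (Real.pi * n 0) ^ 2) * h2 +
          (1 - τ / 2 * (Real.pi * n 0) ^ 2) * h1
  refine ⟨hZ, fun k hk m n => ?_⟩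
  obtain ⟨y, h1, h2⟩ := coefs k hk m (hZ k hk.le m) n
  rw [symL_two, symB_two, coef_smul]
  simp only [coef_sub (v := u (k + 1) m), coef_add (v := u (k + 1) m)]
  -- The difference of the two equations expresses `y` as the average of old and new value plus `(τ
  -- / 4) λ₁` times the increment; inserted into their sum, the latter produces the term with `B`.
  linear_combination h1 + h2 + τ / 2 * (Real.pi * n 0) ^ 2 * (h2 - h1)

lemma ZeroOnFaces.sub {i : Fin d} {v w : L2 d} (hv : ZeroOnFaces i v) (hw : ZeroOnFaces i w) :
    ZeroOnFaces i (v - w) :=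
  MemClosureTest.sub hv hw

/-- Each substep inverts one factor `1 + τ λ_i / 2` on the deviation from `u^k`, so the product of
all three acts on the increment. Its expansion is `1 + (τ / 2) symL + (τ² / 4) symB τ`; the term of
degree three explains the `τ`-dependent part of `B`. -/
lemma IsScheme3D.isVelocityScheme {τ χ : ℝ} {K : ℕ} {f : ℝ → VF 3} {u₀ : VF 3} {p₀ φ₀ : L2 3}
    {u ξ η ζ : ℕ → VF 3} {p φ : ℕ → L2 3} (hτ : 0 < τ)
    (h : IsScheme3D τ χ K f u₀ p₀ φ₀ u ξ η ζ p φ) (h0 : ∀ m, MemZ1 (u₀ m)) :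
    IsVelocityScheme τ K f u p φ := by
  have coefs : ∀ k < K, ∀ m, MemZ1 (u k m) → ∀ n,
      (∏ i, (1 + τ / 2 * (Real.pi * n i) ^ 2)) *
          (coef (fun _ => false) n (u (k + 1) m) - coef (fun _ => false) n (u k m)) =
        τ * (coef (fun _ => false) n (f (tHalf τ k) m - WD [m] (p k + φ k))
          - symL n * coef (fun _ => false) n (u k m)) := by
    intro k hk m hu n
    have z := fun i => hu.1.zeroOnFaces i
    have c0 := coef_lap hu.1 (h.diff_u k hk.le m) n
    have c1 := (ZeroOnFaces.sub (h.bc_eta k hk m) (z 0)).coef_wd_pair (h.diff_eta k hk m) n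
    have c2 := (ZeroOnFaces.sub (h.bc_zeta k hk m) (z 1)).coef_wd_pair (h.diff_zeta k hk m) n
    have c3 := (ZeroOnFaces.sub (h.bc_u k hk m) (z 2)).coef_wd_pair (h.diff_incr k hk m) n
    have s0 := congrArg (fun x => τ * coef (fun _ => false) n x) (h.xi_step k hk m)
    have s1 := congrArg (fun x => τ * coef (fun _ => false) n x) (h.eta_step k hk m)
    have s2 := congrArg (fun x => τ * coef (fun _ => false) n x) (h.zeta_step k hk m)
    have s3 := congrArg (fun x => τ * coef (fun _ => false) n x) (h.u_step k hk m)
    have hz : coef (fun _ => false) n (0 : L2 3) = 0 := by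
      rw [coef_eq_inner, inner_zero_left]
    have hi : τ * (1 / τ) = 1 := by field_simp
    have hi' : ∀ x : ℝ, τ * (1 / τ * x) = x := fun x => by rw [← mul_assoc, hi, one_mul]
    simp only [coef_add, coef_sub, coef_smul, c0, c1, c2, c3, hz, mul_add, mul_sub, hi'] at *
    rw [Fin.prod_univ_three]
    linear_combination s0 + s1 + s2 * (1 + τ / 2 * (Real.pi * n 0) ^ 2) +
      s3 * ((1 + τ / 2 * (Real.pi * n 0) ^ 2) * (1 + τ / 2 * (Real.pi * n 1) ^ 2))
  have hZ : ∀ k ≤ K, ∀ m, MemZ1 (u k m) := by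
    intro k
    induction k with
    | zero =>
      intro _ m
      rw [h.init_u]
      exact h0 m
    | succ k ih =>
      intro hk m
      have hu := ih (by omega) m
      -- With `r` equal to the full product the old velocity keeps its regularity; `lap (u k m)` may
      -- be part of `g` because it is in `L²`.
      refine MemZ1.of_coef (a := τ / 2) (by positivity) hu
        (r := fun n => ∏ i, (1 + τ / 2 * (Real.pi * n i) ^ 2))
        (g := τ • (f (tHalf τ k) m - WD [m] (p k + φ k) + lap (u k m))) (fun n => ?_) fun n => ?_
      · exact (abs_of_nonneg (zero_le_one.trans (one_le_prod (by positivity) n))).le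
      · have h1 := coefs k (by omega) m hu n
        rw [coef_smul, coef_add, coef_lap hu.1 (h.diff_u k (by omega) m)]
        linear_combination h1
  refine ⟨hZ, fun k hk m n => ?_⟩
  have h1 := coefs k hk m (hZ k hk.le m) n
  rw [Fin.prod_univ_three, symL_three] at h1
  rw [symL_three, symB_three, coef_smul]
  simp only [coef_sub (v := u (k + 1) m), coef_add (v := u (k + 1) m)]
  linear_combination h1

/-! ### The error recursion -/

open Classical in
/-- A velocity field as an element of `Zsub`. -/
def toZ (v : VF d) : Zsub d := if h : MemZ v then ⟨v, h⟩ else 0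

open Classical in
/-- A pressure as an element of `Ysub`. -/
def toY (q : L2 d) : Ysub d := if h : MemY q then ⟨q, h⟩ else 0

lemma toZ_val {v : VF d} (h : MemZ v) : (toZ v).1 = v := by rw [toZ, dif_pos h]

lemma toY_val {q : L2 d} (h : MemY q) : (toY q).1 = q := by rw [toY, dif_pos h]

lemma toZ_zero : toZ (0 : VF d) = 0 := Subtype.ext (toZ_val (Zsub d).zero_mem)

lemma toY_zero : toY (0 : L2 d) = 0 := Subtype.ext (toY_val (Ysub d).zero_mem)

lemma MemY.add {p q : L2 d} (hp : MemY p) (hq : MemY q) : MemY (p + q) := (Ysub d).add_mem hp hq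

lemma MemY.sub {p q : L2 d} (hp : MemY p) (hq : MemY q) : MemY (p - q) := (Ysub d).sub_mem hp hq

lemma MemZ.sub {v w : VF d} (hv : MemZ v) (hw : MemZ w) : MemZ (v - w) := (Zsub d).sub_mem hv hw

lemma formA_le (p : Ysub d) {B : ℝ} (h : ∀ l, YIndex l → ‖WD l p.1‖ ≤ B) :
    formA d p p ≤ (1 + d + d ^ 2 + d ^ 3) * B ^ 2 := by
  have hsq : ∀ l, YIndex l → ‖WD l p.1‖ ^ 2 ≤ B ^ 2 := fun l hl =>
    pow_le_pow_left₀ (norm_nonneg _) (h l hl) 2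
  have hc : ∀ {s : Finset (Fin d)} {g : Fin d → ℝ} {b : ℝ}, 0 ≤ b → (∀ i ∈ s, g i ≤ b) →
      ∑ i ∈ s, g i ≤ d * b := by
    intro s g b hb hg
    refine (Finset.sum_le_card_nsmul s g b hg).trans ?_
    rw [nsmul_eq_mul]
    gcongr
    simpa using Finset.card_le_univ s
  rw [formA_apply]
  simp only [real_inner_self_eq_norm_sq]
  have h0 := hsq [] yIndex_nil
  rw [wd_nil] at h0
  have h1 := hc (s := Finset.univ) (sq_nonneg B) fun i _ => hsq _ (yIndex_one i)
  have h2 := hc (s := Finset.univ) (by positivity : 0 ≤ d * B ^ 2) fun i _ =>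
    hc (s := Finset.Ioi i) (sq_nonneg B) fun j hj => hsq _ (yIndex_two hj)
  have h3 := hc (s := Finset.univ) (by positivity : 0 ≤ d * (d * B ^ 2)) fun i _ =>
    hc (s := Finset.Ioi i) (by positivity : 0 ≤ d * B ^ 2) fun j hj =>
      hc (s := Finset.Ioi j) (sq_nonneg B) fun k hk => hsq _ (yIndex_three hj hk)
  linarith

/-- The exact pressure at the times at which the discrete pressure approximates it. -/
def exactPres (τ : ℝ) (pe : ℝ → L2 d) : ℕ → L2 d
  | 0 => pe 0
  | k + 1 => pe (tHalf τ k)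

lemma tHalf_mem {T τ : ℝ} {k K : ℕ} (hτ : 0 < τ) (hK : K * τ ≤ T) (hk : k < K) :
    tHalf τ k ∈ Set.Icc 0 T := by
  have h : ((k : ℝ) + 1) * τ ≤ K * τ :=
    mul_le_mul_of_nonneg_right (by exact_mod_cast hk) hτ.le
  unfold tHalf
  exact ⟨by positivity, by linarith⟩

lemma exactPres_memY {T τ : ℝ} {K k : ℕ} {f u : ℝ → VF d} {pe : ℝ → L2 d} (hT : 0 < T)
    (h : IsSmoothEnough T f u pe) (hτ : 0 < τ) (hK : K * τ ≤ T) (hk : k ≤ K) :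
    MemY (exactPres τ pe k) := by
  cases k with
  | zero => exact h.pressure_Y.1 0 ⟨le_rfl, hT.le⟩
  | succ k => exact h.pressure_Y.1 _ (tHalf_mem hτ hK hk)

/-- Time differences of the exact pressure are of the expected order in the norm of `Y`. -/
lemma IsSmoothEnough.exists_pressure_bound {T : ℝ} {f u : ℝ → VF d} {pe : ℝ → L2 d} (hT : 0 < T)
    (h : IsSmoothEnough T f u pe) : ∃ C, 0 ≤ C ∧ ∀ (τ : ℝ) (K : ℕ), 0 < τ → K * τ ≤ T →
      (∀ k < K, ∀ q : Ysub d, q.1 = exactPres τ pe (k + 1) - exactPres τ pe k →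
        formA d q q ≤ (C * τ) ^ 2) ∧
      ∀ k, 0 < k → k + 1 < K → ∀ q : Ysub d,
        q.1 = exactPres τ pe (k + 2) - exactPres τ pe (k + 1) -
          (exactPres τ pe (k + 1) - exactPres τ pe k) → formA d q q ≤ (C * τ ^ 2) ^ 2 := by
  have hfin : Finite {l : List (Fin d) // YIndex l} :=
    ((List.finite_length_le (Fin d) 3).subset fun l hl => hl.1).to_subtype
  obtain ⟨C₁, hC₁, b₁⟩ := exists_uniform
    (P := fun (l : {l : List (Fin d) // YIndex l}) C => ∀ x ∈ Set.Icc 0 T, ∀ y ∈ Set.Icc 0 T,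
      ‖WD l.1 (pe y) - WD l.1 (pe x)‖ ≤ C * |y - x|)
    (fun l => (h.pressure_Y.2 l.1 l.2).exists_lipschitz_bound)
    fun l C C' hCC hC x hx y hy => (hC x hx y hy).trans (by gcongr)
  obtain ⟨C₂, hC₂, b₂⟩ := exists_uniform
    (P := fun (l : {l : List (Fin d) // YIndex l}) C => ∀ m s, m - s ∈ Set.Icc 0 T →
      m ∈ Set.Icc 0 T → m + s ∈ Set.Icc 0 T →
      ‖WD l.1 (pe (m + s)) + WD l.1 (pe (m - s)) - (2 : ℝ) • WD l.1 (pe m)‖ ≤ C * s ^ 2)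
    (fun l => (h.pressure_Y.2 l.1 l.2).exists_second_difference_bound)
    fun l C C' hCC hC m s h1 h2 h3 => (hC m s h1 h2 h3).trans (by gcongr)
  set M : ℝ := 1 + d + d ^ 2 + d ^ 3 with hM
  have hM0 : 0 ≤ M := by positivity
  refine ⟨√M * (C₁ + C₂), by positivity, fun τ K hτ hK => ⟨fun k hk q hq => ?_, ?_⟩⟩
  · refine (formA_le q (B := (C₁ + C₂) * τ) fun l hl => ?_).trans_eq ?_
    · rw [hq, wd_sub ((exactPres_memY hT h hτ hK hk).2 l hl)
        ((exactPres_memY hT h hτ hK hk.le).2 l hl)]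
      have key : ∀ x ∈ Set.Icc 0 T, ∀ y ∈ Set.Icc 0 T, |y - x| ≤ τ →
          ‖WD l (pe y) - WD l (pe x)‖ ≤ (C₁ + C₂) * τ := fun x hx y hy hxy =>
        (b₁ ⟨l, hl⟩ x hx y hy).trans (mul_le_mul (by linarith) hxy (abs_nonneg _) (by positivity))
      cases k with
      | zero =>
        -- The first increment is over a time of only `τ / 2`, as the initial pressure is taken at
        -- time zero.
        refine key _ ⟨le_rfl, hT.le⟩ _ (tHalf_mem hτ hK hk) ?_
        rw [tHalf, abs_le]
        constructor <;> push_cast <;> linarith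
      | succ k =>
        refine key _ (tHalf_mem hτ hK (by omega)) _ (tHalf_mem hτ hK hk) ?_
        rw [tHalf, tHalf, abs_le]
        constructor <;> push_cast <;> linarith
    · rw [mul_pow, mul_pow, mul_pow, Real.sq_sqrt hM0]
      ring
  · intro k hk0 hk q hq
    -- For `k > 0` the three times are equally spaced by `τ`, so this is a genuine second
    -- difference; with time zero among them it would be of first order only.
    obtain ⟨j, rfl⟩ : ∃ j, k = j + 1 := ⟨k - 1, by omega⟩
    refine (formA_le q (B := (C₁ + C₂) * τ ^ 2) fun l hl => ?_).trans_eq ?_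
    · have y := fun i (hi : i ≤ K) => (exactPres_memY hT h hτ hK hi).2 l hl
      rw [hq, wd_sub ((y _ hk).sub (y _ hk.le)) ((y _ hk.le).sub (y _ (by omega))),
        wd_sub (y _ hk) (y _ hk.le), wd_sub (y _ hk.le) (y _ (by omega))]
      have e1 : tHalf τ (j + 1 + 1) = tHalf τ (j + 1) + τ := by
        unfold tHalf
        push_cast
        ring
      have e2 : tHalf τ j = tHalf τ (j + 1) - τ := by
        unfold tHalf
        push_cast
        ring
      have m0 := tHalf_mem hτ hK (show j < K by omega)
      have m1 := tHalf_mem hτ hK (show j + 1 < K by omega)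
      have m2 := tHalf_mem hτ hK hk
      rw [e2] at m0
      rw [e1] at m2
      have := b₂ ⟨l, hl⟩ _ τ m0 m1 m2
      simp only [exactPres]
      rw [e1, e2]
      refine (le_of_eq (congrArg norm ?_)).trans (this.trans (by gcongr; linarith))
      module
    · rw [mul_pow, mul_pow, mul_pow, Real.sq_sqrt hM0]
      ring

/-- Testing with velocities the equation satisfied by the error in one step. -/
lemma ModalStep.sum_inner_eq {τ : ℝ} {e e' w : Zsub d} {R : VF d} {q : L2 d}
    (hq : ∀ m, HasWD [m] q) (h : ∀ m, ModalStep τ (e.1 m) (e'.1 m) (τ • (R m - WD [m] q))) :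
    form0 d (e' - e) w + τ / 2 * form1 d (e' + e) w + τ ^ 2 / 4 * formB d τ (e' - e) w =
      τ * ∑ m, inner ℝ q (WD [m] (w.1 m)) + τ * ∑ m, inner ℝ (R m) (w.1 m) := by
  rw [form0_apply, form1_apply, formB_apply, Finset.mul_sum, Finset.mul_sum, Finset.mul_sum,
    Finset.mul_sum, ← Finset.sum_add_distrib, ← Finset.sum_add_distrib, ← Finset.sum_add_distrib]
  refine Finset.sum_congr rfl fun m _ => ?_
  refine ((h m).inner_eq (e.2 m) (e'.2 m) (w.2 m)).trans ?_
  rw [real_inner_smul_left, inner_sub_left, ((w.2 m).1.zeroOnFaces m).inner_wd (hq m)]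
  ring

/-- The functional `w ↦ ∑ m, ⟨R m, w m⟩`. -/
def pairVel (R : VF d) : Zsub d →ₗ[ℝ] ℝ := ∑ m, (innerₗ (L2 d) (R m)) ∘ₗ wdZ [] m

lemma pairVel_apply (R : VF d) (w : Zsub d) : pairVel R w = ∑ m, inner ℝ (R m) (w.1 m) := by
  simp [pairVel, wdZ_apply yIndex_nil]

/-- The functional `w ↦ ⟨q, ∇ · w⟩`. -/
def pairDiv (q : L2 d) : Zsub d →ₗ[ℝ] ℝ := ∑ m, (innerₗ (L2 d) q) ∘ₗ wdZ [m] m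

lemma pairDiv_apply (q : L2 d) (w : Zsub d) :
    pairDiv q w = ∑ m, inner ℝ q (WD [m] (w.1 m)) := by
  simp [pairDiv, wdZ_apply (yIndex_one _)]

lemma pairVel_sq_le {R : VF d} {B : ℝ} (h : ∀ m, ‖R m‖ ≤ B) (w : Zsub d) :
    pairVel R w ^ 2 ≤ d * B ^ 2 * form0 d w w := by
  rw [pairVel_apply, form0_apply]
  simp only [real_inner_self_eq_norm_sq]
  refine (sum_inner_sq_le _ _ _).trans (mul_le_mul_of_nonneg_right ?_
    (Finset.sum_nonneg fun m _ => sq_nonneg _))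
  refine (Finset.sum_le_card_nsmul _ _ (B ^ 2) fun m _ =>
    pow_le_pow_left₀ (norm_nonneg _) (h m) 2).trans_eq ?_
  simp

lemma pairDiv_sq_le {q : L2 d} {B : ℝ} (h : ‖q‖ ≤ B) (w : Zsub d) :
    pairDiv q w ^ 2 ≤ d * B ^ 2 * form1 d w w := by
  rw [pairDiv_apply, form1_apply]
  simp only [real_inner_self_eq_norm_sq]
  refine (sum_inner_sq_le _ (fun _ => q) _).trans (mul_le_mul ?_ ?_
    (Finset.sum_nonneg fun m _ => sq_nonneg _) (by positivity))
  · refine (Finset.sum_le_card_nsmul _ _ (B ^ 2) fun m _ =>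
      pow_le_pow_left₀ (norm_nonneg _) h 2).trans_eq ?_
    simp
  · exact Finset.sum_le_sum fun m _ => Finset.single_le_sum
      (f := fun i => ‖WD [i] (w.1 m)‖ ^ 2) (fun i _ => sq_nonneg _) (Finset.mem_univ m)

lemma IsPressureScheme.memY {τ : ℝ} {K : ℕ} {u₀ : VF d} {p₀ φ₀ : L2 d} {u : ℕ → VF d}
    {p φ : ℕ → L2 d} (h : IsPressureScheme τ 0 K u₀ p₀ φ₀ u p φ) (h0 : MemY p₀) :
    ∀ k ≤ K, MemY (p k) := by
  intro k
  induction k with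
  | zero =>
    intro _
    rw [h.init_p]
    exact h0
  | succ k ih =>
    intro hk
    rw [h.update k hk, zero_smul, sub_zero]
    exact (ih (by omega)).add (h.penalty k hk).memY

/-- The errors of the scheme satisfy an error recursion with constants that do not depend on the
time step. -/
lemma exists_recursion (hd : SymbolIdentity d) {T : ℝ} {f : ℝ → VF d} {u₀ : VF d} {ue : ℝ → VF d}
    {pe : ℝ → L2 d} (hT : 0 < T) (hS : IsStokesSolution T f u₀ ue pe)
    (hs : IsSmoothEnough T f ue pe) (c₀ : ℝ) : ∃ c₁ Cd Cr : ℝ,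
      ∀ (τ : ℝ) (K : ℕ) (φ₀ : L2 d) (u : ℕ → VF d) (p φ : ℕ → L2 d) (hτ : 0 < τ), K * τ ≤ T →
        IsPressureScheme τ 0 K u₀ (pe 0) φ₀ u p φ → IsVelocityScheme τ K f u p φ →
        ‖pe (τ / 2) - (p 0 + φ 0)‖ ≤ c₀ * τ →
        ∃ (ρ : ℕ → Zsub d →ₗ[ℝ] ℝ) (σ : Zsub d →ₗ[ℝ] ℝ),
          (cubeForms d hτ.le).Recursion c₁ Cd Cr T τ K (fun k => toZ (velErr τ ue u k))
            (fun k => toY (exactPres τ pe k - p k)) (fun k => toY (φ k))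
            (fun k => toY (exactPres τ pe (k + 1) - exactPres τ pe k)) ρ σ := by
  obtain ⟨Cr, hCr, hres⟩ := hS.exists_residual hT hs
  obtain ⟨Cd, hCd, hpres⟩ := hs.exists_pressure_bound hT
  -- The factors `√d` come from Cauchy–Schwarz over the components.
  refine ⟨√d * c₀, Cd, √d * Cr, fun τ K φ₀ u p φ hτ hK hP hV h0 => ?_⟩
  have htime : ∀ k ≤ K, (k : ℝ) * τ ∈ Set.Icc 0 T := fun k hk =>
    ⟨by positivity, (mul_le_mul_of_nonneg_right (by exact_mod_cast hk) hτ.le).trans hK⟩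
  have hres' : ∀ (k : ℕ) (m : Fin d), ∃ R : L2 d, k < K → ‖R‖ ≤ Cr * τ ^ 2 ∧
      ModalStep τ (ue (k * τ) m) (ue ((k + 1 : ℕ) * τ) m)
        (τ • (R + (f (tHalf τ k) m - WD [m] (pe (tHalf τ k))))) := by
    intro k m
    by_cases hk : k < K
    · obtain ⟨R, hR⟩ := hres m τ k hτ (by simpa using (htime (k + 1) hk).2)
      exact ⟨R, fun _ => hR⟩
    -- The value beyond the last step is irrelevant; it only makes the choice of residuals total.
    · exact ⟨0, fun h => absurd h hk⟩
  choose R hR using hres'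
  have hZ : ∀ k ≤ K, MemZ (velErr τ ue u k) := fun k hk =>
    MemZ.sub (fun m => hs.memZ1 (htime k hk) m) (fun m => hV.memZ1 k hk m)
  have hPe : ∀ k ≤ K, MemY (exactPres τ pe k) := fun k hk => exactPres_memY hT hs hτ hK hk
  have hp : ∀ k ≤ K, MemY (p k) := hP.memY (hPe 0 (Nat.zero_le K))
  have hφ : ∀ k < K, MemY (φ (k + 1)) := fun k hk => (hP.penalty k hk).memY
  have hstep : ∀ k < K, ∀ w, form0 d (toZ (velErr τ ue u (k + 1)) - toZ (velErr τ ue u k)) w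
      + τ / 2 * form1 d (toZ (velErr τ ue u (k + 1)) + toZ (velErr τ ue u k)) w
      + τ ^ 2 / 4 * formB d τ (toZ (velErr τ ue u (k + 1)) - toZ (velErr τ ue u k)) w =
        τ * ∑ m, inner ℝ (exactPres τ pe (k + 1) - (p k + φ k)) (WD [m] (w.1 m))
          + τ * ∑ m, inner ℝ (R k m) (w.1 m) := by
    intro k hk w
    have h1 := fun m => (hPe (k + 1) hk).2 _ (yIndex_one m)
    refine ModalStep.sum_inner_eq (fun m => (h1 m).sub (hP.diff_predictor k hk m)) fun m => ?_
    rw [toZ_val (hZ _ hk.le), toZ_val (hZ _ hk), wd_sub (h1 m) (hP.diff_predictor k hk m)]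
    have e : τ • (R k m - (WD [m] (exactPres τ pe (k + 1)) - WD [m] (p k + φ k))) =
        τ • (R k m + (f (tHalf τ k) m - WD [m] (pe (tHalf τ k)))) -
          τ • (f (tHalf τ k) m - WD [m] (p k + φ k)) := by
      rw [exactPres]
      module
    rw [e]
    exact (hR k m hk).2.sub (hV.modal k hk m)
  refine ⟨fun k => pairVel (R k), pairDiv (pe (τ / 2) - (p 0 + φ 0)), ?_⟩
  have ht0 : tHalf τ 0 = τ / 2 := by
    rw [tHalf]
    push_cast
    ring
  have he0 : toZ (velErr τ ue u 0) = 0 := by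
    have : velErr τ ue u 0 = 0 := by
      rw [velErr, hP.init_u, Nat.cast_zero, zero_mul, hS.initial, sub_self]
    rw [this, toZ_zero]
  constructor
  · exact he0
  · simp only [exactPres]
    rw [hP.init_p, sub_self, toY_zero]
  · intro k hk
    refine Subtype.ext ?_
    simp only [Submodule.coe_add, Submodule.coe_sub]
    rw [toY_val ((hPe _ hk).sub (hp _ hk)), toY_val ((hPe _ hk.le).sub (hp _ hk.le)),
      toY_val ((hPe _ hk).sub (hPe _ hk.le)), toY_val (hφ k hk), hP.update k hk]
    module
  · intro k hk P
    have e := toY_val (hφ k hk)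
    have hA := hP.penalty k hk
    rw [← e] at hA
    change formDiv d _ _ = τ * formA d _ _
    rw [← hA.inner_eq hd P, formDiv_apply, toZ_val (hZ _ hk), ← sum_inner]
    -- The exact velocity is solenoidal, so the divergence of the error is minus that of `u (k +
    -- 1)`, which matches the sign in the penalty step.
    have hdiv : ∑ m, WD [m] (velErr τ ue u (k + 1) m) = -dvg (u (k + 1)) := by
      have h1 := hS.incompressible _ (htime (k + 1) hk)
      rw [← zero_sub, ← h1, dvg, dvg, ← Finset.sum_sub_distrib]
      exact Finset.sum_congr rfl fun m _ =>
        wd_sub (hS.diff_div _ (htime (k + 1) hk) m) (hP.diff_div _ hk m)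
    rw [hdiv, real_inner_smul_right, inner_neg_left, real_inner_comm]
    field_simp
  · intro k hk0 hk w
    refine (hstep k hk w).trans ?_
    -- From the second step on, `φ k` comes from a penalty step and lies in `Y`; hence the predictor
    -- error splits as `E k + δ k - φ k` within `Y`.
    obtain ⟨j, rfl⟩ : ∃ j, k = j + 1 := ⟨k - 1, by omega⟩
    change _ = τ * formDiv d _ _ + _
    rw [formDiv_apply, pairVel_apply]
    simp only [Submodule.coe_add, Submodule.coe_sub]
    rw [toY_val ((hPe _ hk.le).sub (hp _ hk.le)), toY_val ((hPe _ hk).sub (hPe _ hk.le)),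
      toY_val (hφ j (by omega))]
    congr 2
    refine Finset.sum_congr rfl fun m _ => ?_
    rw [real_inner_comm]
    congr 1
    module
  -- The given `φ 0` need not lie in `Y`, so `toY (φ 0)` carries no information; the predictor error
  -- is kept in `L²` and paired with the divergence of `w`.
  · intro hK0 w
    have h1 := hstep 0 hK0 w
    simp only [zero_add, he0, sub_zero, add_zero, exactPres, ht0] at h1
    refine h1.trans ?_
    rw [pairVel_apply, pairDiv_apply]
  · intro _ w
    refine (pairDiv_sq_le h0 w).trans_eq ?_
    simp only [mul_pow, Real.sq_sqrt (Nat.cast_nonneg d)]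
    change _ = _ * form1 d w w
    ring
  · intro k hk
    exact (hpres τ K hτ hK).1 k hk _ (toY_val ((hPe _ hk).sub (hPe _ hk.le)))
  · intro k hk0 hk
    refine (hpres τ K hτ hK).2 k hk0 hk _ ?_
    rw [Submodule.coe_sub, toY_val ((hPe _ hk).sub (hPe _ hk.le)),
      toY_val ((hPe _ hk.le).sub (hPe _ (by omega)))]
  · intro k hk w
    refine (pairVel_sq_le (fun m => (hR k m hk).1) w).trans_eq ?_
    simp only [mul_pow, Real.sq_sqrt (Nat.cast_nonneg d)]
    change _ = _ * form0 d w w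
    ring

lemma linf_le {N : ℕ} {a : ℕ → ℝ} {B : ℝ} (hB : 0 ≤ B) (h : ∀ k < N, a k ≤ B) : linf N a ≤ B :=
  Real.iSup_le (fun k => h k k.2) hB

/-- The error estimate for a scheme whose velocity step has the modal form. -/
lemma exists_errorEstimate (hd : SymbolIdentity d) {T : ℝ} {f : ℝ → VF d} {u₀ : VF d}
    {ue : ℝ → VF d} {pe : ℝ → L2 d} (hT : 0 < T) (hS : IsStokesSolution T f u₀ ue pe)
    (hs : IsSmoothEnough T f ue pe) (c₀ : ℝ) : ∃ c : ℝ,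
      ∀ (τ : ℝ) (K : ℕ) (φ₀ : L2 d) (u : ℕ → VF d) (p φ : ℕ → L2 d), 0 < τ → K * τ ≤ T →
        IsPressureScheme τ 0 K u₀ (pe 0) φ₀ u p φ → IsVelocityScheme τ K f u p φ →
        ‖pe (τ / 2) - (p 0 + φ 0)‖ ≤ c₀ * τ → ErrorEstimate c τ K ue pe u p := by
  obtain ⟨c₁, Cd, Cr, hrec⟩ := exists_recursion hd hT hS hs c₀
  obtain ⟨C, hC0, hC⟩ := Forms.Recursion.exists_bounds (V := Zsub d) (Y := Ysub d) c₁ Cd Cr T hT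
  -- Each of the five terms is at most `√C * τ`.
  refine ⟨5 * √C, fun τ K φ₀ u p φ hτ hK hP hV h0 => ?_⟩
  obtain ⟨ρ, σ, hr⟩ := hrec τ K φ₀ u p φ hτ hK hP hV h0
  obtain ⟨b0, bB, bA, bI, b1⟩ := hC hτ hK hr
  have hZ : ∀ k ≤ K, MemZ (velErr τ ue u k) := fun k hk =>
    MemZ.sub (fun m => hs.memZ1 ⟨by positivity,
      (mul_le_mul_of_nonneg_right (by exact_mod_cast hk) hτ.le).trans hK⟩ m)
      (fun m => hV.memZ1 k hk m)
  have hY : ∀ k < K, MemY (presErr τ pe p k) := fun k hk =>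
    (hs.pressure_Y.1 _ (tHalf_mem hτ hK hk)).sub
      (hP.memY (hs.pressure_Y.1 0 ⟨le_rfl, hT.le⟩) _ hk)
  have hsq : √(C * τ ^ 2) = √C * τ := by
    rw [Real.sqrt_mul hC0, Real.sqrt_sq hτ.le]
  refine ⟨hZ, hY, ?_⟩
  have n0 : linf (K + 1) (fun k => normL2 (velErr τ ue u k)) ≤ √C * τ := by
    refine linf_le (by positivity) fun k hk => ?_
    have hk' := Nat.lt_succ_iff.1 hk
    rw [← hsq, ← toZ_val (hZ k hk')]
    refine Real.le_sqrt_of_sq_le ?_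
    rw [normL2_sq]
    exact b0 k hk'
  have n1 : l2 τ (K + 1) (fun k => normH1 (velErr τ ue u k)) ≤ √C * τ := by
    rw [← hsq, l2]
    refine Real.sqrt_le_sqrt (le_trans (le_of_eq ?_) b1)
    congr 1
    refine Finset.sum_congr rfl fun k hk => ?_
    rw [← toZ_val (hZ k (Nat.lt_succ_iff.1 (Finset.mem_range.1 hk))), normH1_sq]
    rfl
  have nB : linf (K + 1) (fun k => normB τ (velErr τ ue u k)) ≤ √C := by
    refine linf_le (by positivity) fun k hk => ?_
    have hk' := Nat.lt_succ_iff.1 hk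
    rw [← toZ_val (hZ k hk')]
    refine Real.le_sqrt_of_sq_le ?_
    rw [normB_sq hτ.le]
    exact bB k hk'
  have nA : linf K (fun k => normA (presErr τ pe p k)) ≤ √C := by
    refine linf_le (by positivity) fun k hk => ?_
    rw [← toY_val (hY k hk)]
    refine Real.le_sqrt_of_sq_le ?_
    rw [normA_sq]
    exact bA (k + 1) hk
  have nI : √τ * l2 τ K (fun k => normB τ (velErrIncr τ ue u k)) ≤ √C * τ := by
    -- The two factors `√τ` combine to the power of `τ` required; the remaining sum of squared
    -- increments is bounded uniformly.
    rw [l2, Real.sqrt_mul hτ.le, ← mul_assoc, Real.mul_self_sqrt hτ.le, mul_comm]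
    refine mul_le_mul_of_nonneg_right (Real.sqrt_le_sqrt (le_trans (le_of_eq ?_) bI)) hτ.le
    refine Finset.sum_congr rfl fun k hk => ?_
    have hk' := Finset.mem_range.1 hk
    have e : velErrIncr τ ue u k =
        (toZ (velErr τ ue u (k + 1)) - toZ (velErr τ ue u k)).1 := by
      rw [Submodule.coe_sub, toZ_val (hZ _ hk'), toZ_val (hZ _ hk'.le), velErrIncr]
    rw [e, normB_sq hτ.le]
    rfl
  have nB' := mul_le_mul_of_nonneg_left nB hτ.le
  have nA' := mul_le_mul_of_nonneg_left nA hτ.le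
  linarith

end DirSplit

end

theorem mainTheorem1 :
    (∀ (T : ℝ) (f : ℝ → VF 2) (u₀ : VF 2) (ue : ℝ → VF 2) (pe : ℝ → L2 2), 0 < T →
      IsStokesSolution T f u₀ ue pe → IsSmoothEnough T f ue pe →
      ∀ c₀ : ℝ, ∃ c : ℝ, ∀ (τ : ℝ) (K : ℕ) (φ₀ : L2 2) (u uh : ℕ → VF 2) (p φ : ℕ → L2 2),
        0 < τ → (K : ℝ) * τ ≤ T →
        IsScheme2D τ 0 K f u₀ (pe 0) φ₀ u uh p φ →
        ‖pe (τ / 2) - (p 0 + φ 0)‖ ≤ c₀ * τ →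
        ErrorEstimate c τ K ue pe u p) ∧
    (∀ (T : ℝ) (f : ℝ → VF 3) (u₀ : VF 3) (ue : ℝ → VF 3) (pe : ℝ → L2 3), 0 < T →
      IsStokesSolution T f u₀ ue pe → IsSmoothEnough T f ue pe →
      ∀ c₀ : ℝ, ∃ c : ℝ, ∀ (τ : ℝ) (K : ℕ) (φ₀ : L2 3) (u ξ η ζ : ℕ → VF 3) (p φ : ℕ → L2 3),
        0 < τ → (K : ℝ) * τ ≤ T →
        IsScheme3D τ 0 K f u₀ (pe 0) φ₀ u ξ η ζ p φ →
        ‖pe (τ / 2) - (p 0 + φ 0)‖ ≤ c₀ * τ →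
        ErrorEstimate c τ K ue pe u p) := by
  constructor
  · intro T f u₀ ue pe hT hS hs c₀
    obtain ⟨c, hc⟩ := exists_errorEstimate symbolIdentity_two hT hS hs c₀
    refine ⟨c, fun τ K φ₀ u uh p φ hτ hK h h0 =>
      hc τ K φ₀ u p φ hτ hK h.toIsPressureScheme (h.isVelocityScheme hτ fun m => ?_) h0⟩
    -- The initial velocity is the exact one at time zero, from which it inherits the regularity
    -- that starts the induction.
    rw [← hS.initial]
    exact hs.memZ1 ⟨le_rfl, hT.le⟩ m
  · intro T f u₀ ue pe hT hS hs c₀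
    obtain ⟨c, hc⟩ := exists_errorEstimate symbolIdentity_three hT hS hs c₀
    refine ⟨c, fun τ K φ₀ u ξ η ζ p φ hτ hK h h0 =>
      hc τ K φ₀ u p φ hτ hK h.toIsPressureScheme (h.isVelocityScheme hτ fun m => ?_) h0⟩
    rw [← hS.initial]
    exact hs.memZ1 ⟨le_rfl, hT.le⟩ m
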